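/- **Setting.** Let $L,\tilde a>0$ with $L/\tilde a\in\mathbb N$. Indices $r,s,\alpha$ take the values $\pm$. For ${\bf k}=(k_+,k_-)\in\mathbb R^2$ let $k_s,k_{-s}$ be the components along the unit vectors ${\bf e}_s,{\bf e}_{-s}$. Put $$\Lambda_{1D}=\{x\in\tilde a\mathbb Z: -\tfrac L2\le x<\tfrac L2\},\qquad \Lambda_s^*=\{{\bf k}\in\tfrac{2\pi}{L}(\mathbb Z+\tfrac12)^2: -\tfrac{\pi}{\tilde a}\le k_{-s}<\tfrac{\pi}{\tilde a}\},$$ $$\hat\Lambda_s^*=\{{\bf p}\in\tfrac{2\pi}{L}\mathbb Z^2: -\tfrac{\pi}{\tilde a}\le p_{-s}<\tfrac{\pi}{\tilde a},\ p_s\ne0\},\qquad \tilde\Lambda_{1D}^*=\{p\in\tfrac{2\pi}L\mathbb Z:-\tfrac{\pi}{\tilde a}\le p<\tfrac{\pi}{\tilde a}\}.$$ Let $\mathcal F$ be the fermion Fock space with normalized Dirac vacuum $\Omega$ and fermion operators $c_{r,s,x,\alpha}(k)$, $x\in\Lambda_{1D}$, $k\in\frac{2\pi}L(\mathbb Z+\frac12)$,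 satisfying the canonical anticommutation relations and $c_{r,s,x,\alpha}(k)\Omega=c_{r,s,x,\alpha}(-k)^\dagger\Omega=0$ for $rk>0$; $\mathcal F$ has an orthonormal basis consisting, up to signs, of the vectors obtained by applying to $\Omega$ finitely many distinct operators among the $c(k)^\dagger$ with $rk>0$ and the $c(k)$ with $rk<0$. Let $\mathcal D\subset\mathcal F$ be the linear span of this basis (a dense subspace). All unbounded operators below, and their adjoints, are defined on $\mathcal D$ and map it to itself, and relations between them are identities on $\mathcal D$. Define, for ${\bf k}\in\Lambda_s^*$, $$\hat\psi_{r,s,\alpha}({\bf k})=\frac{L}{2\pi}\sqrt{\frac{\tilde a}{L}}\sum_{x\in\Lambda_{1D}}c_{r,s,x,\alpha}(k_s)\,e^{-ik_{-s}x},$$ and, with $\sigma^0$ the unit matrix, $\sigma^3=\mathrm{diag}(1,-1)$, $:\!\mathcal O\!:\,=\mathcal O-\langle\Omega,\mathcal O\Omega\rangle$, ${\bf p}\in\frac{2\pi}L\mathbb Z^2$ and $\mu=0,3$, $$\hat J^\mu_{r,s}({\bf p})=\sum_{\alpha,\beta}\ \sum_{{\bf k}_1,{\bf k}_2\in\Lambda_s^*}\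 \sum_{n\in\mathbb Z}\Bigl(\frac{2\pi}L\Bigr)^2:\!\hat\psi_{r,s,\alpha}^\dagger({\bf k}_1)\sigma^\mu_{\alpha\beta}\hat\psi_{r,s,\beta}({\bf k}_2)\!:\ \delta_{{\bf k}_1+{\bf p},\,{\bf k}_2+2\pi n{\bf e}_{-s}/\tilde a},\qquad \hat J_{r,s,\alpha}=\tfrac12\bigl(\hat J^0_{r,s}+\alpha\hat J^3_{r,s}\bigr).$$ The boson operators are, for ${\bf p}\in\hat\Lambda_s^*$, $$b_{s,\alpha}({\bf p})=-\frac iL\sqrt{\frac{2\pi\tilde a}{|p_s|}}\,\hat J_{+,s,\alpha}({\bf p})\ \text{ if }p_s>0,\qquad b_{s,\alpha}({\bf p})=\frac iL\sqrt{\frac{2\pi\tilde a}{|p_s|}}\,\hat J_{-,s,\alpha}({\bf p})\ \text{ if }p_s<0,$$ and the zero modes are, for $x\in\Lambda_{1D}$, $$N_{r,s,\alpha}(x)=\sqrt{2\pi\tilde a}\sum_{p\in\tilde\Lambda_{1D}^*}\frac1L\,\hat N_{r,s,\alpha}(p)\,e^{ipx},\qquad \hat N_{r,s,\alpha}(p_{-s})=\sqrt{\frac{\tilde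 a}{2\pi}}\;\hat J_{r,s,\alpha}({\bf p})\Big|_{p_s=0}.$$ **Lemma.** **(a)** There exist unitary operators $R_{r,s,\alpha}(x)$ on $\mathcal F$ (indexed by $r,s,\alpha=\pm$, $x\in\Lambda_{1D}$), mapping $\mathcal D$ onto itself, commuting with all $b_{s',\alpha'}({\bf p})$ and $b_{s',\alpha'}({\bf p})^\dagger$, and satisfying $$[N_{r,s,\alpha}(x),R_{r',s',\alpha'}(x')]=r\,\delta_{r,r'}\delta_{s,s'}\delta_{\alpha,\alpha'}\delta_{x,x'}R_{r,s,\alpha}(x),\qquad \{R_{r,s,\alpha}(x),R_{r',s',\alpha'}(x')^\dagger\}=2\,\delta_{r,r'}\delta_{s,s'}\delta_{\alpha,\alpha'}\delta_{x,x'}.$$ Moreover, for every such family, and for every fixed ordering of the product of the (anticommuting) operators $R$ below: **(b)** Let $\mathcal Q$ be the set of all pairs $({\bf n},\boldsymbol\nu)$ of families of integers $n_{s,\alpha}({\bf p})\ge0$ ($s,\alpha=\pm$, ${\bf p}\in\hat\Lambda_s^*$) and $\nu_{r,s,\alpha}(x)\in\mathbb Z$ ($r,s,\alpha=\pm$, $x\in\Lambda_{1D}$)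 with $$\sum_{r,s,\alpha}\sum_x\nu_{r,s,\alpha}(x)^2<\infty,\qquad \sum_{s,\alpha}\sum_{{\bf p}\in\hat\Lambda_s^*}|p_s|\,n_{s,\alpha}({\bf p})<\infty.$$ Then the states $$\eta_{{\bf n},\boldsymbol\nu}=\Bigl(\prod_{\alpha,s=\pm}\ \prod_{{\bf p}\in\hat\Lambda_s^*}\frac{b_{s,\alpha}^\dagger({\bf p})^{n_{s,\alpha}({\bf p})}}{\sqrt{n_{s,\alpha}({\bf p})!}}\Bigr)\Bigl(\prod_{\alpha,r,s=\pm}\ \prod_{x\in\Lambda_{1D}}R_{r,s,\alpha}(x)^{\nu_{r,s,\alpha}(x)}\Bigr)\Omega,\qquad({\bf n},\boldsymbol\nu)\in\mathcal Q,$$ form a complete orthonormal basis of $\mathcal F$. **(c)** Each $\eta_{{\bf n},\boldsymbol\nu}$ is a common eigenvector of all operators $N_{r,s,\alpha}(x)$ and $b_{s,\alpha}^\dagger({\bf p})b_{s,\alpha}({\bf p})$, with eigenvalues $r\,\nu_{r,s,\alpha}(x)$ and $n_{s,\alpha}({\bf p})$, respectively. -/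

import Mathlib

noncomputable section

namespace Fock

/-!
### Fermion Fock space over a linearly ordered set of modes, in the occupation number representation

The Fock space is `ℓ²` of the set of all finite sets `S` of modes; the orthonormal vector labelled by
`S` is the state in which exactly the modes of `S` are excited. The vectors with finitely many
non-zero components form the dense core, a common invariant domain of all unbounded operators below.
-/

/-- The dense subspace of the Fock space spanned by the occupation number states. -/
abbrev Core (ι : Type) : Type := Finset ι →₀ ℂ

/-- The fermion Fock space (a Hilbert space). -/
abbrev Space (ι : Type) : Type := lp (fun _ : Finset ι => ℂ) 2

/-- The occupation number state in which exactly the modes in `S` are excited. -/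
def ket {ι : Type} (S : Finset ι) : Core ι := Finsupp.single S 1

/-- The normalized vacuum state. -/
def vacuum {ι : Type} : Core ι := ket ∅

/-- The inclusion of the core in the Fock space. -/
def toSpace {ι : Type} : Core ι →ₗ[ℂ] Space ι :=
  Finsupp.linearCombination ℂ fun S =>
    open Classical in (lp.single 2 S (1 : ℂ) : lp (fun _ : Finset ι => ℂ) 2)

/-- The Jordan-Wigner sign: `-1` to the power of the number of excited modes preceding `i`. -/
def sign {ι : Type} [LinearOrder ι] (i : ι) (S : Finset ι) : ℂ := (-1) ^ (S.filter (· < i)).card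

/-- The operator removing an excitation of the mode `i`. -/
def annihilate {ι : Type} [LinearOrder ι] (i : ι) : Module.End ℂ (Core ι) :=
  Finsupp.linearCombination ℂ fun S => if i ∈ S then sign i S • ket (S.erase i) else 0

/-- The operator adding an excitation of the mode `i`, the adjoint of `annihilate i`. -/
def create {ι : Type} [LinearOrder ι] (i : ι) : Module.End ℂ (Core ι) :=
  Finsupp.linearCombination ℂ fun S => if i ∈ S then 0 else sign i S • ket (insert i S)

/-- The vacuum expectation value `⟨Ω, T Ω⟩`. -/
def vev {ι : Type} (T : Module.End ℂ (Core ι)) : ℂ :=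
  inner ℂ (toSpace (vacuum : Core ι)) (toSpace (T vacuum))

/-- Fermion normal ordering `:T: = T - ⟨Ω, T Ω⟩` of a fermion bilinear `T`. -/
def normalOrder {ι : Type} (T : Module.End ℂ (Core ι)) : Module.End ℂ (Core ι) :=
  T - vev T • (1 : Module.End ℂ (Core ι))

/-- A unitary operator on the Fock space that maps the core onto itself, together with its
restriction to the core. -/
structure CoreUnitary (ι : Type) where
  /-- the unitary operator -/
  op : unitary (Space ι →L[ℂ] Space ι)
  /-- its restriction to the core -/
  onCore : Core ι ≃ₗ[ℂ] Core ι
  op_toSpace : ∀ v : Core ι, (op : Space ι →L[ℂ] Space ι) (toSpace v) = toSpace (onCore v)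

/-- The restriction of a `CoreUnitary` to the core, as an endomorphism of the core. -/
def CoreUnitary.toEnd {ι : Type} (U : CoreUnitary ι) : Module.End ℂ (Core ι) := U.onCore.toLinearMap

end Fock

namespace Nodal

open Fock

/-!
### Nodal fermions

`L > 0` is the system size and `a > 0` the lattice constant `ã`, with `L / a` a positive integer.
The indices `r`, `s`, `α` take the values `±`, i.e. `±1 : ℤˣ`. A vector of `ℝ²` is given by its
components `k s`, `s = ±`, in the directions `e₊` and `e₋`.
-/

/-- `Λ_1D`. -/
def lattice (L a : ℝ) : Set ℝ :=
  {x | (∃ j : ℤ, x = a * j) ∧ -(L / 2) ≤ x ∧ x < L / 2}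

/-- The 1D fermion momenta `(2π/L)(ℤ + 1/2)`. -/
def fermiMomenta (L : ℝ) : Set ℝ := {k | ∃ j : ℤ, k = 2 * Real.pi / L * (j + 1 / 2)}

/-- The nodal fermion momenta `Λ_s^*`. -/
def nodalMomenta (L a : ℝ) (s : ℤˣ) : Set (ℤˣ → ℝ) :=
  {k | (∀ t, k t ∈ fermiMomenta L) ∧ -(Real.pi / a) ≤ k (-s) ∧ k (-s) < Real.pi / a}

/-- The boson momenta `p ∈ (2π/L)ℤ²` with `-π/ã ≤ p_{-s} < π/ã` and `p_s ≠ 0`. -/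
def bosonMomenta (L a : ℝ) (s : ℤˣ) : Set (ℤˣ → ℝ) :=
  {p | (∀ t, ∃ j : ℤ, p t = 2 * Real.pi / L * j) ∧
    (-(Real.pi / a) ≤ p (-s) ∧ p (-s) < Real.pi / a) ∧ p s ≠ 0}

/-- The 1D momenta `p ∈ (2π/L)ℤ` with `-π/ã ≤ p < π/ã`. -/
def zeroModeMomenta (L a : ℝ) : Set ℝ :=
  {p | (∃ j : ℤ, p = 2 * Real.pi / L * j) ∧ -(Real.pi / a) ≤ p ∧ p < Real.pi / a}

/-- The flavor indices `(r, s, α, x)`. -/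
@[ext] structure Flavor (L a : ℝ) where
  r : ℤˣ
  s : ℤˣ
  α : ℤˣ
  x : lattice L a

/-- The one-particle modes: a flavor and a 1D momentum. -/
@[ext] structure Mode (L a : ℝ) where
  flavor : Flavor L a
  k : fermiMomenta L

/-- The lexicographic ordering of the modes (used only for the Jordan-Wigner signs). -/
instance (L a : ℝ) : LinearOrder (Mode L a) :=
  LinearOrder.lift' (fun m : Mode L a => toLex (m.flavor.r, toLex (m.flavor.s, toLex (m.flavor.α,
      toLex ((m.flavor.x : ℝ), (m.k : ℝ)))))) (by
    intro m m' h
    simp only [EmbeddingLike.apply_eq_iff_eq, Prod.mk.injEq, Subtype.coe_inj] at h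
    exact Mode.ext (Flavor.ext h.1 h.2.1 h.2.2.1 h.2.2.2.1) h.2.2.2.2)

/-- Operators on the core of the fermion Fock space of the nodal fermions. -/
abbrev Op (L a : ℝ) : Type := Module.End ℂ (Core (Mode L a))

/-- The fermion operator `c_{r,s,x,α}(k)`. Excitations of the Dirac sea are particles if `r k > 0`
and holes if `r k < 0`; so `c(k) Ω = 0` for `r k > 0` and `c(k)† Ω = 0` for `r k < 0`. -/
def c {L a : ℝ} (m : Mode L a) : Op L a :=
  if 0 < ((m.flavor.r : ℤ) : ℝ) * m.k then annihilate m else create m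

/-- The fermion operator `c_{r,s,x,α}(k)†`. -/
def cDag {L a : ℝ} (m : Mode L a) : Op L a :=
  if 0 < ((m.flavor.r : ℤ) : ℝ) * m.k then create m else annihilate m

/-- `ψ_{r,s,α}(k) = (L/2π) √(ã/L) ∑_x c_{r,s,x,α}(k_s) exp(-i k_{-s} x)`. -/
def ψ {L a : ℝ} (r s α : ℤˣ) (k : nodalMomenta L a s) : Op L a :=
  ((L / (2 * Real.pi) * √(a / L) : ℝ) : ℂ) • ∑ᶠ x : lattice L a,
    Complex.exp (-(Complex.I * (k.1 (-s) : ℂ) * (x : ℂ))) • c ⟨⟨r, s, α, x⟩, ⟨k.1 s, k.2.1 s⟩⟩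

/-- `ψ_{r,s,α}(k)†`. -/
def ψDag {L a : ℝ} (r s α : ℤˣ) (k : nodalMomenta L a s) : Op L a :=
  ((L / (2 * Real.pi) * √(a / L) : ℝ) : ℂ) • ∑ᶠ x : lattice L a,
    Complex.exp (Complex.I * (k.1 (-s) : ℂ) * (x : ℂ)) • cDag ⟨⟨r, s, α, x⟩, ⟨k.1 s, k.2.1 s⟩⟩

/-- `∑_{α,β} (2π/L)² σ_{α,β} :ψ_{r,s,α}(k₁)† ψ_{r,s,β}(k₂):`. -/
def bilinear {L a : ℝ} (σ : ℤˣ → ℤˣ → ℂ) (r s : ℤˣ) (k₁ k₂ : nodalMomenta L a s) : Op L a :=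
  ∑ α : ℤˣ, ∑ β : ℤˣ, (((2 * Real.pi / L) ^ 2 : ℝ) * σ α β : ℂ) •
    normalOrder (ψDag r s α k₁ * ψ r s β k₂)

/-- The triples `(k₁, k₂, n)` with `k₁ + p = k₂ + 2π n e_{-s} / ã`. -/
def transfer (L a : ℝ) (s : ℤˣ) (p : ℤˣ → ℝ) :
    Set (nodalMomenta L a s × nodalMomenta L a s × ℤ) :=
  {t | t.1.1 + p = t.2.1.1 + Pi.single (-s) (2 * Real.pi * t.2.2 / a)}

/-- The nodal density- and spin operator
`∑_{α,β} ∑_{k₁,k₂} ∑_n (2π/L)² :ψ_{r,s,α}(k₁)† σ_{α,β} ψ_{r,s,β}(k₂): δ(k₁ + p, k₂ + 2π n e_{-s}/ã)`.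
Only finitely many terms do not vanish on a given occupation number state. -/
def J {L a : ℝ} (σ : ℤˣ → ℤˣ → ℂ) (r s : ℤˣ) (p : ℤˣ → ℝ) : Op L a :=
  Finsupp.linearCombination ℂ fun S =>
    ∑ᶠ t : transfer L a s p, bilinear σ r s t.1.1 t.1.2.1 (ket S)

/-- The adjoint of `J σ r s p` for a hermitian matrix `σ`: the sum of the adjoint terms. -/
def JDag {L a : ℝ} (σ : ℤˣ → ℤˣ → ℂ) (r s : ℤˣ) (p : ℤˣ → ℝ) : Op L a :=
  Finsupp.linearCombination ℂ fun S =>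
    ∑ᶠ t : transfer L a s p, bilinear σ r s t.1.2.1 t.1.1 (ket S)

/-- The unit matrix `σ⁰`. -/
def σ₀ (α β : ℤˣ) : ℂ := if α = β then 1 else 0

/-- The Pauli matrix `σ³`. -/
def σ₃ (α β : ℤˣ) : ℂ := if α = β then ((α : ℤ) : ℂ) else 0

/-- The spin-dependent density `J_{r,s,α}(p) = (J⁰_{r,s}(p) + α J³_{r,s}(p)) / 2`. -/
def density {L a : ℝ} (r s α : ℤˣ) (p : ℤˣ → ℝ) : Op L a :=
  (1 / 2 : ℂ) • (J σ₀ r s p + ((α : ℤ) : ℂ) • J σ₃ r s p)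

/-- `J_{r,s,α}(p)†`. -/
def densityDag {L a : ℝ} (r s α : ℤˣ) (p : ℤˣ → ℝ) : Op L a :=
  (1 / 2 : ℂ) • (JDag σ₀ r s p + ((α : ℤ) : ℂ) • JDag σ₃ r s p)

/-- The indices `(s, α, p)` of the 2D boson operators. -/
@[ext] structure BosonMode (L a : ℝ) where
  s : ℤˣ
  α : ℤˣ
  p : bosonMomenta L a s

/-- The component `p_s`. -/
def BosonMode.ps {L a : ℝ} (m : BosonMode L a) : ℝ := m.p.1 m.s

/-- The boson annihilation operator `b_{s,α}(p)`. -/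
def b {L a : ℝ} (m : BosonMode L a) : Op L a :=
  if 0 < m.ps then
    (-(Complex.I / (L : ℂ)) * (√(2 * Real.pi * a / |m.ps|) : ℝ)) • density 1 m.s m.α m.p
  else
    ((Complex.I / (L : ℂ)) * (√(2 * Real.pi * a / |m.ps|) : ℝ)) • density (-1) m.s m.α m.p

/-- The boson creation operator `b_{s,α}(p)†`. -/
def bDag {L a : ℝ} (m : BosonMode L a) : Op L a :=
  if 0 < m.ps then
    ((Complex.I / (L : ℂ)) * (√(2 * Real.pi * a / |m.ps|) : ℝ)) • densityDag 1 m.s m.α m.p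
  else
    (-(Complex.I / (L : ℂ)) * (√(2 * Real.pi * a / |m.ps|) : ℝ)) • densityDag (-1) m.s m.α m.p

/-- `√(ã/2π) J_{r,s,α}(p)` at the momentum `p` with `p_s = 0` and `p_{-s} = q`. -/
def zeroModeHat {L a : ℝ} (r s α : ℤˣ) (q : ℝ) : Op L a :=
  ((√(a / (2 * Real.pi)) : ℝ) : ℂ) • density r s α (Pi.single (-s) q)

/-- The zero mode `N_{r,s,α}(x) = √(2πã) ∑_p (1/L) N_{r,s,α}(p) exp(i p x)`. -/
def zeroMode {L a : ℝ} (f : Flavor L a) : Op L a :=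
  ((√(2 * Real.pi * a) : ℝ) : ℂ) • ∑ᶠ q : zeroModeMomenta L a,
    ((1 / L : ℂ) * Complex.exp (Complex.I * (q : ℂ) * (f.x : ℂ))) • zeroModeHat f.r f.s f.α q

/-- The Klein factor relations: `R_{r,s,α}(x)` are unitary operators commuting with all boson
operators, with `[N, R'] = r δ R` and `{R, R'†} = 2 δ`. -/
structure IsKleinFamily {L a : ℝ} (R : Flavor L a → CoreUnitary (Mode L a)) : Prop where
  commute_b : ∀ f m, Commute (b m) (R f).toEnd
  commute_bDag : ∀ f m, Commute (bDag m) (R f).toEnd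
  zeroMode_commutator : ∀ f f' : Flavor L a,
    zeroMode f * (R f').toEnd - (R f').toEnd * zeroMode f =
      open Classical in if f = f' then ((f.r : ℤ) : ℂ) • (R f).toEnd else 0
  anticommutator : ∀ f f' : Flavor L a,
    ((R f).op : Space (Mode L a) →L[ℂ] Space (Mode L a)) * star ((R f').op : _ →L[ℂ] _) +
      star ((R f').op : Space (Mode L a) →L[ℂ] Space (Mode L a)) * ((R f).op : _ →L[ℂ] _) =
      open Classical in if f = f' then 2 else 0

/-- The set of pairs `(n, ν)` with `∑ ν² < ∞` and `∑ |p_s| n_{s,α}(p) < ∞`. -/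
def occupations (L a : ℝ) : Set ((BosonMode L a → ℕ) × (Flavor L a → ℤ)) :=
  {q | Summable (fun f => (q.2 f : ℝ) ^ 2) ∧ Summable fun m => |m.ps| * (q.1 m : ℝ)}

/-- `∏ (b_{s,α}(p)†) ^ n_{s,α}(p) / √(n_{s,α}(p)!)` over the (finitely many, for the `n` considered)
boson modes with `n_{s,α}(p) ≠ 0`. These factors commute, so their order is irrelevant. -/
def bosonProduct {L a : ℝ} (n : BosonMode L a → ℕ) : Op L a :=
  open Classical in
  if h : (Function.support n).Finite then
    (h.toFinset.toList.map fun m =>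
      ((1 / √((n m).factorial : ℝ) : ℝ) : ℂ) • (bDag m) ^ n m).prod
  else 0

/-- The state `η_{n,ν}`; the Klein factors, which anticommute, are multiplied in the order given by
the list `o` of all flavors. -/
def η {L a : ℝ} (R : Flavor L a → CoreUnitary (Mode L a)) (o : List (Flavor L a))
    (n : BosonMode L a → ℕ) (ν : Flavor L a → ℤ) : Core (Mode L a) :=
  bosonProduct n ((o.map fun f => (R f).onCore ^ ν f).prod vacuum)

end Nodal

/-!
### Consistency of the definitions

Proved below: the canonical anticommutation relations, the finiteness of the sums defining `J` and
`JDag` on every occupation number state, and the fact that `bDag m` is the adjoint of `b m`.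
-/

namespace Fock

theorem annihilate_ket {ι : Type} [LinearOrder ι] (i : ι) (S : Finset ι) :
    annihilate i (ket S) = if i ∈ S then sign i S • ket (S.erase i) else 0 := by
  simp [annihilate, ket]

theorem create_ket {ι : Type} [LinearOrder ι] (i : ι) (S : Finset ι) :
    create i (ket S) = if i ∈ S then 0 else sign i S • ket (insert i S) := by
  simp [create, ket]

theorem ext_ket {ι : Type} {M : Type} [AddCommMonoid M] [Module ℂ M] {T T' : Core ι →ₗ[ℂ] M}
    (h : ∀ S, T (ket S) = T' (ket S)) : T = T' :=
  Finsupp.lhom_ext' fun S => LinearMap.ext_ring (h S)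

theorem sign_insert {ι : Type} [LinearOrder ι] (i j : ι) (S : Finset ι) (hj : j ∉ S) :
    sign i (insert j S) = (if j < i then -1 else 1) * sign i S := by
  unfold sign
  rw [Finset.filter_insert]
  split_ifs with h
  · rw [Finset.card_insert_of_notMem (by simp [hj]), pow_succ]; ring
  · simp

theorem sign_mul_self {ι : Type} [LinearOrder ι] (i : ι) (S : Finset ι) :
    sign i S * sign i S = 1 := by
  unfold sign
  rw [← mul_pow]; simp

/-- The canonical anticommutation relations. -/
theorem anticomm {ι : Type} [LinearOrder ι] (i j : ι) :
    annihilate i * create j + create j * annihilate i =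
      (if i = j then 1 else 0 : Module.End ℂ (Core ι)) := by
  refine ext_ket fun S => ?_
  simp only [LinearMap.add_apply, Module.End.mul_apply]
  by_cases hij : i = j
  · subst hij
    by_cases hi : i ∈ S
    · have h1 : sign i (S.erase i) = sign i S := by
        conv_rhs => rw [← Finset.insert_erase hi, sign_insert _ _ _ (by simp)]
        simp
      simp [annihilate_ket, create_ket, hi, h1, smul_smul, sign_mul_self]
    · simp [annihilate_ket, create_ket, hi, sign_insert, smul_smul, sign_mul_self]
  · rw [if_neg hij, create_ket, annihilate_ket]
    by_cases hi : i ∈ S <;> by_cases hj : j ∈ S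
    · simp [hi, hj, create_ket, Ne.symm hij]
    · simp only [hi, hj, if_true, if_false, map_smul, annihilate_ket, create_ket,
        Finset.mem_insert, Finset.mem_erase, or_true, and_false, smul_smul]
      have h1 : sign j S = (if i < j then -1 else 1) * sign j (S.erase i) := by
        conv_lhs => rw [← Finset.insert_erase hi, sign_insert _ _ _ (by simp)]
      rw [sign_insert _ _ _ hj, h1, Finset.erase_insert_of_ne (Ne.symm hij)]
      rcases lt_or_gt_of_ne hij with h | h
      · simp [h, h.not_gt, mul_comm]
      · simp [h, h.not_gt, mul_comm]
    · simp [hi, hj]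
    · simp [hi, hj, annihilate_ket, hij]

/-- `T'` is the adjoint of `T` on the core. -/
def IsAdj {ι : Type} (T T' : Module.End ℂ (Core ι)) : Prop :=
  ∀ v w, inner ℂ (toSpace (T' v)) (toSpace w) = inner ℂ (toSpace v) (toSpace (T w))

theorem inner_ket {ι : Type} (S T : Finset ι) [Decidable (S = T)] :
    inner ℂ (toSpace (ket S)) (toSpace (ket T)) = if S = T then (1 : ℂ) else 0 := by
  classical
  simp only [toSpace, ket, Finsupp.linearCombination_single, one_smul]
  rw [lp.inner_single_left]
  simp [lp.single_apply, Pi.single_apply]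

theorem isAdj_of_ket {ι : Type} {T T' : Module.End ℂ (Core ι)}
    (h : ∀ S U, inner ℂ (toSpace (T' (ket S))) (toSpace (ket U)) =
      inner ℂ (toSpace (ket S)) (toSpace (T (ket U)))) : IsAdj T T' := by
  intro v w
  induction v using Finsupp.induction_linear with
  | zero => simp
  | add v v' hv hv' => simp only [map_add, inner_add_left, hv, hv']
  | single S x =>
    have e : Finsupp.single S x = x • ket S := by simp [ket]
    simp only [e, map_smul, inner_smul_left]
    congr 1
    induction w using Finsupp.induction_linear with
    | zero => simp
    | add v v' hv hv' => simp only [map_add, inner_add_right, hv, hv']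
    | single U y =>
      have e : Finsupp.single U y = y • ket U := by simp [ket]
      simp only [e, map_smul, inner_smul_right, h]

theorem IsAdj.symm {ι : Type} {T T' : Module.End ℂ (Core ι)} (h : IsAdj T T') : IsAdj T' T := by
  intro v w
  have := congrArg (starRingEnd ℂ) (h w v)
  simpa using this.symm

theorem IsAdj.smul {ι : Type} {T T' : Module.End ℂ (Core ι)} (h : IsAdj T T') (x : ℂ) :
    IsAdj (x • T) (starRingEnd ℂ x • T') := by
  intro v w
  simp only [LinearMap.smul_apply, map_smul, inner_smul_left, inner_smul_right, h v w,
    Complex.conj_conj]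

theorem IsAdj.add {ι : Type} {T T' U U' : Module.End ℂ (Core ι)} (h : IsAdj T T')
    (h' : IsAdj U U') : IsAdj (T + U) (T' + U') := by
  intro v w
  simp only [LinearMap.add_apply, map_add, inner_add_left, inner_add_right, h v w, h' v w]

theorem IsAdj.mul {ι : Type} {T T' U U' : Module.End ℂ (Core ι)} (h : IsAdj T T')
    (h' : IsAdj U U') : IsAdj (T * U) (U' * T') := by
  intro v w
  simp [h _ _, h' _ _]

theorem IsAdj.one {ι : Type} : IsAdj (1 : Module.End ℂ (Core ι)) 1 := fun _ _ => rfl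

theorem IsAdj.sum {ι κ : Type} (s : Finset κ) (T T' : κ → Module.End ℂ (Core ι))
    (h : ∀ i, IsAdj (T i) (T' i)) : IsAdj (∑ i ∈ s, T i) (∑ i ∈ s, T' i) := by
  classical
  induction s using Finset.induction_on with
  | empty => intro v w; simp
  | insert a s ha ih => rw [Finset.sum_insert ha, Finset.sum_insert ha]; exact (h a).add ih

theorem IsAdj.vev {ι : Type} {T T' : Module.End ℂ (Core ι)} (h : IsAdj T T') :
    vev T' = starRingEnd ℂ (vev T) := by
  unfold Fock.vev
  rw [← h, inner_conj_symm]

theorem IsAdj.normalOrder {ι : Type} {T T' : Module.End ℂ (Core ι)} (h : IsAdj T T') :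
    IsAdj (normalOrder T) (normalOrder T') := by
  unfold Fock.normalOrder
  rw [h.vev]
  intro v w
  have := IsAdj.one.smul (Fock.vev T) v w
  simp only [LinearMap.sub_apply, map_sub, inner_sub_left, inner_sub_right, h v w, this]

theorem isAdj_create {ι : Type} [LinearOrder ι] (i : ι) : IsAdj (annihilate i) (create i) := by
  refine isAdj_of_ket fun S U => ?_
  rw [annihilate_ket, create_ket]
  have hs : ∀ S : Finset ι, starRingEnd ℂ (sign i S) = sign i S := by simp [sign]
  by_cases hi : i ∈ S <;> by_cases hu : i ∈ U
  · simp only [hi, hu, if_true, map_zero, inner_zero_left, map_smul, inner_smul_right, inner_ket]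
    rw [if_neg]; · simp
    rintro rfl; simp at hi
  · simp [hi, hu]
  · simp only [hi, hu, if_true, if_false, map_smul, inner_smul_left, inner_smul_right, inner_ket]
    by_cases h : insert i S = U
    · subst h
      simp [hi, hs, sign_insert]
    · rw [if_neg h, if_neg]; · simp
      rintro rfl; exact h (Finset.insert_erase hu)
  · simp only [hi, hu, if_false, map_zero, inner_zero_right, map_smul, inner_smul_left, inner_ket]
    rw [if_neg]; · simp
    rintro rfl; simp at hu

end Fock

namespace Nodal
open Fock

theorem isAdj_c {L a : ℝ} (m : Mode L a) : IsAdj (c m) (cDag m) := by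
  unfold c cDag
  split_ifs
  · exact isAdj_create m
  · exact (isAdj_create m).symm

theorem finite_lattice {L a : ℝ} (ha : 0 < a) : Finite (lattice L a) := by
  have : (lattice L a) ⊆ (fun j : ℤ => a * j) '' Set.Icc ⌊-(L/2)/a⌋ ⌈L/2/a⌉ := by
    rintro x ⟨⟨j, rfl⟩, h1, h2⟩
    refine ⟨j, ⟨?_, ?_⟩, rfl⟩
    · have : -(L/2)/a ≤ j := by rw [div_le_iff₀ ha]; linarith
      exact_mod_cast (Int.floor_le _).trans this
    · have : (j:ℝ) ≤ L/2/a := by rw [le_div_iff₀ ha]; linarith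
      exact_mod_cast this.trans (Int.le_ceil _)
  exact ((Set.finite_Icc _ _).image _).subset this

theorem isAdj_ψ {L a : ℝ} (ha : 0 < a) (r s α : ℤˣ) (k : nodalMomenta L a s) :
    IsAdj (ψ r s α k) (ψDag r s α k) := by
  have := finite_lattice (L := L) ha
  have := Fintype.ofFinite (lattice L a)
  unfold ψ ψDag
  rw [finsum_eq_sum_of_fintype, finsum_eq_sum_of_fintype]
  convert (IsAdj.sum Finset.univ _ _ fun x : lattice L a =>
    (isAdj_c ⟨⟨r, s, α, x⟩, ⟨k.1 s, k.2.1 s⟩⟩).smul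
      (Complex.exp (-(Complex.I * (k.1 (-s) : ℂ) * (x : ℂ))))).smul
    ((L / (2 * Real.pi) * √(a / L) : ℝ) : ℂ) using 2
  · exact (Complex.conj_ofReal _).symm
  · refine Finset.sum_congr rfl fun x _ => ?_
    rw [← Complex.exp_conj]
    simp

theorem isAdj_bilinear {L a : ℝ} (ha : 0 < a) (σ : ℤˣ → ℤˣ → ℂ)
    (hσ : ∀ α β, σ β α = starRingEnd ℂ (σ α β)) (r s : ℤˣ)
    (k₁ k₂ : nodalMomenta L a s) :
    IsAdj (bilinear σ r s k₁ k₂) (bilinear σ r s k₂ k₁) := by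
  unfold bilinear
  rw [Finset.sum_comm]
  refine IsAdj.sum _ _ _ fun α => IsAdj.sum _ _ _ fun β => ?_
  convert IsAdj.smul (((isAdj_ψ ha r s β k₁).symm.mul (isAdj_ψ ha r s α k₂)).normalOrder) _ using 2
  rw [hσ β α, map_mul, Complex.conj_ofReal]

theorem anticomm_ψ {L a : ℝ} (ha : 0 < a) (r s α β : ℤˣ) (k₁ k₂ : nodalMomenta L a s)
    (h1 : ((r : ℤ) : ℝ) * k₁.1 s < 0) (h2 : ((r : ℤ) : ℝ) * k₂.1 s < 0) :
    ∃ z : ℂ, ψDag r s α k₁ * ψ r s β k₂ = z • (1 : Op L a) - ψ r s β k₂ * ψDag r s α k₁ := by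
  have := finite_lattice (L := L) ha
  have := Fintype.ofFinite (lattice L a)
  have key : ∀ m m' : Mode L a, ((m.flavor.r : ℤ) : ℝ) * m.k < 0 →
      ((m'.flavor.r : ℤ) : ℝ) * m'.k < 0 → ∃ z : ℂ,
      cDag m * c m' + c m' * cDag m = z • (1 : Op L a) := by
    intro m m' h h'
    unfold c cDag
    rw [if_neg h.not_gt, if_neg h'.not_gt, anticomm]
    refine ⟨if m = m' then 1 else 0, ?_⟩
    split_ifs <;> simp
  have key' := fun x y : lattice L a => key ⟨⟨r, s, α, x⟩, ⟨k₁.1 s, k₁.2.1 s⟩⟩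
    ⟨⟨r, s, β, y⟩, ⟨k₂.1 s, k₂.2.1 s⟩⟩ h1 h2
  choose z hz using key'
  suffices h : ∃ z : ℂ, ψDag r s α k₁ * ψ r s β k₂ + ψ r s β k₂ * ψDag r s α k₁ =
      z • (1 : Op L a) from h.imp fun z hz => (eq_sub_iff_add_eq (G := Op L a)).2 hz
  unfold ψ ψDag
  rw [finsum_eq_sum_of_fintype, finsum_eq_sum_of_fintype]
  simp only [Finset.smul_sum, Finset.sum_mul_sum, smul_mul_smul_comm, smul_smul]
  rw [Finset.sum_comm (s := (Finset.univ : Finset (lattice L a)))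
    (f := fun y x => _ • (c _ * cDag _)), ← Finset.sum_add_distrib]
  simp only [← Finset.sum_add_distrib]
  refine ⟨∑ x : lattice L a, ∑ y : lattice L a, ((L / (2 * Real.pi) * √(a / L) : ℝ) : ℂ) *
    Complex.exp (Complex.I * (k₁.1 (-s) : ℂ) * (x : ℂ)) *
    (((L / (2 * Real.pi) * √(a / L) : ℝ) : ℂ) *
    Complex.exp (-(Complex.I * (k₂.1 (-s) : ℂ) * (y : ℂ)))) * z x y, ?_⟩
  simp only [Finset.sum_smul]
  refine Finset.sum_congr rfl fun x _ => Finset.sum_congr rfl fun y _ => ?_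
  rw [mul_smul _ (z x y) (1 : Op L a), ← hz, smul_add]
  congr 2
  ring

theorem ψ_ket {L a : ℝ} (ha : 0 < a) (r s α : ℤˣ) (k : nodalMomenta L a s)
    (h : 0 < ((r : ℤ) : ℝ) * k.1 s) (S : Finset (Mode L a)) (hS : ∀ m ∈ S, (m.k : ℝ) ≠ k.1 s) :
    ψ r s α k (ket S) = 0 := by
  have := finite_lattice (L := L) ha
  have := Fintype.ofFinite (lattice L a)
  unfold ψ
  rw [finsum_eq_sum_of_fintype]
  simp only [LinearMap.smul_apply, LinearMap.sum_apply]
  rw [Finset.sum_eq_zero, smul_zero]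
  intro x _
  unfold c
  rw [if_pos h, annihilate_ket, if_neg, smul_zero]
  intro hm
  exact hS _ hm rfl

theorem ψDag_ket {L a : ℝ} (ha : 0 < a) (r s α : ℤˣ) (k : nodalMomenta L a s)
    (h : ((r : ℤ) : ℝ) * k.1 s < 0) (S : Finset (Mode L a)) (hS : ∀ m ∈ S, (m.k : ℝ) ≠ k.1 s) :
    ψDag r s α k (ket S) = 0 := by
  have := finite_lattice (L := L) ha
  have := Fintype.ofFinite (lattice L a)
  unfold ψDag
  rw [finsum_eq_sum_of_fintype]
  simp only [LinearMap.smul_apply, LinearMap.sum_apply]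
  rw [Finset.sum_eq_zero, smul_zero]
  intro x _
  unfold cDag
  rw [if_neg h.not_gt, annihilate_ket, if_neg, smul_zero]
  intro hm
  exact hS _ hm rfl

theorem bilinear_ket {L a : ℝ} (ha : 0 < a) (σ : ℤˣ → ℤˣ → ℂ) (r s : ℤˣ)
    (k₁ k₂ : nodalMomenta L a s) (S : Finset (Mode L a)) (B : ℝ) (hB : 0 ≤ B)
    (hS : ∀ m ∈ S, |(m.k : ℝ)| ≤ B) (h : B + |k₁.1 s - k₂.1 s| < |k₂.1 s|) :
    bilinear σ r s k₁ k₂ (ket S) = 0 := by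
  have hr : (((r : ℤ) : ℝ) = 1) ∨ (((r : ℤ) : ℝ) = -1) := by
    rcases Int.units_eq_one_or r with rfl | rfl <;> simp
  have hk1 : B < |k₁.1 s| := by
    have := abs_sub_abs_le_abs_sub (k₂.1 s) (k₁.1 s)
    rw [abs_sub_comm] at this
    linarith
  have hk2 : B < |k₂.1 s| := lt_of_le_of_lt (by linarith [abs_nonneg (k₁.1 s - k₂.1 s)]) h
  have hS1 : ∀ m ∈ S, (m.k : ℝ) ≠ k₁.1 s := fun m hm e => by
    have := hS m hm; rw [e] at this; linarith
  have hS2 : ∀ m ∈ S, (m.k : ℝ) ≠ k₂.1 s := fun m hm e => by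
    have := hS m hm; rw [e] at this; linarith
  have habs : |((r : ℤ) : ℝ) * k₂.1 s| = |k₂.1 s| := by
    rcases hr with h | h <;> simp [h]
  unfold bilinear
  simp only [LinearMap.sum_apply, LinearMap.smul_apply]
  refine Finset.sum_eq_zero fun α _ => Finset.sum_eq_zero fun β _ => ?_
  convert smul_zero _
  unfold normalOrder vev
  by_cases hp : 0 < ((r : ℤ) : ℝ) * k₂.1 s
  · simp [ψ_ket ha r s β k₂ hp S hS2, vacuum, ψ_ket ha r s β k₂ hp ∅ (by simp)]
  · have h2 : ((r : ℤ) : ℝ) * k₂.1 s < 0 := by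
      refine lt_of_le_of_ne (not_lt.1 hp) fun e => ?_
      rw [e, abs_zero] at habs; linarith
    have h1 : ((r : ℤ) : ℝ) * k₁.1 s < 0 := by
      rw [abs_of_neg h2] at habs
      have : ((r : ℤ) : ℝ) * k₁.1 s - ((r : ℤ) : ℝ) * k₂.1 s ≤ |k₁.1 s - k₂.1 s| := by
        rw [← mul_sub]
        rcases hr with h | h <;> rw [h]
        · linarith [le_abs_self (k₁.1 s - k₂.1 s)]
        · linarith [neg_abs_le (k₁.1 s - k₂.1 s)]
      linarith
    obtain ⟨z, hz⟩ := anticomm_ψ ha r s α β k₁ k₂ h1 h2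
    have hv : inner ℂ (toSpace (ket (∅ : Finset (Mode L a)))) (toSpace (ket ∅)) = (1 : ℂ) := by
      rw [inner_ket]; simp
    rw [hz]
    simp only [LinearMap.sub_apply, LinearMap.smul_apply, Module.End.one_apply,
      Module.End.mul_apply, ψDag_ket ha r s α k₁ h1 S hS1, vacuum,
      ψDag_ket ha r s α k₁ h1 ∅ (by simp), map_zero, sub_zero, map_smul, inner_smul_right, hv,
      mul_one, sub_self]

theorem finite_momenta {L : ℝ} (hL : 0 < L) (B : ℝ) :
    {k : fermiMomenta L | |(k : ℝ)| ≤ B}.Finite := by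
  have hp : 0 < 2 * Real.pi / L := by positivity
  refine Set.Finite.of_finite_image (f := Subtype.val) ?_ Subtype.val_injective.injOn
  refine ((Set.finite_Icc ⌊-B / (2 * Real.pi / L) - 1/2⌋ ⌈B / (2 * Real.pi / L)⌉).image
    (fun j : ℤ => 2 * Real.pi / L * (j + 1 / 2))).subset ?_
  rintro _ ⟨⟨_, j, rfl⟩, h, rfl⟩
  simp only [Set.mem_ofPred_eq, abs_le] at h
  refine ⟨j, ⟨?_, ?_⟩, rfl⟩
  · have : -B / (2 * Real.pi / L) - 1/2 ≤ j := by
      rw [sub_le_iff_le_add, div_le_iff₀ hp]; linarith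
    exact_mod_cast (Int.floor_le _).trans this
  · have : (j:ℝ) ≤ B / (2 * Real.pi / L) := by rw [le_div_iff₀ hp]; nlinarith
    exact_mod_cast this.trans (Int.le_ceil _)

theorem finite_nodalMomenta {L a : ℝ} (hL : 0 < L) (s : ℤˣ) (B : ℝ) :
    {k : nodalMomenta L a s | |k.1 s| ≤ B}.Finite := by
  have hs : ∀ t : ℤˣ, t = s ∨ t = -s := fun t => by
    rcases Int.units_eq_one_or t with rfl | rfl <;> rcases Int.units_eq_one_or s with rfl | rfl <;>
      simp
  refine Set.Finite.of_injOn (f := fun k : nodalMomenta L a s => fun t : ℤˣ =>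
    (⟨k.1 t, k.2.1 t⟩ : fermiMomenta L)) (t := {f | ∀ t, f t ∈
      {k : fermiMomenta L | |(k : ℝ)| ≤ max B (Real.pi / a)}}) ?_ ?_
      (Set.Finite.pi' fun _ => finite_momenta hL _)
  · intro k hk t
    change |k.1 t| ≤ _
    rcases hs t with rfl | rfl
    · exact le_max_of_le_left hk
    · exact le_max_of_le_right (abs_le.2 ⟨k.2.2.1, k.2.2.2.le⟩)
  · intro k _ k' _ h
    ext t
    exact congrArg Subtype.val (congrFun h t)

theorem transfer_s {L a : ℝ} {s : ℤˣ} {p : ℤˣ → ℝ} (t : transfer L a s p) :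
    t.1.1.1 s - t.1.2.1.1 s = -p s := by
  have h := congrFun t.2 s
  have : s ≠ -s := by rcases Int.units_eq_one_or s with rfl | rfl <;> decide
  simp [this] at h
  linarith

theorem finite_transfer {L a : ℝ} (hL : 0 < L) (ha : 0 < a) (s : ℤˣ) (p : ℤˣ → ℝ) (B : ℝ) :
    {t : transfer L a s p | |t.1.1.1 s| ≤ B ∧ |t.1.2.1.1 s| ≤ B}.Finite := by
  refine Set.Finite.of_injOn (f := fun t => (t.1.1, t.1.2.1))
    (t := {k : nodalMomenta L a s | |k.1 s| ≤ B} ×ˢ {k : nodalMomenta L a s | |k.1 s| ≤ B})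
    (fun t h => Set.mk_mem_prod h.1 h.2) ?_
    ((finite_nodalMomenta hL s B).prod (finite_nodalMomenta hL s B))
  rintro ⟨⟨k, k', n⟩, h⟩ - ⟨⟨l, l', n'⟩, h'⟩ - e
  simp only [Prod.mk.injEq] at e
  obtain ⟨rfl, rfl⟩ := e
  have h1 := congrFun (h.symm.trans h') (-s)
  simp [Real.pi_ne_zero, ha.ne'] at h1
  subst h1
  rfl

/-- Only finitely many terms of `J σ r s p` do not vanish on a given occupation number state. -/
theorem finite_support_J {L a : ℝ} (hL : 0 < L) (ha : 0 < a) (σ : ℤˣ → ℤˣ → ℂ) (r s : ℤˣ)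
    (p : ℤˣ → ℝ) (S : Finset (Mode L a)) :
    (Function.support fun t : transfer L a s p => bilinear σ r s t.1.1 t.1.2.1 (ket S)).Finite ∧
    (Function.support fun t : transfer L a s p =>
      bilinear σ r s t.1.2.1 t.1.1 (ket S)).Finite := by
  obtain ⟨B, hB⟩ : ∃ B : ℝ, ∀ m ∈ S, |(m.k : ℝ)| ≤ B := by
    obtain ⟨B, hB⟩ := (S.image fun m => |(m.k : ℝ)|).exists_le
    exact ⟨B, fun m hm => hB _ (Finset.mem_image_of_mem _ hm)⟩
  have hm : ∀ m ∈ S, |(m.k : ℝ)| ≤ max B 0 := fun m h => le_max_of_le_left (hB m h)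
  constructor
  · refine (finite_transfer hL ha s p (max B 0 + |p s| + |p s|)).subset fun t ht => ?_
    have h1 := transfer_s t
    have h2 : |t.1.2.1.1 s| ≤ max B 0 + |p s| := by
      by_contra! h
      refine ht (bilinear_ket ha σ r s _ _ S _ (le_max_right _ _) hm ?_)
      rwa [h1, abs_neg]
    refine ⟨?_, h2.trans (by linarith [abs_nonneg (p s)])⟩
    rw [sub_eq_iff_eq_add'.1 h1]
    refine (abs_add_le _ _).trans ?_
    rw [abs_neg]; linarith
  · refine (finite_transfer hL ha s p (max B 0 + |p s| + |p s|)).subset fun t ht => ?_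
    have h1 := transfer_s t
    have h2 : |t.1.1.1 s| ≤ max B 0 + |p s| := by
      by_contra! h
      refine ht (bilinear_ket ha σ r s _ _ S _ (le_max_right _ _) hm ?_)
      rwa [abs_sub_comm, h1, abs_neg]
    refine ⟨h2.trans (by linarith [abs_nonneg (p s)]), ?_⟩
    have : t.1.2.1.1 s = t.1.1.1 s + p s := by linarith
    rw [this]
    refine (abs_add_le _ _).trans ?_
    linarith

theorem isAdj_J {L a : ℝ} (hL : 0 < L) (ha : 0 < a) (σ : ℤˣ → ℤˣ → ℂ)
    (hσ : ∀ α β, σ β α = starRingEnd ℂ (σ α β)) (r s : ℤˣ) (p : ℤˣ → ℝ) :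
    IsAdj (J (L := L) (a := a) σ r s p) (JDag σ r s p) := by
  refine isAdj_of_ket fun S U => ?_
  have hS := (finite_support_J hL ha σ r s p S).2
  have hU := (finite_support_J hL ha σ r s p U).1
  simp only [J, JDag, ket, Finsupp.linearCombination_single, one_smul] at hS hU ⊢
  rw [finsum_eq_sum_of_support_subset (s := hS.toFinset ∪ hU.toFinset) _ (by
      intro t ht; simp [Function.mem_support.1 ht]),
    finsum_eq_sum_of_support_subset (s := hS.toFinset ∪ hU.toFinset) _ (by
      intro t ht; simp [Function.mem_support.1 ht])]
  simp only [map_sum, sum_inner, inner_sum]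
  exact Finset.sum_congr rfl fun t _ => isAdj_bilinear ha σ hσ r s _ _ _ _

theorem isAdj_density {L a : ℝ} (hL : 0 < L) (ha : 0 < a) (r s α : ℤˣ) (p : ℤˣ → ℝ) :
    IsAdj (density (L := L) (a := a) r s α p) (densityDag r s α p) := by
  have h0 : ∀ α β, σ₀ β α = starRingEnd ℂ (σ₀ α β) := fun α β => by
    simp [σ₀, eq_comm, apply_ite]
  have h3 : ∀ α β, σ₃ β α = starRingEnd ℂ (σ₃ α β) := fun α β => by
    unfold σ₃
    by_cases h : α = β
    · subst h; simp
    · simp [h, Ne.symm h]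
  have := ((isAdj_J hL ha _ h0 r s p).add ((isAdj_J hL ha _ h3 r s p).smul ((α : ℤ) : ℂ))).smul
    (1 / 2 : ℂ)
  simpa [density, densityDag, Complex.conj_ofNat] using this

/-- `bDag m` is the adjoint of `b m` on the core. -/
theorem isAdj_b {L a : ℝ} (hL : 0 < L) (ha : 0 < a) (m : BosonMode L a) :
    IsAdj (b m) (bDag m) := by
  unfold b bDag
  split_ifs
  · convert (isAdj_density hL ha 1 m.s m.α m.p).smul _ using 2
    rw [map_mul, Complex.conj_ofReal]; simp [neg_div]
  · convert (isAdj_density hL ha (-1) m.s m.α m.p).smul _ using 2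
    rw [map_mul, Complex.conj_ofReal]; simp [neg_div]

/-- For `(n, ν)` in `occupations L a`, only finitely many `n_{s,α}(p)` do not vanish. -/
theorem finite_support_occupations {L a : ℝ} (hL : 0 < L) (q : occupations L a) :
    (Function.support q.1.1).Finite := by
  have hc : 0 < 2 * Real.pi / L := by positivity
  have h := q.2.2.tendsto_cofinite_zero.eventually (gt_mem_nhds hc)
  refine Set.Finite.subset h fun m hm => ?_
  obtain ⟨j, hj⟩ := m.p.2.1 m.s
  have hj' : m.ps = 2 * Real.pi / L * j := hj
  have h0 : m.ps ≠ 0 := m.p.2.2.2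
  have hj0 : j ≠ 0 := by rintro rfl; simp [hj'] at h0
  have h1 : (1 : ℝ) ≤ |(j : ℝ)| := by exact_mod_cast Int.one_le_abs hj0
  have h2 : (1 : ℝ) ≤ q.1.1 m := by exact_mod_cast Nat.one_le_iff_ne_zero.2 hm
  simp only [Set.mem_compl_iff, Set.mem_ofPred_eq, not_lt, hj', abs_mul, abs_of_pos hc]
  nlinarith [mul_le_mul h1 h2 zero_le_one (abs_nonneg _)]

end Nodal
end

/-!
The Fourier modes `ρ_f(n)` of the density of a chiral fermion `f` form a Heisenberg algebra: the
commutator of two of them commutes with all fermion operators, so it is the scalar given by its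
vacuum expectation value. Since the two-dimensional densities are lattice Fourier transforms of the
`ρ_f(n)` in the transverse position, the bosons `b` are unitary combinations of the `ρ_f(n)` with
`n ≠ 0`, and the zero modes `N` are the charges `ρ_f(0)`.

Completeness rests on Kronig's identity: `∑ ρ_f(-n) ρ_f(n)` over `n > 0` is diagonal on occupation
number states and counts the pairs of an empty level below a filled one, because the off-diagonal
quartic terms cancel in pairs under the exchange of the two fermions. Hence a state with a positive
number of such pairs is obtained by applying some `ρ_f(-n)` to states with fewer pairs, and the
states without such pairs are the filled Dirac seas, one for every family of charges. Operators that
commute with the bosons and shift the charges permute these ground states up to phases. Conversely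
Klein factors exist because shifting the charges in the resulting occupation number basis, with
Jordan-Wigner signs between the flavors, is unitary.
-/

noncomputable section

namespace Fock

/-! ### Operators on the core -/

section Operators

variable {ι : Type} {κ κ' : Type*}

theorem inner_ket_left (S : Finset ι) (u : Core ι) :
    inner ℂ (toSpace (ket S)) (toSpace u) = u S := by
  classical
  induction u using Finsupp.induction_linear with
  | zero => simp
  | add v w hv hw => simp only [map_add, inner_add_right, hv, hw, Finsupp.add_apply]
  | single U z =>
    have hz : Finsupp.single U z = z • ket U := by simp [ket]
    rw [hz, map_smul, inner_smul_right, inner_ket]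
    simp [ket, Finsupp.single_apply, eq_comm]

@[elab_as_elim]
theorem Core.induction {p : Core ι → Prop} (ket : ∀ S, p (ket S))
    (add : ∀ v w, p v → p w → p (v + w)) (smul : ∀ (z : ℂ) v, p v → p (z • v)) (v : Core ι) :
    p v := by
  induction v using Finsupp.induction_linear with
  | zero => simpa using smul 0 _ (ket ∅)
  | add v w hv hw => exact add _ _ hv hw
  | single S z => simpa [Fock.ket] using smul z _ (ket S)

theorem IsAdj.zero : IsAdj (0 : Module.End ℂ (Core ι)) 0 := fun v w => by simp

theorem IsAdj.unique {T T' T'' : Module.End ℂ (Core ι)} (h : IsAdj T T') (h' : IsAdj T T'') :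
    T' = T'' := by
  refine LinearMap.ext fun v => Finsupp.ext fun S => ?_
  rw [← inner_ket_left, ← inner_ket_left, ← inner_conj_symm, h, ← h', inner_conj_symm]

theorem vev_eq (T : Module.End ℂ (Core ι)) : vev T = T vacuum ∅ := by
  rw [vev, vacuum, inner_ket_left]

theorem vev_add (T U : Module.End ℂ (Core ι)) : vev (T + U) = vev T + vev U := by simp [vev_eq]

theorem vev_sub (T U : Module.End ℂ (Core ι)) : vev (T - U) = vev T - vev U := by simp [vev_eq]

theorem vev_neg (T : Module.End ℂ (Core ι)) : vev (-T) = -vev T := by simp [vev_eq]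

theorem vev_smul (z : ℂ) (T : Module.End ℂ (Core ι)) : vev (z • T) = z * vev T := by simp [vev_eq]

theorem vev_one : vev (1 : Module.End ℂ (Core ι)) = 1 := by simp [vev_eq, vacuum, ket]

theorem normalOrder_of_vev_eq_zero {T U : Module.End ℂ (Core ι)} {z : ℂ} (h : T = U + z • 1)
    (hU : vev U = 0) : normalOrder T = U := by
  have hz : vev T = z := by rw [h, vev_add, vev_smul, vev_one, hU, zero_add, mul_one]
  rw [normalOrder, hz, h, add_sub_cancel_right (G := Module.End ℂ (Core ι))]

theorem normalOrder_smul (z : ℂ) (T : Module.End ℂ (Core ι)) :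
    normalOrder (z • T) = z • normalOrder T := by
  rw [normalOrder, normalOrder, vev_smul]
  module

theorem normalOrder_add (T U : Module.End ℂ (Core ι)) :
    normalOrder (T + U) = normalOrder T + normalOrder U := by
  rw [normalOrder, normalOrder, normalOrder, vev_add]
  module

theorem normalOrder_sum {κ : Type*} (s : Finset κ) (T : κ → Module.End ℂ (Core ι)) :
    normalOrder (∑ i ∈ s, T i) = ∑ i ∈ s, normalOrder (T i) :=
  map_sum (G := Module.End ℂ (Core ι) →+ Module.End ℂ (Core ι))
    (AddMonoidHom.mk' normalOrder normalOrder_add) T s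

theorem normalOrder_lie (T U : Module.End ℂ (Core ι)) : ⁅normalOrder T, U⁆ = ⁅T, U⁆ := by
  refine LinearMap.ext fun v => ?_
  simp [normalOrder, Ring.lie_def]

section CAR

variable [LinearOrder ι]

theorem sign_of_mem {i j : ι} {S : Finset ι} (hj : j ∈ S) :
    sign i S = (if j < i then -1 else 1) * sign i (S.erase j) := by
  conv_lhs => rw [← Finset.insert_erase hj, sign_insert _ _ _ (Finset.notMem_erase j S)]

theorem annihilate_anticomm (i j : ι) :
    annihilate i * annihilate j + annihilate j * annihilate i = (0 : Module.End ℂ (Core ι)) := by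
  refine ext_ket fun S => ?_
  simp only [LinearMap.add_apply, Module.End.mul_apply, LinearMap.zero_apply]
  rcases eq_or_ne i j with rfl | hij
  · by_cases hi : i ∈ S <;> simp [annihilate_ket, hi]
  by_cases hi : i ∈ S <;> by_cases hj : j ∈ S
  · simp only [annihilate_ket, hi, hj, if_true, map_smul, Finset.mem_erase, hij, hij.symm, ne_eq,
      not_false_eq_true, true_and, smul_smul, Finset.erase_right_comm (a := i)]
    rw [sign_of_mem (i := i) hj, sign_of_mem (i := j) hi, ← add_smul]
    refine smul_eq_zero_of_left ?_ _
    rcases lt_or_gt_of_ne hij with h | h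
    · simp only [h, h.not_gt, if_true, if_false]; ring
    · simp only [h, h.not_gt, if_true, if_false]; ring
  all_goals simp [annihilate_ket, hi, hj]

theorem create_anticomm (i j : ι) :
    create i * create j + create j * create i = (0 : Module.End ℂ (Core ι)) := by
  have h := ((isAdj_create j).mul (isAdj_create i)).add ((isAdj_create i).mul (isAdj_create j))
  rw [annihilate_anticomm] at h
  exact h.unique IsAdj.zero

theorem create_annihilate_apply (i : ι) (v : Core ι) (S : Finset ι) :
    create i (annihilate i v) S = if i ∈ S then v S else 0 := by
  induction v using Core.induction with
  | ket U =>
    have hU : create i (annihilate i (ket U)) = if i ∈ U then ket U else 0 := by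
      rw [annihilate_ket]
      split_ifs with hi
      · rw [sign_of_mem hi]
        simp [create_ket, smul_smul, sign_mul_self, Finset.insert_erase hi]
      · exact map_zero _
    rw [hU]
    by_cases h : U = S
    · subst h
      split_ifs <;> simp
    · split_ifs <;> simp [ket, h]
  | add v w hv hw => simp only [map_add, Finsupp.add_apply, hv, hw]; split_ifs <;> simp
  | smul z v hv => simp only [map_smul, Finsupp.smul_apply, hv]; split_ifs <;> simp

theorem eq_smul_vacuum_of_annihilate_eq_zero {v : Core ι} (h : ∀ i, annihilate i v = 0) :
    v = v ∅ • vacuum := by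
  ext S
  rcases S.eq_empty_or_nonempty with rfl | ⟨i, hi⟩
  · simp [vacuum, ket]
  · have hS := create_annihilate_apply i v S
    have hne : (∅ : Finset ι) ≠ S := by rintro rfl; simp at hi
    rw [h, map_zero, if_pos hi] at hS
    rw [← hS]
    simp [vacuum, ket, hne]

theorem eq_smul_one_of_commute {T : Module.End ℂ (Core ι)} (h : ∀ i, Commute T (annihilate i))
    (h' : ∀ i, Commute T (create i)) : T = vev T • 1 := by
  refine ext_ket fun S => ?_
  induction S using Finset.induction_on with
  | empty =>
    rw [vev_eq]
    refine eq_smul_vacuum_of_annihilate_eq_zero fun i => ?_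
    have hi := LinearMap.congr_fun (h i) vacuum
    simpa [vacuum, annihilate_ket] using hi.symm
  | insert i S hi ih =>
    have hS : ket (insert i S) = sign i S • create i (ket S) := by
      rw [create_ket, if_neg hi, smul_smul, sign_mul_self, one_smul]
    rw [hS, map_smul, ← Module.End.mul_apply T, (h' i).eq, Module.End.mul_apply, ih]
    simp

end CAR

/-! ### Locally finite sums of operators -/

/-- A family of operators of which only finitely many do not vanish on any given vector. -/
def LocFinite (T : κ → Module.End ℂ (Core ι)) : Prop :=
  ∀ v, (fun i => T i v).HasFiniteSupport

theorem locFinite_of_ket {T : κ → Module.End ℂ (Core ι)}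
    (h : ∀ S, (fun i => T i (ket S)).HasFiniteSupport) : LocFinite T := by
  intro v
  induction v using Core.induction with
  | ket S => exact h S
  | add v w hv hw => simpa using hv.fun_add hw
  | smul z v hv => simpa using hv.fun_comp (g := fun w => z • w) (smul_zero z)

theorem LocFinite.mul_left {T : κ → Module.End ℂ (Core ι)} (h : LocFinite T)
    (U : Module.End ℂ (Core ι)) : LocFinite fun i => U * T i := fun v =>
  (h v).fun_comp (map_zero U)

theorem LocFinite.mul_right {T : κ → Module.End ℂ (Core ι)} (h : LocFinite T)
    (U : Module.End ℂ (Core ι)) : LocFinite fun i => T i * U := fun v => h (U v)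

theorem LocFinite.comp_injective {T : κ' → Module.End ℂ (Core ι)} (h : LocFinite T) {g : κ → κ'}
    (hg : Function.Injective g) : LocFinite fun i => T (g i) := fun v =>
  (h v).preimage hg.injOn

theorem LocFinite.lie {T : κ → Module.End ℂ (Core ι)} (h : LocFinite T)
    (U : Module.End ℂ (Core ι)) : LocFinite fun i => ⁅T i, U⁆ := fun v =>
  (h.mul_right U v).fun_sub (h.mul_left U v)

open Classical in
/-- The sum of a locally finite family of operators, and the junk value `0` for a family that is
not locally finite. -/
def opSum (T : κ → Module.End ℂ (Core ι)) : Module.End ℂ (Core ι) :=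
  if h : LocFinite T then
    { toFun := fun v => ∑ᶠ i, T i v
      map_add' := fun v w => by simp only [map_add]; exact finsum_add_distrib (h v) (h w)
      map_smul' := fun z v => by simp only [map_smul, smul_finsum, RingHom.id_apply] }
  else 0

theorem opSum_apply {T : κ → Module.End ℂ (Core ι)} (h : LocFinite T) (v : Core ι) :
    opSum T v = ∑ᶠ i, T i v := by
  rw [opSum, dif_pos h]; rfl

theorem opSum_lie {T : κ → Module.End ℂ (Core ι)} (h : LocFinite T) (U : Module.End ℂ (Core ι)) :
    ⁅opSum T, U⁆ = opSum fun i => ⁅T i, U⁆ := by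
  refine LinearMap.ext fun v => ?_
  have hU : U (∑ᶠ i, T i v) = ∑ᶠ i, U (T i v) := U.toAddMonoidHom.map_finsum (h v)
  rw [Ring.lie_def, LinearMap.sub_apply, Module.End.mul_apply, Module.End.mul_apply,
    opSum_apply (h.lie U), opSum_apply h, opSum_apply h, hU]
  exact (finsum_sub_distrib (h.mul_right U v) (h.mul_left U v)).symm

theorem opSum_eq_single {T : κ → Module.End ℂ (Core ι)} (i : κ) (h : ∀ j, j ≠ i → T j = 0) :
    opSum T = T i := by
  have hT : LocFinite T := fun v => (Set.finite_singleton i).subset fun j hj => by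
    by_contra hne
    exact hj (by simp [h j hne])
  refine LinearMap.ext fun v => ?_
  rw [opSum_apply hT, finsum_eq_single _ i fun j hj => by simp [h j hj]]

theorem opSum_comp_equiv (g : κ ≃ κ') {T : κ' → Module.End ℂ (Core ι)} (h : LocFinite T) :
    opSum (fun i => T (g i)) = opSum T := by
  refine LinearMap.ext fun v => ?_
  rw [opSum_apply h, opSum_apply (h.comp_injective g.injective)]
  exact finsum_comp_equiv g (f := fun i => T i v)

theorem opSum_prod [Fintype κ'] {T : κ × κ' → Module.End ℂ (Core ι)} (h : LocFinite T) :
    opSum T = opSum fun i => ∑ j, T (i, j) := by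
  classical
  have hT : LocFinite fun i => ∑ j, T (i, j) := fun v =>
    ((h v).image Prod.fst).subset fun i hi => by
      simp only [Function.mem_support, LinearMap.sum_apply] at hi
      obtain ⟨j, -, hj⟩ := Finset.exists_ne_zero_of_sum_ne_zero hi
      exact ⟨(i, j), hj, rfl⟩
  refine LinearMap.ext fun v => ?_
  rw [opSum_apply h, opSum_apply hT, finsum_curry _ (h v)]
  simp only [finsum_eq_sum_of_fintype, LinearMap.sum_apply]

theorem opSum_sum_smul [Fintype κ'] {T : κ' → κ → Module.End ℂ (Core ι)}
    (h : ∀ j, LocFinite (T j)) (z : κ' → ℂ) :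
    opSum (fun i => ∑ j, z j • T j i) = ∑ j, z j • opSum (T j) := by
  have hsmul : ∀ j v, (fun i => z j • T j i v).HasFiniteSupport := fun j v =>
    (h j v).fun_comp (smul_zero (z j))
  have hT : LocFinite fun i => ∑ j, z j • T j i := fun v => by
    simpa only [LinearMap.sum_apply, LinearMap.smul_apply] using
      Function.HasFiniteSupport.sum (hsmul · v) Finset.univ
  refine LinearMap.ext fun v => ?_
  simp only [opSum_apply hT, LinearMap.sum_apply, LinearMap.smul_apply, opSum_apply (h _),
    smul_finsum]
  exact finsum_sum_comm _ _ fun j _ => hsmul j v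

theorem IsAdj.opSum {T T' : κ → Module.End ℂ (Core ι)} (h : ∀ i, IsAdj (T i) (T' i))
    (hT : LocFinite T) (hT' : LocFinite T') : IsAdj (opSum T) (opSum T') := by
  classical
  intro v w
  rw [opSum_apply hT', opSum_apply hT,
    finsum_eq_sum_of_support_subset (s := (hT w).toFinset ∪ (hT' v).toFinset) _ (by
      rw [Finset.coe_union, Set.Finite.coe_toFinset (hT' v)]; exact Set.subset_union_right),
    finsum_eq_sum_of_support_subset (s := (hT w).toFinset ∪ (hT' v).toFinset) _ (by
      rw [Finset.coe_union, Set.Finite.coe_toFinset (hT w)]; exact Set.subset_union_left)]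
  simp only [map_sum, sum_inner, inner_sum]
  exact Finset.sum_congr rfl fun i _ => h i v w

end Operators

/-! ### Chiral fermions -/

theorem lie_smul_right {ι : Type} (T U : Module.End ℂ (Core ι)) (z : ℂ) :
    ⁅T, z • U⁆ = z • ⁅T, U⁆ := by
  rw [Ring.lie_def, Ring.lie_def, mul_smul_comm, smul_mul_assoc, smul_sub]

theorem lie_sum_smul_sum_smul {A κ κ' : Type*} [Ring A] [Algebra ℂ A] [Fintype κ] [Fintype κ']
    (z : κ → ℂ) (w : κ' → ℂ) (S : κ → A) (T : κ' → A) :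
    ⁅∑ x, z x • S x, ∑ y, w y • T y⁆ = ∑ x, ∑ y, (z x * w y) • ⁅S x, T y⁆ := by
  simp only [Ring.lie_def, Finset.sum_mul_sum, smul_mul_smul_comm, smul_sub,
    Finset.sum_sub_distrib]
  rw [Finset.sum_comm (s := Finset.univ (α := κ'))]
  simp only [mul_comm]

theorem commute_of_lie_eq_zero {A : Type*} [Ring A] {S T : A} (h : ⁅S, T⁆ = 0) : Commute S T :=
  sub_eq_zero.1 h

section Chiral

variable {F ι : Type} (e : F × ℤ ≃ ι)

/-- The level `j` of flavor `f` is occupied by a fermion in the state `ket S`. Excitations of the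
levels with negative index are holes, so such a level is filled if it is not excited. -/
def Filled (S : Finset ι) (f : F) (j : ℤ) : Prop :=
  if 0 ≤ j then e (f, j) ∈ S else e (f, j) ∉ S

variable {e} {S : Finset ι} {f : F} {j : ℤ}

theorem filled_empty : Filled e ∅ f j ↔ j < 0 := by simp [Filled]

variable (e S) in
theorem exists_filled_bound : ∃ A : ℤ, 0 ≤ A ∧ ∀ f j,
    (A ≤ j → ¬ Filled e S f j) ∧ (j < -A → Filled e S f j) := by
  obtain ⟨A, hA⟩ := (S.image fun m => |(e.symm m).2|).exists_le
  have hS : ∀ f j, e (f, j) ∈ S → -A ≤ j ∧ j ≤ A := fun f j h =>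
    abs_le.1 (by simpa using hA _ (Finset.mem_image_of_mem _ h))
  refine ⟨max A 0 + 1, by positivity, fun f j => ⟨fun hj h => ?_, fun hj => ?_⟩⟩
  · rw [Filled, if_pos (by omega)] at h
    have := hS f j h
    omega
  · rw [Filled, if_neg (by omega)]
    intro h
    have := hS f j h
    omega

theorem filled_injective {S' : Finset ι} (h : ∀ f j, Filled e S f j ↔ Filled e S' f j) :
    S = S' := by
  ext m
  obtain ⟨⟨f, j⟩, rfl⟩ := e.surjective m
  have hfj := h f j
  unfold Filled at hfj
  split_ifs at hfj
  · exact hfj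
  · exact not_iff_not.1 hfj

variable (e) in
theorem exists_filled_iff_lt [Finite F] (ν : F → ℤ) :
    ∃ S : Finset ι, ∀ f j, Filled e S f j ↔ j < ν f := by
  have hfin : {m : ι | ¬((e.symm m).2 < ν (e.symm m).1 ↔ (e.symm m).2 < 0)}.Finite := by
    refine (Set.finite_iUnion fun f : F =>
      (Set.finite_Icc (min (ν f) 0) (max (ν f) 0)).image fun j => e (f, j)).subset fun m hm => ?_
    obtain ⟨⟨f, j⟩, rfl⟩ := e.surjective m
    simp only [Set.mem_ofPred_eq, Equiv.symm_apply_apply] at hm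
    exact Set.mem_iUnion.2 ⟨f, j, ⟨by omega, by omega⟩, rfl⟩
  refine ⟨hfin.toFinset, fun f j => ?_⟩
  unfold Filled
  simp only [Set.Finite.mem_toFinset, Set.mem_ofPred_eq, Equiv.symm_apply_apply]
  split_ifs <;> omega

variable (e) [LinearOrder ι]

/-- The annihilation operator of chiral fermions with the set `F` of flavors at the level `j`, when
the Dirac sea consists of the levels with negative index. -/
def fermi (f : F) (j : ℤ) : Module.End ℂ (Core ι) :=
  if 0 ≤ j then annihilate (e (f, j)) else create (e (f, j))

/-- The creation operator of chiral fermions at the level `j`, the adjoint of `fermi e f j`. -/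
def fermiDag (f : F) (j : ℤ) : Module.End ℂ (Core ι) :=
  if 0 ≤ j then create (e (f, j)) else annihilate (e (f, j))

theorem isAdj_fermi (f : F) (j : ℤ) : IsAdj (fermi e f j) (fermiDag e f j) := by
  unfold fermi fermiDag
  split_ifs
  · exact isAdj_create _
  · exact (isAdj_create _).symm

theorem fermi_fermiDag [DecidableEq F] (f g : F) (i j : ℤ) :
    fermi e f i * fermiDag e g j + fermiDag e g j * fermi e f i =
      if f = g ∧ i = j then 1 else 0 := by
  have he : e (f, i) = e (g, j) ↔ f = g ∧ i = j := by simp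
  unfold fermi fermiDag
  split_ifs with hi hj h h hj h h
  · rw [anticomm, if_pos (he.2 h)]
  · rw [anticomm, if_neg (mt he.1 h)]
  · omega
  · exact annihilate_anticomm _ _
  · omega
  · exact create_anticomm _ _
  · rw [add_comm, anticomm, if_pos (he.2 h).symm]
  · rw [add_comm, anticomm, if_neg fun h' => h (he.1 h'.symm)]

theorem fermi_fermi (f g : F) (i j : ℤ) :
    fermi e f i * fermi e g j + fermi e g j * fermi e f i = 0 := by
  have he : ∀ f g (i j : ℤ), 0 ≤ i → ¬ 0 ≤ j → e (f, i) ≠ e (g, j) := by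
    simp only [ne_eq, EmbeddingLike.apply_eq_iff_eq, Prod.mk.injEq, not_and]
    omega
  unfold fermi
  split_ifs with hi hj hj
  · exact annihilate_anticomm _ _
  · rw [anticomm, if_neg (he _ _ _ _ hi hj)]
  · rw [add_comm, anticomm, if_neg (he _ _ _ _ hj hi)]
  · exact create_anticomm _ _

theorem fermiDag_fermiDag (f g : F) (i j : ℤ) :
    fermiDag e f i * fermiDag e g j + fermiDag e g j * fermiDag e f i = 0 := by
  have h := ((isAdj_fermi e g j).mul (isAdj_fermi e f i)).add
    ((isAdj_fermi e f i).mul (isAdj_fermi e g j))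
  rw [fermi_fermi] at h
  exact h.unique IsAdj.zero

theorem eq_smul_one_of_commute_fermi {T : Module.End ℂ (Core ι)}
    (h : ∀ f j, Commute T (fermi e f j)) (h' : ∀ f j, Commute T (fermiDag e f j)) :
    T = vev T • 1 := by
  have key : ∀ f j, Commute T (annihilate (e (f, j))) ∧ Commute T (create (e (f, j))) := by
    intro f j
    have h := h f j
    have h' := h' f j
    unfold fermi at h
    unfold fermiDag at h'
    split_ifs at h h'
    · exact ⟨h, h'⟩
    · exact ⟨h', h⟩
  refine eq_smul_one_of_commute (fun i => ?_) fun i => ?_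
  · simpa using (key (e.symm i).1 (e.symm i).2).1
  · simpa using (key (e.symm i).1 (e.symm i).2).2

variable {e}

theorem fermi_ket (h : ¬ Filled e S f j) : fermi e f j (ket S) = 0 := by
  unfold Filled at h
  unfold fermi
  split_ifs at h ⊢
  · rw [annihilate_ket, if_neg h]
  · rw [create_ket, if_pos (not_not.1 h)]

theorem fermiDag_ket (h : Filled e S f j) : fermiDag e f j (ket S) = 0 := by
  unfold Filled at h
  unfold fermiDag
  split_ifs at h ⊢
  · rw [create_ket, if_pos h]
  · rw [annihilate_ket, if_neg h]

open Classical in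
theorem fermiDag_fermi_ket :
    fermiDag e f j (fermi e f j (ket S)) = if Filled e S f j then ket S else 0 := by
  split_ifs with h
  · have h' := LinearMap.congr_fun (fermi_fermiDag e f f j j) (ket S)
    simpa [fermiDag_ket h] using h'
  · rw [fermi_ket h, map_zero]

theorem fermi_vacuum (h : 0 ≤ j) : fermi e f j vacuum = 0 :=
  fermi_ket (by rw [filled_empty]; omega)

theorem fermiDag_vacuum (h : j < 0) : fermiDag e f j vacuum = 0 :=
  fermiDag_ket (filled_empty.2 h)

/-! ### Densities and the Heisenberg algebra -/

variable (e)

/-- The normal ordered bilinear `:c_f(j)† c_f(j + n):`. -/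
def hop (f : F) (n j : ℤ) : Module.End ℂ (Core ι) :=
  normalOrder (fermiDag e f j * fermi e f (j + n))

variable {e}

theorem vev_fermiDag_mul (h : 0 ≤ j) (T : Module.End ℂ (Core ι)) :
    vev (fermiDag e f j * T) = 0 := by
  rw [vev, Module.End.mul_apply, ← (isAdj_fermi e f j).symm, fermi_vacuum h, map_zero,
    inner_zero_left]

theorem vev_mul_fermiDag (h : j < 0) (T : Module.End ℂ (Core ι)) :
    vev (T * fermiDag e f j) = 0 := by
  rw [vev, Module.End.mul_apply, fermiDag_vacuum h, map_zero, map_zero, inner_zero_right]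

theorem hop_of_nonneg (h : 0 ≤ j) (n : ℤ) : hop e f n j = fermiDag e f j * fermi e f (j + n) :=
  normalOrder_of_vev_eq_zero (z := 0) (by simp) (vev_fermiDag_mul h _)

theorem fermiDag_mul_fermi (i : ℤ) :
    fermiDag e f j * fermi e f i =
      -(fermi e f i * fermiDag e f j) + (if i = j then (1 : ℂ) else 0) • 1 := by
  classical
  have h := fermi_fermiDag e f f i j
  rw [eq_neg_add_iff_add_eq (G := Module.End ℂ (Core ι)), h]
  by_cases hi : i = j <;> simp [hi]

theorem hop_of_neg (h : j < 0) (n : ℤ) : hop e f n j = -(fermi e f (j + n) * fermiDag e f j) :=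
  normalOrder_of_vev_eq_zero (fermiDag_mul_fermi _) (by
    rw [vev_neg, vev_mul_fermiDag h, neg_zero])

theorem vev_fermiDag_mul_fermi (i : ℤ) :
    vev (fermiDag e f j * fermi e f i) = if i = j ∧ j < 0 then 1 else 0 := by
  rcases lt_or_ge j 0 with hj | hj
  · rw [fermiDag_mul_fermi, vev_add, vev_neg, vev_mul_fermiDag hj, vev_smul, vev_one]
    simp [hj]
  · rw [vev_fermiDag_mul hj, if_neg (by omega)]

variable (e) in
theorem isAdj_hop (f : F) (n j : ℤ) : IsAdj (hop e f n j) (hop e f (-n) (j + n)) := by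
  simpa [hop] using ((isAdj_fermi e f j).symm.mul (isAdj_fermi e f (j + n))).normalOrder

theorem hop_ket_eq_zero {n A : ℤ} (hA : 0 ≤ A)
    (h : ∀ f j, (A ≤ j → ¬ Filled e S f j) ∧ (j < -A → Filled e S f j))
    (hj : j < -A ∨ A ≤ j ∧ A ≤ j + n) : hop e f n j (ket S) = 0 := by
  rcases hj with hj | hj
  · simp [hop_of_neg (show j < 0 by omega), fermiDag_ket ((h f j).2 hj)]
  · simp [hop_of_nonneg (show 0 ≤ j by omega), fermi_ket ((h f (j + n)).1 (by omega))]

variable (e) in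
theorem locFinite_hop (f : F) (n : ℤ) : LocFinite (hop e f n) := by
  refine locFinite_of_ket fun S => ?_
  obtain ⟨A, hA, h⟩ := exists_filled_bound e S
  refine (Set.finite_Icc (-A) (max A (A - n))).subset fun j hj => ?_
  by_contra hc
  rw [Set.mem_Icc, not_and_or] at hc
  exact hj (hop_ket_eq_zero hA h (by omega))

variable (e)

/-- The Fourier component `ρ_f(n) = ∑_j :c_f(j)† c_f(j + n):` of the fermion density. -/
def rho (f : F) (n : ℤ) : Module.End ℂ (Core ι) := opSum (hop e f n)

theorem isAdj_rho (f : F) (n : ℤ) : IsAdj (rho e f n) (rho e f (-n)) := by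
  have h := IsAdj.opSum (isAdj_hop e f n) (locFinite_hop e f n)
    ((locFinite_hop e f (-n)).comp_injective (add_left_injective n))
  rwa [show opSum (fun j => hop e f (-n) (j + n)) = rho e f (-n) from
    opSum_comp_equiv (Equiv.addRight n) (locFinite_hop e f (-n))] at h

theorem mul_lie_eq_anticomm {R : Type*} [Ring R] (x y z : R) :
    ⁅x * y, z⁆ = x * (y * z + z * y) - (x * z + z * x) * y := by
  rw [Ring.lie_def]
  noncomm_ring

theorem rho_lie_fermiDag [DecidableEq F] (f g : F) (n i : ℤ) :
    ⁅rho e f n, fermiDag e g i⁆ = (if f = g then 1 else 0 : ℂ) • fermiDag e g (i - n) := by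
  have key : ∀ j, ⁅hop e f n j, fermiDag e g i⁆ =
      fermiDag e f j * if f = g ∧ j + n = i then 1 else 0 := fun j => by
    rw [hop, normalOrder_lie, mul_lie_eq_anticomm (R := Module.End ℂ (Core ι)), fermi_fermiDag,
      fermiDag_fermiDag, zero_mul, sub_zero (G := Module.End ℂ (Core ι))]
  rw [rho, opSum_lie (locFinite_hop e f n), opSum_eq_single (i - n), key]
  · by_cases h : f = g <;> simp [h]
  · intro j hj
    rw [key, if_neg (by omega), mul_zero]

theorem rho_lie_fermi [DecidableEq F] (f g : F) (n i : ℤ) :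
    ⁅rho e f n, fermi e g i⁆ = (if f = g then -1 else 0 : ℂ) • fermi e g (i + n) := by
  have key : ∀ j, ⁅hop e f n j, fermi e g i⁆ =
      (if f = g ∧ i = j then -1 else 0 : ℂ) • fermi e f (j + n) := fun j => by
    rw [hop, normalOrder_lie, mul_lie_eq_anticomm (R := Module.End ℂ (Core ι)), fermi_fermi,
      add_comm (fermiDag e f j * _), fermi_fermiDag, mul_zero,
      zero_sub (G := Module.End ℂ (Core ι))]
    by_cases h : f = g ∧ i = j
    · rw [if_pos h, if_pos ⟨h.1.symm, h.2⟩, one_mul]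
      exact (neg_one_smul ℂ (fermi e f (j + n))).symm
    · rw [if_neg h, if_neg fun h' => h ⟨h'.1.symm, h'.2⟩, zero_mul, zero_smul]
      exact neg_zero (G := Module.End ℂ (Core ι))
  rw [rho, opSum_lie (locFinite_hop e f n), opSum_eq_single i, key]
  · by_cases h : f = g <;> simp [h]
  · intro j hj
    rw [key, if_neg (by omega), zero_smul]

theorem rho_vacuum_eq_sum (f : F) (n : ℤ) : rho e f n vacuum =
    ∑ j ∈ Finset.Ico 0 (-n), fermiDag e f j (fermi e f (j + n) vacuum) := by
  rw [rho, opSum_apply (locFinite_hop e f n),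
    finsum_eq_sum_of_support_subset (s := Finset.Ico 0 (-n))]
  · refine Finset.sum_congr rfl fun j hj => ?_
    rw [hop_of_nonneg (Finset.mem_Ico.1 hj).1, Module.End.mul_apply]
  · intro j hj
    rw [Finset.coe_Ico, Set.mem_Ico]
    by_contra hc
    refine hj ?_
    rcases lt_or_ge j 0 with h | h
    · simp [hop_of_neg h, fermiDag_vacuum h]
    · simp [hop_of_nonneg h, fermi_vacuum (f := f) (show 0 ≤ j + n by omega)]

theorem rho_vacuum (f : F) {n : ℤ} (hn : 0 ≤ n) : rho e f n vacuum = 0 := by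
  rw [rho_vacuum_eq_sum, Finset.Ico_eq_empty (by omega), Finset.sum_empty]

theorem vev_rho_mul (T : Module.End ℂ (Core ι)) (f : F) {n : ℤ} (hn : n ≤ 0) :
    vev (rho e f n * T) = 0 := by
  rw [vev, Module.End.mul_apply, ← isAdj_rho, rho_vacuum e f (by omega), map_zero, inner_zero_left]

theorem vev_rho_mul_fermiDag_mul_fermi [DecidableEq F] (f g : F) {n i j : ℤ} (hj : 0 ≤ j) :
    vev (rho e f n * (fermiDag e g j * fermi e g i)) =
      if f = g ∧ i = j - n ∧ j < n then 1 else 0 := by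
  have h : rho e f n * (fermiDag e g j * fermi e g i) = fermiDag e g j * (rho e f n * fermi e g i) +
      (if f = g then 1 else 0 : ℂ) • fermiDag e g (j - n) * fermi e g i := by
    rw [← rho_lie_fermiDag, Ring.lie_def, ← mul_assoc, ← mul_assoc, ← add_mul, add_sub_cancel]
  rw [h, vev_add, vev_fermiDag_mul hj, zero_add, smul_mul_assoc, vev_smul, vev_fermiDag_mul_fermi]
  rw [ite_mul, one_mul, zero_mul, ← ite_and]
  exact if_congr (and_congr_right fun _ => by omega) rfl rfl

theorem vev_rho_mul_rho [DecidableEq F] (f g : F) (n m : ℤ) :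
    vev (rho e f n * rho e g m) = if f = g ∧ n + m = 0 then ((max n 0 : ℤ) : ℂ) else 0 := by
  rcases le_or_gt n 0 with hn | hn
  · rw [vev_rho_mul e _ f hn, max_eq_right hn]
    simp
  have h : ∀ j ∈ Finset.Ico 0 (-m), (rho e f n * (fermiDag e g j * fermi e g (j + m))) vacuum ∅ =
      if f = g ∧ n + m = 0 then 1 else 0 := fun j hj => by
    rw [Finset.mem_Ico] at hj
    rw [← vev_eq, vev_rho_mul_fermiDag_mul_fermi e f g hj.1]
    exact if_congr (and_congr_right fun _ => by omega) rfl rfl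
  rw [vev_eq, Module.End.mul_apply, rho_vacuum_eq_sum, map_sum, Finsupp.finsetSum_apply]
  refine (Finset.sum_congr rfl h).trans ?_
  split_ifs with hnm
  · rw [Finset.sum_const, Int.card_Ico, show -m - 0 = n by omega, nsmul_eq_mul, mul_one,
      max_eq_left hn.le]
    exact_mod_cast congrArg (Int.cast : ℤ → ℂ) (Int.toNat_of_nonneg hn.le)
  · exact Finset.sum_const_zero

theorem vev_rho_lie_rho [DecidableEq F] (f g : F) (n m : ℤ) :
    vev ⁅rho e f n, rho e g m⁆ = if f = g ∧ n + m = 0 then (n : ℂ) else 0 := by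
  rw [Ring.lie_def, vev_sub, vev_rho_mul_rho, vev_rho_mul_rho]
  by_cases h : f = g ∧ n + m = 0
  · obtain ⟨rfl, hnm⟩ := h
    obtain rfl : m = -n := by omega
    have hn : max n 0 - max (-n) 0 = n := max_zero_sub_max_neg_zero_eq_self n
    simp [← Int.cast_sub, hn]
  · rw [if_neg h, if_neg h, if_neg (by rwa [eq_comm, add_comm]), sub_zero]

theorem commute_lie_of_lie_lie_eq {R : Type*} [Ring R] {x y z : R}
    (h : ⁅x, ⁅y, z⁆⁆ = ⁅y, ⁅x, z⁆⁆) : Commute ⁅x, y⁆ z := by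
  have jacobi : ⁅⁅x, y⁆, z⁆ = ⁅x, ⁅y, z⁆⁆ - ⁅y, ⁅x, z⁆⁆ := by
    simp only [Ring.lie_def]
    noncomm_ring
  rw [commute_iff_lie_eq, jacobi, h, sub_self]

theorem rho_lie_rho [DecidableEq F] (f g : F) (n m : ℤ) :
    ⁅rho e f n, rho e g m⁆ = if f = g ∧ n + m = 0 then (n : ℂ) • 1 else 0 := by
  have h := eq_smul_one_of_commute_fermi (T := ⁅rho e f n, rho e g m⁆) e
    (fun h i => ?_) fun h i => ?_
  · rw [h, vev_rho_lie_rho]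
    split_ifs <;> simp
  · refine commute_lie_of_lie_lie_eq ?_
    simp only [rho_lie_fermi, lie_smul_right, smul_smul, mul_comm, add_right_comm i n m]
  · refine commute_lie_of_lie_lie_eq ?_
    simp only [rho_lie_fermiDag, lie_smul_right, smul_smul, mul_comm, sub_right_comm i n m]

theorem rho_zero_ket {S : Finset ι} {f : F} {ν : ℤ} (h : ∀ j, Filled e S f j ↔ j < ν) :
    rho e f 0 (ket S) = (ν : ℂ) • ket S := by
  have key : ∀ j, hop e f 0 j (ket S) =
      ((if j < ν then 1 else 0 : ℂ) - if j < 0 then 1 else 0) • ket S := fun j => by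
    rw [hop, add_zero, normalOrder, LinearMap.sub_apply, Module.End.mul_apply, fermiDag_fermi_ket,
      vev_fermiDag_mul_fermi]
    rw [sub_smul, ite_smul, ite_smul]
    simp [h j, apply_ite (fun T : Module.End ℂ (Core ι) => T (ket S))]
  rw [rho, opSum_apply (locFinite_hop e f 0), finsum_congr key,
    finsum_eq_sum_of_support_subset (s := Finset.Ico (min ν 0) (max ν 0))]
  · have hcard : ∀ μ ≤ max ν 0,
        (Finset.Ico (min ν 0) (max ν 0)).filter (· < μ) = Finset.Ico (min ν 0) μ := by
      intro μ hμ
      ext j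
      simp only [Finset.mem_filter, Finset.mem_Ico]
      omega
    rw [← Finset.sum_smul, Finset.sum_sub_distrib, Finset.sum_boole, Finset.sum_boole,
      hcard ν (le_max_left ν 0), hcard 0 (le_max_right ν 0), Int.card_Ico, Int.card_Ico]
    have hν : ((ν - min ν 0).toNat : ℤ) - ((0 - min ν 0).toNat : ℤ) = ν := by omega
    congr 1
    exact_mod_cast congrArg (Int.cast : ℤ → ℂ) hν
  · intro j hj
    rw [Finset.coe_Ico, Set.mem_Ico]
    by_contra hc
    refine hj ?_
    have hiff : j < ν ↔ j < 0 := by omega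
    simp [hiff]

end Chiral

theorem lie_sum_rho {F ι : Type} [LinearOrder ι] [DecidableEq F] (e : F × ℤ ≃ ι)
    {κ κ' : Type*} [Fintype κ] [Fintype κ'] (z : κ → ℂ) (w : κ' → ℂ) (f : κ → F) (g : κ' → F)
    (n n' : ℤ) : ⁅∑ x, z x • rho e (f x) n, ∑ y, w y • rho e (g y) n'⁆ =
      (∑ x, ∑ y, z x * w y * if f x = g y ∧ n + n' = 0 then (n : ℂ) else 0) •
        (1 : Module.End ℂ (Core ι)) := by
  refine (lie_sum_smul_sum_smul (A := Module.End ℂ (Core ι)) z w _ _).trans ?_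
  simp only [rho_lie_rho, Finset.sum_smul, mul_smul, ite_smul, zero_smul]

/-! ### Kronig's identity and completeness of the densities -/

section Kronig

variable {F ι : Type} {κ : Type*}

/-- The number of pairs of an empty level `l` and a filled level `l + n` above it, for the
flavor `f` in the state `ket S`. -/
def levelNumber (e : F × ℤ ≃ ι) (S : Finset ι) (f : F) : ℕ :=
  {p : Set.Ioi (0 : ℤ) × ℤ | ¬ Filled e S f p.2 ∧ Filled e S f (p.2 + p.1)}.ncard

variable {e : F × ℤ ≃ ι} {S : Finset ι} {f : F}

variable (e S f) in
theorem finite_empty_below_filled :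
    {p : Set.Ioi (0 : ℤ) × ℤ | ¬ Filled e S f p.2 ∧ Filled e S f (p.2 + p.1)}.Finite := by
  obtain ⟨A, -, h⟩ := exists_filled_bound e S
  refine ((Set.finite_Icc (-A) A).prod (Set.finite_Icc (-A) A)).of_injOn
    (f := fun p : Set.Ioi (0 : ℤ) × ℤ => (p.2, p.2 + p.1)) (fun p hp => ?_) fun p _ q _ hpq => ?_
  · have h₁ := mt (h f p.2).2 hp.1
    have h₂ := mt (h f (p.2 + p.1)).1 (not_not.2 hp.2)
    have h₃ : 0 < (p.1 : ℤ) := p.1.2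
    simp only [Set.mem_prod, Set.mem_Icc]
    omega
  · rw [Prod.mk.injEq] at hpq
    exact Prod.ext (Subtype.ext (by omega)) hpq.1

theorem levelNumber_eq_zero_of_filled_iff_lt {ν : ℤ} (h : ∀ j, Filled e S f j ↔ j < ν) :
    levelNumber e S f = 0 := by
  rw [levelNumber, Set.ncard_eq_zero (finite_empty_below_filled e S f)]
  refine Set.eq_empty_iff_forall_notMem.2 fun p hp => ?_
  have hlt : p.2 + p.1 < ν := (h _).1 hp.2
  have hpos : (0 : ℤ) < p.1 := p.1.2
  exact hp.1 ((h _).2 (by omega))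

theorem exists_filled_iff_lt_of_levelNumber_eq_zero (h : levelNumber e S f = 0) :
    ∃ ν : ℤ, ∀ j, Filled e S f j ↔ j < ν := by
  rw [levelNumber, Set.ncard_eq_zero (finite_empty_below_filled e S f)] at h
  have hdown : ∀ i j, i < j → Filled e S f j → Filled e S f i := fun i j hij hj => by
    by_contra hi
    exact Set.eq_empty_iff_forall_notMem.1 h (⟨j - i, sub_pos.2 hij⟩, i)
      ⟨hi, by simpa using hj⟩
  obtain ⟨A, -, hA⟩ := exists_filled_bound e S
  obtain ⟨ν, hν, hmin⟩ := Int.exists_least_of_bdd (P := fun j => ¬ Filled e S f j)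
    ⟨-A, fun j hj => not_lt.1 fun hc => hj ((hA f j).2 hc)⟩ ⟨A, (hA f A).1 le_rfl⟩
  refine ⟨ν, fun j => ⟨fun hj => ?_, fun hj => ?_⟩⟩
  · by_contra hc
    rcases (not_lt.1 hc).eq_or_lt with rfl | hlt
    · exact hν hj
    · exact hν (hdown ν j hlt hj)
  · by_contra hc
    exact absurd (hmin j hc) (by omega)

theorem mem_of_ket_mem {W : Submodule ℂ (Core ι)} {v : Core ι} (h : ∀ S, v S ≠ 0 → ket S ∈ W) :
    v ∈ W := by
  rw [← Finsupp.sum_single v]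
  refine W.sum_mem fun S hS => ?_
  have hsingle : Finsupp.single S (v S) = v S • ket S := by simp [ket]
  rw [hsingle]
  exact W.smul_mem _ (h S (Finsupp.mem_support_iff.1 hS))

variable [LinearOrder ι]

theorem fermi_fermi_apply (i j : ℤ) (v : Core ι) :
    fermi e f i (fermi e f j v) = -fermi e f j (fermi e f i v) :=
  eq_neg_of_add_eq_zero_left (LinearMap.congr_fun (fermi_fermi e f f i j) v)

theorem fermiDag_fermiDag_apply (i j : ℤ) (v : Core ι) :
    fermiDag e f i (fermiDag e f j v) = -fermiDag e f j (fermiDag e f i v) :=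
  eq_neg_of_add_eq_zero_left (LinearMap.congr_fun (fermiDag_fermiDag e f f i j) v)

theorem fermi_fermiDag_apply {i j : ℤ} (h : i ≠ j) (v : Core ι) :
    fermi e f i (fermiDag e f j v) = -fermiDag e f j (fermi e f i v) := by
  classical
  have h' := LinearMap.congr_fun (fermi_fermiDag e f f i j) v
  rw [if_neg (by simp [h])] at h'
  exact eq_neg_of_add_eq_zero_left h'

variable (e f) in
/-- The terms of the quartic operator `∑_{n > 0} ρ_f(-n) ρ_f(n)`, labelled by `((n, l), j)`. -/
def quartic (t : (Set.Ioi (0 : ℤ) × ℤ) × ℤ) : Module.End ℂ (Core ι) :=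
  fermiDag e f (t.2 + t.1.1) * fermi e f t.2 * (fermiDag e f t.1.2 * fermi e f (t.1.2 + t.1.1))

theorem quartic_apply_of_ne {t : (Set.Ioi (0 : ℤ) × ℤ) × ℤ} (h : t.1.2 ≠ t.2) (v : Core ι) :
    quartic e f t v = fermiDag e f (t.2 + t.1.1)
      (fermiDag e f t.1.2 (fermi e f (t.1.2 + t.1.1) (fermi e f t.2 v))) := by
  simp only [quartic, Module.End.mul_apply]
  rw [fermi_fermiDag_apply h.symm, fermi_fermi_apply, map_neg, map_neg, map_neg,
    neg_neg]

/-- Exchanges the two annihilation operators of a quartic term or its two creation operators,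
whichever keeps the transferred momentum positive. -/
def exchange (t : (Set.Ioi (0 : ℤ) × ℤ) × ℤ) : (Set.Ioi (0 : ℤ) × ℤ) × ℤ :=
  if h : t.1.2 < t.2 then ((⟨t.2 - t.1.2, sub_pos.2 h⟩, t.1.2), t.1.2 + t.1.1)
  else if h : t.2 < t.1.2 then ((⟨t.1.2 - t.2, sub_pos.2 h⟩, t.2 + t.1.1), t.2)
  else t

theorem exchange_involutive : Function.Involutive exchange := by
  rintro ⟨⟨⟨n, hn⟩, l⟩, j⟩
  rw [Set.mem_Ioi] at hn
  rcases lt_trichotomy l j with h | rfl | h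
  · simp [exchange, h, hn]
  · simp [exchange]
  · simp [exchange, h, h.not_gt, hn, hn.not_gt]

theorem exchange_of_eq {t : (Set.Ioi (0 : ℤ) × ℤ) × ℤ} (ht : t.1.2 = t.2) : exchange t = t := by
  simp [exchange, ht]

theorem exchange_offdiag {t : (Set.Ioi (0 : ℤ) × ℤ) × ℤ} (ht : t.1.2 ≠ t.2) :
    (exchange t).1.2 ≠ (exchange t).2 := fun h => by
  have hfix := exchange_of_eq h
  rw [exchange_involutive t] at hfix
  rw [← hfix] at h
  exact ht h

theorem quartic_exchange_apply {t : (Set.Ioi (0 : ℤ) × ℤ) × ℤ} (ht : t.1.2 ≠ t.2) (v : Core ι) :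
    quartic e f (exchange t) v = -quartic e f t v := by
  rw [quartic_apply_of_ne ht, quartic_apply_of_ne (exchange_offdiag ht)]
  obtain ⟨⟨⟨n, hn⟩, l⟩, j⟩ := t
  rcases lt_or_gt_of_ne ht with h | h
  · simp only at h
    simp only [exchange, h, dif_pos, add_sub_cancel, fermi_fermi_apply (l + n) j, map_neg]
    rw [add_comm l n, add_assoc, add_sub_cancel, add_comm n j, neg_neg]
  · simp only at h
    simp only [exchange, h, h.not_gt, dif_pos, dif_neg, not_false_eq_true, add_sub_cancel]
    rw [fermiDag_fermiDag_apply, add_right_comm, add_sub_cancel]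

open Classical in
theorem fermi_fermiDag_ket (j : ℤ) :
    fermi e f j (fermiDag e f j (ket S)) = if Filled e S f j then 0 else ket S := by
  have h := LinearMap.congr_fun (fermi_fermiDag e f f j j) (ket S)
  rw [if_pos ⟨rfl, rfl⟩, LinearMap.add_apply, Module.End.mul_apply, Module.End.mul_apply,
    fermiDag_fermi_ket] at h
  split_ifs at h ⊢ with hj
  · exact add_eq_right.1 h
  · rwa [add_zero] at h

open Classical in
theorem quartic_diag_ket (p : Set.Ioi (0 : ℤ) × ℤ) :
    quartic e f (p, p.2) (ket S) =
      if ¬ Filled e S f p.2 ∧ Filled e S f (p.2 + p.1) then ket S else 0 := by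
  obtain ⟨⟨n, hn⟩, l⟩ := p
  rw [Set.mem_Ioi] at hn
  have h : fermiDag e f l (fermi e f (l + n) (ket S)) =
      -fermi e f (l + n) (fermiDag e f l (ket S)) := by
    rw [fermi_fermiDag_apply (by omega), neg_neg]
  simp only [quartic, Module.End.mul_apply]
  rw [h, map_neg, fermi_fermi_apply, neg_neg, fermi_fermiDag_ket]
  by_cases hl : Filled e S f l
  · simp [hl]
  · simp [hl, fermiDag_fermi_ket]

theorem filled_of_quartic_ket_ne_zero {t : (Set.Ioi (0 : ℤ) × ℤ) × ℤ}
    (ht : quartic e f t (ket S) ≠ 0) :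
    (¬ Filled e S f t.1.2 ∧ Filled e S f (t.1.2 + t.1.1)) ∧
      (t.1.2 ≠ t.2 → Filled e S f t.2 ∧ ¬ Filled e S f (t.2 + t.1.1)) := by
  classical
  obtain ⟨⟨⟨n, hn⟩, l⟩, j⟩ := t
  rw [Set.mem_Ioi] at hn
  simp only at ht ⊢
  rcases eq_or_ne l j with rfl | hne
  · rw [quartic_diag_ket ((⟨n, hn⟩, l) : Set.Ioi (0 : ℤ) × ℤ)] at ht
    exact ⟨by_contra fun hc => ht (if_neg hc), fun h => absurd rfl h⟩
  rw [quartic_apply_of_ne hne] at ht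
  simp only at ht
  refine ⟨⟨fun hl => ht ?_, by_contra fun hl => ht ?_⟩, fun _ =>
    ⟨by_contra fun hj => ht ?_, fun hj => ht ?_⟩⟩
  · rw [← neg_eq_iff_eq_neg.2 (fermi_fermiDag_apply (by omega) _),
      ← neg_eq_iff_eq_neg.2 (fermi_fermiDag_apply hne.symm _), fermiDag_ket hl]
    simp
  · rw [fermi_fermi_apply, fermi_ket hl]
    simp
  · rw [fermi_ket hj]
    simp
  · rw [fermiDag_fermiDag_apply, ← neg_eq_iff_eq_neg.2 (fermi_fermiDag_apply (by omega) _),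
      ← neg_eq_iff_eq_neg.2 (fermi_fermiDag_apply (by omega) _), fermiDag_ket hj]
    simp

variable (e S f) in
theorem hasFiniteSupport_quartic_ket : (fun t => quartic e f t (ket S)).HasFiniteSupport := by
  obtain ⟨A, -, h⟩ := exists_filled_bound e S
  have hfin := ((Set.finite_Icc (-A) A).prod (Set.finite_Icc (-A) A)).prod
    (Set.finite_Icc (-(3 * A)) A)
  refine hfin.of_injOn (f := fun t : (Set.Ioi (0 : ℤ) × ℤ) × ℤ => ((t.1.2, t.1.2 + t.1.1), t.2))
    (fun t ht => ?_) fun t _ u _ htu => ?_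
  · obtain ⟨⟨hl, hln⟩, hj⟩ := filled_of_quartic_ket_ne_zero ht
    have h₁ := mt (h f _).2 hl
    have h₂ := mt (h f _).1 (not_not.2 hln)
    have h₃ : 0 < (t.1.1 : ℤ) := t.1.1.2
    simp only [Set.mem_prod, Set.mem_Icc]
    rcases eq_or_ne t.1.2 t.2 with heq | hne
    · omega
    · have h₄ := mt (h f _).1 (not_not.2 (hj hne).1)
      have h₅ := mt (h f _).2 (hj hne).2
      omega
  · simp only [Prod.mk.injEq] at htu
    exact Prod.ext (Prod.ext (Subtype.ext (by omega)) htu.1.1) htu.2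

theorem hop_of_ne {n : ℤ} (hn : n ≠ 0) (j : ℤ) :
    hop e f n j = fermiDag e f j * fermi e f (j + n) := by
  rw [hop, normalOrder, vev_fermiDag_mul_fermi, if_neg (by omega), zero_smul,
    sub_zero (G := Module.End ℂ (Core ι))]

theorem rho_apply {n : ℤ} (hn : n ≠ 0) (v : Core ι) :
    rho e f n v = ∑ᶠ j, fermiDag e f j (fermi e f (j + n) v) := by
  rw [rho, opSum_apply (locFinite_hop e f n)]
  simp only [hop_of_ne hn, Module.End.mul_apply]

theorem rho_neg_apply {n : ℤ} (hn : n ≠ 0) (v : Core ι) :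
    rho e f (-n) v = ∑ᶠ j, fermiDag e f (j + n) (fermi e f j v) := by
  rw [rho_apply (neg_ne_zero.2 hn), ← finsum_comp_equiv (Equiv.addRight n)]
  simp only [Equiv.coe_addRight, add_neg_cancel_right]

theorem rho_neg_rho_apply (n : Set.Ioi (0 : ℤ)) (v : Core ι) :
    rho e f (-n) (rho e f n v) = ∑ᶠ (l) (j), quartic e f ((n, l), j) v := by
  have hn : (n : ℤ) ≠ 0 := (Set.mem_Ioi.1 n.2).ne'
  have hfin := locFinite_hop e f n v
  simp only [hop_of_ne hn, Module.End.mul_apply] at hfin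
  have hmap := (rho e f (-n)).toAddMonoidHom.map_finsum hfin
  rw [LinearMap.toAddMonoidHom_coe] at hmap
  rw [rho_apply hn, hmap]
  simp only [rho_neg_apply hn]
  rfl

variable (e f) in
theorem locFinite_rho_neg_mul_rho :
    LocFinite fun n : Set.Ioi (0 : ℤ) => rho e f (-n) * rho e f n := by
  refine locFinite_of_ket fun S => ?_
  obtain ⟨A, -, h⟩ := exists_filled_bound e S
  refine ((Set.finite_Icc 0 (2 * A)).preimage Subtype.val_injective.injOn).subset fun n hn => ?_
  have hn₀ : 0 < (n : ℤ) := n.2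
  by_contra hc
  rw [Set.mem_preimage, Set.mem_Icc] at hc
  refine hn (?_ : (rho e f (-n) * rho e f n) (ket S) = 0)
  rw [Module.End.mul_apply, rho_apply hn₀.ne', finsum_eq_zero_of_forall_eq_zero, map_zero]
  intro j
  by_cases hj : j < -A
  · rw [← neg_eq_iff_eq_neg.2 (fermi_fermiDag_apply (by omega) _), fermiDag_ket ((h f j).2 hj)]
    simp
  · rw [fermi_ket ((h f _).1 (by omega)), map_zero]

variable (e) in
/-- The operator `∑_{n > 0} ρ_f(-n) ρ_f(n)`. -/
def level (f : F) : Module.End ℂ (Core ι) :=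
  opSum fun n : Set.Ioi (0 : ℤ) => rho e f (-n) * rho e f n

variable (e f) in
theorem level_apply_eq_finsum_quartic (S : Finset ι) :
    level e f (ket S) = ∑ᶠ t, quartic e f t (ket S) := by
  have hfin := hasFiniteSupport_quartic_ket e S f
  rw [level, opSum_apply (locFinite_rho_neg_mul_rho e f), finsum_curry _ hfin, finsum_curry]
  · simp only [Module.End.mul_apply, rho_neg_rho_apply]
  · exact (hfin.image Prod.fst).subset fun p hp => by
      by_contra hc
      exact hp (finsum_eq_zero_of_forall_eq_zero fun j =>
        by_contra fun hj => hc ⟨(p, j), hj, rfl⟩)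

theorem finsum_eq_zero_of_antisymm {M : Type*} [AddCommGroup M] [IsAddTorsionFree M] (g : κ ≃ κ)
    {X : κ → M} (h : ∀ t, X (g t) = -X t) : ∑ᶠ t, X t = 0 := by
  have hX : ∑ᶠ t, X t = -∑ᶠ t, X t := by
    rw [← finsum_neg_distrib, ← finsum_comp_equiv g]
    exact finsum_congr h
  exact self_eq_neg.1 hX

variable (e S f) in
theorem finsum_quartic_diag_ket :
    ∑ᶠ t : (Set.Ioi (0 : ℤ) × ℤ) × ℤ, (if t.1.2 = t.2 then quartic e f t (ket S) else 0) =
      (levelNumber e S f : ℂ) • ket S := by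
  classical
  have hfin := finite_empty_below_filled e S f
  have hdiag : ∀ p : Set.Ioi (0 : ℤ) × ℤ,
      ∑ᶠ j, (if p.2 = j then quartic e f (p, j) (ket S) else 0) =
        if p ∈ hfin.toFinset then ket S else 0 := fun p => by
    rw [finsum_eq_single _ p.2 fun j hj => if_neg hj.symm, if_pos rfl, quartic_diag_ket]
    simp only [Set.Finite.mem_toFinset, Set.mem_ofPred_eq]
  rw [finsum_curry, finsum_congr hdiag,
    finsum_eq_sum_of_support_subset (s := hfin.toFinset), Finset.sum_ite_mem, Finset.inter_self,
    Finset.sum_const, levelNumber, Set.ncard_eq_toFinset_card _ hfin, Nat.cast_smul_eq_nsmul]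
  · exact fun p hp => by_contra fun hc => hp (if_neg hc)
  · exact (hasFiniteSupport_quartic_ket e S f).subset fun t ht hc => ht (by simp [hc])

variable (e S f) in
theorem finsum_quartic_offdiag_ket :
    ∑ᶠ t : (Set.Ioi (0 : ℤ) × ℤ) × ℤ, (if t.1.2 = t.2 then 0 else quartic e f t (ket S)) = 0 := by
  refine finsum_eq_zero_of_antisymm exchange_involutive.toPerm fun t => ?_
  rw [exchange_involutive.coe_toPerm]
  rcases eq_or_ne t.1.2 t.2 with ht | ht
  · rw [exchange_of_eq ht, if_pos ht, neg_zero]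
  · rw [if_neg ht, if_neg (exchange_offdiag ht), quartic_exchange_apply ht]

/-- Kronig's identity: off the diagonal, `exchange` pairs the quartic terms with opposite signs. -/
theorem level_ket (e : F × ℤ ≃ ι) (S : Finset ι) (f : F) :
    level e f (ket S) = (levelNumber e S f : ℂ) • ket S := by
  have hfin := hasFiniteSupport_quartic_ket e S f
  have hsplit : ∀ t, quartic e f t (ket S) = (if t.1.2 = t.2 then quartic e f t (ket S) else 0) +
      if t.1.2 = t.2 then 0 else quartic e f t (ket S) := fun t => by
    split_ifs <;> simp
  rw [level_apply_eq_finsum_quartic, finsum_congr hsplit, finsum_add_distrib,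
    finsum_quartic_diag_ket, finsum_quartic_offdiag_ket, add_zero]
  · exact hfin.subset fun t ht hc => ht (by simp [hc])
  · exact hfin.subset fun t ht hc => ht (by simp [hc])

theorem level_apply (v : Core ι) : level e f v S = levelNumber e S f * v S := by
  classical
  induction v using Core.induction with
  | ket U =>
    rw [level_ket]
    by_cases h : U = S
    · subst h; simp
    · simp [ket, h]
  | add v w hv hw => simp only [map_add, Finsupp.add_apply, hv, hw, mul_add]
  | smul z v hv => simp only [map_smul, Finsupp.smul_apply, hv, smul_eq_mul, mul_left_comm]

theorem mul_lie_eq_add {R : Type*} [Ring R] (x y z : R) : ⁅x * y, z⁆ = x * ⁅y, z⁆ + ⁅x, z⁆ * y := by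
  simp only [Ring.lie_def]
  noncomm_ring

theorem level_lie_rho [DecidableEq F] (f g : F) {n : ℤ} (hn : 0 < n) :
    ⁅level e f, rho e g n⁆ = if f = g then (-n : ℂ) • rho e g n else 0 := by
  have hterm : ∀ m : Set.Ioi (0 : ℤ), ⁅rho e f (-m) * rho e f m, rho e g n⁆ =
      if f = g ∧ m = n then (-n : ℂ) • rho e g n else 0 := fun m => by
    have hm : 0 < (m : ℤ) := m.2
    rw [mul_lie_eq_add (R := Module.End ℂ (Core ι)), rho_lie_rho, rho_lie_rho, if_neg (by omega),
      mul_zero, zero_add]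
    by_cases h : f = g ∧ m = n
    · obtain ⟨rfl, h⟩ := h
      simp [h]
    · rw [if_neg h, if_neg fun hc => h ⟨hc.1, by omega⟩, zero_mul]
  rw [level, opSum_lie (locFinite_rho_neg_mul_rho e f),
    opSum_eq_single ⟨n, hn⟩ fun m hm => by
      rw [hterm, if_neg fun h => hm (Subtype.ext h.2)], hterm]
  simp

theorem levelNumber_of_rho_ket_ne_zero [DecidableEq F] {g : F} {n : ℤ} (hn : 0 < n) {U : Finset ι}
    (hU : rho e f n (ket S) U ≠ 0) :
    (levelNumber e U g : ℤ) = levelNumber e S g - if g = f then n else 0 := by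
  have h := congr($(level_lie_rho (e := e) g f hn) (ket S) U)
  rw [Ring.lie_def, LinearMap.sub_apply, Module.End.mul_apply, Module.End.mul_apply, level_ket,
    map_smul, Finsupp.sub_apply, level_apply, Finsupp.smul_apply, smul_eq_mul, ← sub_mul] at h
  have hC : (levelNumber e U g - levelNumber e S g : ℂ) = if g = f then (-n : ℂ) else 0 := by
    refine mul_right_cancel₀ hU (h.trans ?_)
    split_ifs <;> simp
  rw [sub_eq_iff_eq_add] at hC
  split_ifs at hC ⊢
  · exact_mod_cast hC.trans (neg_add_eq_sub _ _)
  · simpa using hC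

theorem rho_ket_eq_zero {n : ℤ} {ν : ℤ} (h : ∀ j, Filled e S f j ↔ j < ν) (hn : 0 < n) :
    rho e f n (ket S) = 0 := by
  classical
  refine Finsupp.ext fun U => by_contra fun hU => ?_
  have hlevel := levelNumber_of_rho_ket_ne_zero (g := f) hn hU
  rw [levelNumber_eq_zero_of_filled_iff_lt h, if_pos rfl] at hlevel
  omega

/-- By Kronig's identity a state of positive level is obtained from states of lower level by
applying densities. -/
theorem eq_top_of_rho_invariant [Finite F] {W : Submodule ℂ (Core ι)}
    (hρ : ∀ f n, 0 < n → ∀ v ∈ W, rho e f (-n) v ∈ W)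
    (hsea : ∀ (S : Finset ι) (ν : F → ℤ), (∀ f j, Filled e S f j ↔ j < ν f) → ket S ∈ W) :
    W = ⊤ := by
  classical
  have := Fintype.ofFinite F
  suffices h : ∀ N S, ∑ f, levelNumber e S f = N → ket S ∈ W from
    eq_top_iff.2 fun v _ => mem_of_ket_mem fun S _ => h _ S rfl
  intro N
  induction N using Nat.strong_induction_on with | _ N ih
  rintro S rfl
  by_cases h₀ : ∀ f, levelNumber e S f = 0
  · choose ν hν using fun f => exists_filled_iff_lt_of_levelNumber_eq_zero (h₀ f)
    exact hsea S ν hν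
  push Not at h₀
  obtain ⟨f, hf⟩ := h₀
  have hlower : ∀ n, 0 < n → rho e f n (ket S) ∈ W := fun n hn => mem_of_ket_mem fun U hU => by
    have hlevel := fun g => levelNumber_of_rho_ket_ne_zero (g := g) hn hU
    refine ih _ (Finset.sum_lt_sum (fun g _ => ?_) ⟨f, Finset.mem_univ _, ?_⟩) U rfl
    · have := hlevel g
      split_ifs at this <;> omega
    · have := hlevel f
      rw [if_pos rfl] at this
      omega
  have hmem : level e f (ket S) ∈ W := by
    rw [level, opSum_apply (locFinite_rho_neg_mul_rho e f)]
    exact finsum_induction (· ∈ W) W.zero_mem (fun _ _ => W.add_mem) fun n =>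
      hρ f n n.2 _ (hlower n n.2)
  rw [level_ket] at hmem
  exact (W.smul_mem_iff (Nat.cast_ne_zero.2 hf)).1 hmem

theorem eq_smul_ket_of_rho_eq_zero {v : Core ι} {ν : F → ℤ}
    (h : ∀ f n, 0 < n → rho e f n v = 0) (hν : ∀ f, rho e f 0 v = (ν f : ℂ) • v)
    (hS : ∀ f j, Filled e S f j ↔ j < ν f) : v = v S • ket S := by
  have hv : ∀ U, v U ≠ 0 → U = S := fun U hU => filled_injective (e := e) fun f j => by
    have hlevel : level e f v = 0 := by
      rw [level, opSum_apply (locFinite_rho_neg_mul_rho e f)]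
      exact finsum_eq_zero_of_forall_eq_zero fun n => by
        rw [Module.End.mul_apply, h f _ n.2, map_zero]
    have hzero : levelNumber e U f = 0 := by
      have := level_apply (e := e) (f := f) (S := U) v
      rw [hlevel] at this
      simpa [hU] using this.symm
    obtain ⟨μ, hμ⟩ := exists_filled_iff_lt_of_levelNumber_eq_zero hzero
    have hadj := isAdj_rho e f 0 (ket U) v
    rw [neg_zero, rho_zero_ket e hμ, hν, map_smul, map_smul, inner_smul_left, inner_smul_right,
      inner_ket_left, map_intCast] at hadj
    have hμν : μ = ν f := by exact_mod_cast mul_right_cancel₀ hU hadj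
    rw [hμ, hS, hμν]
  ext U
  by_cases hU : U = S
  · subst hU; simp [ket]
  · rw [not_ne_iff.1 (mt (hv U) hU)]
    simp [ket, Ne.symm hU]

end Kronig

/-! ### Bosonic Fock states -/

section Monomial

variable {A : Type*} [Ring A] [Algebra ℂ A]

/-- The divided power `x ^ n / √(n!)`, normalized for boson creation operators. -/
def sqrtDividedPow (x : A) (n : ℕ) : A := ((1 / √(n.factorial : ℝ) : ℝ) : ℂ) • x ^ n

theorem sqrtDividedPow_zero (x : A) : sqrtDividedPow x 0 = 1 := by simp [sqrtDividedPow]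

theorem sqrtDividedPow_succ (x : A) (n : ℕ) : sqrtDividedPow x (n + 1) =
    ((1 / √((n : ℝ) + 1) : ℝ) : ℂ) • (x * sqrtDividedPow x n) := by
  have h : 1 / √((n + 1).factorial : ℝ) = 1 / √((n : ℝ) + 1) * (1 / √(n.factorial : ℝ)) := by
    rw [Nat.factorial_succ, Nat.cast_mul, Real.sqrt_mul (by positivity), Nat.cast_succ,
      one_div_mul_one_div]
  rw [sqrtDividedPow, sqrtDividedPow, mul_smul_comm, smul_smul, ← Complex.ofReal_mul, ← h,
    pow_succ']

theorem commute_sqrtDividedPow {x y : A} (h : Commute x y) (n : ℕ) :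
    Commute x (sqrtDividedPow y n) :=
  (h.pow_right n).smul_right _

variable {β : Type*} {c : β → A}

/-- The normalized monomial with exponents `N` in the operators `c m`, multiplied in an arbitrary
order. -/
def monomial (c : β → A) (N : β →₀ ℕ) : A :=
  (N.support.toList.map fun m => sqrtDividedPow (c m) (N m)).prod

theorem monomial_zero : monomial c 0 = 1 := by simp [monomial]

theorem commute_monomial {x : A} {N : β →₀ ℕ} (h : ∀ m, Commute x (c m)) :
    Commute x (monomial c N) := by
  refine Commute.list_prod_right _ _ fun y hy => ?_
  obtain ⟨m, -, rfl⟩ := List.mem_map.1 hy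
  exact commute_sqrtDividedPow (h m) _

theorem commute_sqrtDividedPow_sqrtDividedPow (hc : ∀ m m', Commute (c m) (c m')) (N : β →₀ ℕ)
    (m m' : β) : Commute (sqrtDividedPow (c m) (N m)) (sqrtDividedPow (c m') (N m')) :=
  commute_sqrtDividedPow (commute_sqrtDividedPow (hc m m').symm _).symm _

theorem monomial_eq_mul_noncommProd [DecidableEq β] (hc : ∀ m m', Commute (c m) (c m'))
    (N : β →₀ ℕ) (m : β) : monomial c N = sqrtDividedPow (c m) (N m) *
      (N.support.erase m).noncommProd (fun k => sqrtDividedPow (c k) (N k))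
        fun k _ k' _ _ => commute_sqrtDividedPow_sqrtDividedPow hc N k k' := by
  have h : monomial c N = N.support.noncommProd (fun k => sqrtDividedPow (c k) (N k))
      fun k _ k' _ _ => commute_sqrtDividedPow_sqrtDividedPow hc N k k' := by
    rw [monomial, ← Multiset.noncommProd_coe _ fun x hx y hy _ => ?_]
    · simp only [← Multiset.map_coe, Finset.coe_toList]
      rfl
    · obtain ⟨k, -, rfl⟩ := List.mem_map.1 hx
      obtain ⟨k', -, rfl⟩ := List.mem_map.1 hy
      exact commute_sqrtDividedPow_sqrtDividedPow hc N k k'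
  rw [h]
  by_cases hm : m ∈ N.support
  · exact (Finset.mul_noncommProd_erase _ hm _ _).symm
  · simp only [Finsupp.notMem_support_iff.1 hm, sqrtDividedPow_zero, one_mul,
      Finset.erase_eq_of_notMem hm]

theorem monomial_add_single (hc : ∀ m m', Commute (c m) (c m')) (N : β →₀ ℕ) (m : β) :
    monomial c (N + Finsupp.single m 1) =
      ((1 / √((N m : ℝ) + 1) : ℝ) : ℂ) • (c m * monomial c N) := by
  classical
  have hsupport : (N + Finsupp.single m 1).support.erase m = N.support.erase m := by
    ext k
    by_cases hk : k = m <;> simp [hk, eq_comm]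
  rw [monomial_eq_mul_noncommProd hc _ m, monomial_eq_mul_noncommProd hc N m, Finsupp.add_apply,
    Finsupp.single_eq_same, sqrtDividedPow_succ, smul_mul_assoc, mul_assoc]
  congr 3
  refine Finset.noncommProd_congr hsupport (fun k hk => ?_) _
  simp [(Finset.ne_of_mem_erase hk)]

theorem mul_monomial (hc : ∀ m m', Commute (c m) (c m')) (N : β →₀ ℕ) (m : β) :
    c m * monomial c N = ((√((N m : ℝ) + 1) : ℝ) : ℂ) • monomial c (N + Finsupp.single m 1) := by
  have h : √((N m : ℝ) + 1) ≠ 0 := by positivity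
  rw [monomial_add_single hc, smul_smul, ← Complex.ofReal_mul, mul_one_div_cancel h,
    Complex.ofReal_one, one_smul]

end Monomial

theorem occupation_induction {β : Type*} {P : (β →₀ ℕ) → Prop} (zero : P 0)
    (add_single : ∀ N m, P N → P (N + Finsupp.single m 1)) (N : β →₀ ℕ) : P N := by
  classical
  rw [← Multiset.toFinsupp.apply_symm_apply N]
  induction Multiset.toFinsupp.symm N using Multiset.induction_on with
  | empty => rwa [map_zero]
  | cons m s ih =>
    rw [← Multiset.singleton_add, map_add, Multiset.toFinsupp_singleton, add_comm]
    exact add_single _ m ih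

theorem inner_eq_zero_of_eigenvectors {ι : Type} {T : Module.End ℂ (Core ι)} (hT : IsAdj T T)
    {v w : Core ι} {x y : ℝ} (hv : T v = (x : ℂ) • v) (hw : T w = (y : ℂ) • w) (h : x ≠ y) :
    inner ℂ (toSpace v) (toSpace w) = (0 : ℂ) := by
  have := hT v w
  rw [hv, hw, map_smul, map_smul, inner_smul_left, inner_smul_right, Complex.conj_ofReal] at this
  by_contra hc
  exact h (by exact_mod_cast mul_right_cancel₀ hc this)

/-- The canonical commutation relations of boson annihilation operators `b m` and their adjoints,
the creation operators `bd m`. -/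
structure IsBosonic {ι : Type} {β : Type*} (b bd : β → Module.End ℂ (Core ι)) : Prop where
  isAdj : ∀ m, IsAdj (b m) (bd m)
  commute : ∀ m m', Commute (b m) (b m')
  lie : ∀ m m', ⁅b m, bd m'⁆ = open Classical in if m = m' then 1 else 0

namespace IsBosonic

variable {ι : Type} {β : Type*} {b bd : β → Module.End ℂ (Core ι)} (h : IsBosonic b bd)
include h

theorem commute_creation (m m' : β) : Commute (bd m) (bd m') := by
  have hadj := (h.isAdj m').mul (h.isAdj m)
  rw [h.commute m' m] at hadj
  exact hadj.unique ((h.isAdj m).mul (h.isAdj m'))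

theorem number_mul_creation (m k : β) : bd m * b m * bd k =
    bd k * (bd m * b m) + open Classical in if m = k then bd k else 0 := by
  have hb : b m * bd k = bd k * b m + open Classical in if m = k then 1 else 0 :=
    sub_eq_iff_eq_add'.1 (h.lie m k)
  rw [mul_assoc, hb, mul_add, ← mul_assoc, h.commute_creation m k, mul_assoc]
  split_ifs with hmk
  · rw [hmk, mul_one]
  · rw [mul_zero]

theorem creation_monomial (N : β →₀ ℕ) (m : β) (g : Core ι) : bd m (monomial bd N g) =
    ((√((N m : ℝ) + 1) : ℝ) : ℂ) • monomial bd (N + Finsupp.single m 1) g :=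
  congrArg (fun T : Module.End ℂ (Core ι) => T g) (mul_monomial h.commute_creation N m)

variable {g g' : Core ι} (hg : ∀ m, b m g = 0)
include hg

theorem number_monomial (N : β →₀ ℕ) (m : β) :
    bd m (b m (monomial bd N g)) = (N m : ℂ) • monomial bd N g := by
  classical
  induction N using occupation_induction with
  | zero => simp [monomial_zero, hg]
  | add_single N k ih =>
    have hnumber := congrArg (fun T : Module.End ℂ (Core ι) => T (monomial bd N g))
      (h.number_mul_creation m k)
    simp only [Module.End.mul_apply, LinearMap.add_apply, ih, map_smul] at hnumber
    rw [monomial_add_single h.commute_creation, LinearMap.smul_apply, Module.End.mul_apply,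
      map_smul, map_smul, hnumber]
    by_cases hmk : m = k
    · subst hmk
      rw [if_pos rfl, Finsupp.add_apply, Finsupp.single_eq_same, Nat.cast_succ]
      module
    · rw [if_neg hmk, LinearMap.zero_apply, add_zero, Finsupp.add_apply,
        Finsupp.single_eq_of_ne hmk, add_zero, smul_comm]

theorem inner_monomial_self (N : β →₀ ℕ) (g' : Core ι) :
    inner ℂ (toSpace (monomial bd N g')) (toSpace (monomial bd N g)) =
      (inner ℂ (toSpace g') (toSpace g) : ℂ) := by
  classical
  induction N using occupation_induction with
  | zero => simp [monomial_zero]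
  | add_single N m ih =>
    have hpos : (0 : ℝ) < (N m : ℝ) + 1 := by positivity
    have hccr : b m (bd m (monomial bd N g)) = ((N m : ℂ) + 1) • monomial bd N g := by
      have := congrArg (fun T : Module.End ℂ (Core ι) => T (monomial bd N g)) (h.lie m m)
      simp only [Ring.lie_def, LinearMap.sub_apply, Module.End.mul_apply, if_true,
        h.number_monomial hg, Module.End.one_apply] at this
      rw [sub_eq_iff_eq_add.1 this, add_comm, add_smul, one_smul]
    rw [← ih, monomial_add_single h.commute_creation, LinearMap.smul_apply, LinearMap.smul_apply,
      Module.End.mul_apply, Module.End.mul_apply, map_smul, map_smul, inner_smul_left,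
      inner_smul_right, h.isAdj m, hccr, map_smul, inner_smul_right, Complex.conj_ofReal,
      ← mul_assoc, ← mul_assoc, ← Complex.ofReal_mul, div_mul_div_comm, one_mul,
      Real.mul_self_sqrt hpos.le]
    have hne : (N m : ℂ) + 1 ≠ 0 := by exact_mod_cast hpos.ne'
    push_cast
    field_simp

theorem inner_monomial_of_ne (hg' : ∀ m, b m g' = 0) {N N' : β →₀ ℕ} (hN : N ≠ N') :
    inner ℂ (toSpace (monomial bd N g)) (toSpace (monomial bd N' g')) = (0 : ℂ) := by
  obtain ⟨m, hm⟩ := DFunLike.ne_iff.1 hN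
  refine inner_eq_zero_of_eigenvectors ((h.isAdj m).symm.mul (h.isAdj m)) (x := N m) (y := N' m)
    ?_ ?_ (by exact_mod_cast hm)
  · exact_mod_cast h.number_monomial hg N m
  · exact_mod_cast h.number_monomial hg' N' m

end IsBosonic

/-! ### Unitary operators on the core -/

section Core

variable {ι : Type} {κ : Type*}

theorem norm_toSpace_ket (S : Finset ι) : ‖toSpace (ket S)‖ = 1 := by
  rw [norm_eq_sqrt_re_inner (𝕜 := ℂ), inner_ket_left]
  simp [ket]

theorem denseRange_toSpace : DenseRange (toSpace : Core ι → Space ι) := by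
  refine Submodule.dense_iff_topologicalClosure_eq_top (s := LinearMap.range toSpace) |>.2 ?_
  rw [Submodule.topologicalClosure_eq_top_iff, Submodule.eq_bot_iff]
  intro x hx
  classical
  ext S
  have hS : inner ℂ (toSpace (ket S)) x = (0 : ℂ) := hx _ ⟨_, rfl⟩
  rw [toSpace, ket, Finsupp.linearCombination_single, one_smul, lp.inner_single_left] at hS
  simpa using hS

theorem topologicalClosure_span_toSpace_eq_top {v : κ → Core ι}
    (h : Submodule.span ℂ (Set.range v) = ⊤) :
    (Submodule.span ℂ (Set.range fun i => toSpace (v i))).topologicalClosure = ⊤ := by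
  have hspan : Submodule.span ℂ (Set.range fun i => toSpace (v i)) =
      LinearMap.range (toSpace : Core ι →ₗ[ℂ] Space ι) := by
    rw [LinearMap.range_eq_map, ← h, Submodule.map_span, ← Set.range_comp]
    rfl
  rw [hspan]
  exact Submodule.dense_iff_topologicalClosure_eq_top.1 denseRange_toSpace

theorem continuousLinearMap_ext_core {A B : Space ι →L[ℂ] Space ι} (E : Module.Basis κ ℂ (Core ι))
    (h : ∀ i, A (toSpace (E i)) = B (toSpace (E i))) : A = B := by
  have hAB : A.toLinearMap ∘ₗ toSpace = B.toLinearMap ∘ₗ toSpace := E.ext h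
  exact DFunLike.coe_injective (denseRange_toSpace.equalizer A.continuous B.continuous
    (funext fun v => congrArg (fun T => T v) hAB))

theorem norm_toSpace_apply_of_orthonormal {E : Module.Basis κ ℂ (Core ι)} {φ : Core ι ≃ₗ[ℂ] Core ι}
    (hE : Orthonormal ℂ fun i => toSpace (E i)) (hφ : Orthonormal ℂ fun i => toSpace (φ (E i)))
    (v : Core ι) : ‖toSpace (φ v)‖ = ‖toSpace v‖ := by
  have hv : toSpace v = Finsupp.linearCombination ℂ (fun i => toSpace (E i)) (E.repr v) := by
    conv_lhs => rw [← E.linearCombination_repr v, Finsupp.apply_linearCombination]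
    rfl
  have hφv : toSpace (φ v) =
      Finsupp.linearCombination ℂ (fun i => toSpace (φ (E i))) (E.repr v) := by
    conv_lhs => rw [← E.linearCombination_repr v, ← LinearEquiv.coe_coe,
      Finsupp.apply_linearCombination, Finsupp.apply_linearCombination]
    rfl
  rw [norm_eq_sqrt_re_inner (𝕜 := ℂ), norm_eq_sqrt_re_inner (𝕜 := ℂ), hv, hφv,
    hE.inner_finsupp_eq_sum_left, hφ.inner_finsupp_eq_sum_left]

variable (ι) in
/-- The group of linear automorphisms of the core that preserve the norm. -/
def coreIsometries : Subgroup (Core ι ≃ₗ[ℂ] Core ι) where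
  carrier := {φ | ∀ v, ‖toSpace (φ v)‖ = ‖toSpace v‖}
  one_mem' _ := rfl
  mul_mem' hφ hφ' v := (hφ _).trans (hφ' v)
  inv_mem' {φ} hφ v := by
    rw [← hφ, ← LinearEquiv.mul_apply, mul_inv_cancel]
    rfl

/-- The rescaled permutation of a basis mapping `E i` to `w i • E (σ i)`. -/
def weightedShift (E : Module.Basis κ ℂ (Core ι)) (σ : Equiv.Perm κ) (w : κ → ℂˣ) :
    Core ι ≃ₗ[ℂ] Core ι :=
  E.equiv ((E.reindex σ.symm).unitsSMul w) (Equiv.refl κ)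

theorem weightedShift_apply (E : Module.Basis κ ℂ (Core ι)) (σ : Equiv.Perm κ) (w : κ → ℂˣ)
    (i : κ) : weightedShift E σ w (E i) = (w i : ℂ) • E (σ i) := by
  rw [weightedShift, Module.Basis.equiv_apply, Module.Basis.unitsSMul_apply, Units.smul_def,
    Module.Basis.reindex_apply]
  rfl

theorem weightedShift_mem_coreIsometries {E : Module.Basis κ ℂ (Core ι)}
    (hE : Orthonormal ℂ fun i => toSpace (E i)) (σ : Equiv.Perm κ) {w : κ → ℂˣ}
    (hw : ∀ i, ‖(w i : ℂ)‖ = 1) : weightedShift E σ w ∈ coreIsometries ι := by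
  refine norm_toSpace_apply_of_orthonormal hE ⟨fun i => ?_, fun i j hij => ?_⟩
  · simp only [weightedShift_apply]
    rw [map_smul, norm_smul, hw, hE.1, mul_one]
  · simp only [weightedShift_apply]
    rw [map_smul, map_smul, inner_smul_left, inner_smul_right, hE.2 (σ.injective.ne hij),
      mul_zero, mul_zero]

end Core

namespace CoreUnitary

variable {ι : Type}

/-- The continuous extension of a norm preserving automorphism of the core. -/
def ofIsometry (φ : coreIsometries ι) : CoreUnitary ι where
  op := Unitary.linearIsometryEquiv.symm
    (φ.1.extendOfIsometry toSpace toSpace denseRange_toSpace denseRange_toSpace φ.2)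
  onCore := φ.1
  op_toSpace v := LinearEquiv.extendOfIsometry_eq _ _ _ denseRange_toSpace denseRange_toSpace φ.2 v

theorem onCore_mem_coreIsometries (U : CoreUnitary ι) : U.onCore ∈ coreIsometries ι := fun v => by
  rw [← U.op_toSpace]
  exact ContinuousLinearMap.norm_map_of_mem_unitary U.op.2 _

theorem star_op_toSpace (U : CoreUnitary ι) (v : Core ι) :
    star (U.op : Space ι →L[ℂ] Space ι) (toSpace v) = toSpace (U.onCore.symm v) := by
  have hv : toSpace v = (U.op : Space ι →L[ℂ] Space ι) (toSpace (U.onCore.symm v)) := by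
    rw [U.op_toSpace, LinearEquiv.apply_symm_apply]
  rw [hv]
  exact congrArg (fun T : Space ι →L[ℂ] Space ι => T (toSpace (U.onCore.symm v)))
    (Unitary.coe_star_mul_self U.op)

theorem isAdj_toEnd (U : CoreUnitary ι) : IsAdj U.toEnd U.onCore.symm.toLinearMap := fun v w => by
  change inner ℂ (toSpace (U.onCore.symm v)) (toSpace w) = _
  rw [← U.star_op_toSpace, ContinuousLinearMap.star_eq_adjoint,
    ContinuousLinearMap.adjoint_inner_left, U.op_toSpace]
  rfl

theorem commute_of_isAdj (U : CoreUnitary ι) {T T' : Module.End ℂ (Core ι)} (hT : IsAdj T T')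
    (h : Commute T' U.toEnd) : Commute T U.toEnd := by
  have hinv : U.onCore.symm.toLinearMap * T' = T' * U.onCore.symm.toLinearMap :=
    LinearMap.ext fun v => U.onCore.symm_apply_eq.2 <| by
      have hv := congrArg (fun A : Module.End ℂ (Core ι) => A (U.onCore.symm v)) h.eq
      exact (congrArg T' (U.onCore.apply_symm_apply v)).symm.trans hv
  have hadj := U.isAdj_toEnd.symm.mul hT.symm
  rw [hinv] at hadj
  exact hadj.unique (hT.symm.mul U.isAdj_toEnd.symm)

end CoreUnitary

section RaisesBy

variable {K V : Type*} [CommRing K] [AddCommGroup V] [Module K V]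

/-- `[T, φ] = z φ`, so that `φ` maps eigenvectors of `T` with eigenvalue `x` to eigenvectors with
eigenvalue `x + z`. -/
def RaisesBy (T : Module.End K V) (φ : V ≃ₗ[K] V) (z : K) : Prop :=
  ∀ v, T (φ v) = φ (T v) + z • φ v

theorem raisesBy_iff {T : Module.End K V} {φ : V ≃ₗ[K] V} {z : K} :
    RaisesBy T φ z ↔ T * φ.toLinearMap - φ.toLinearMap * T = z • φ.toLinearMap :=
  ⟨fun h => LinearMap.ext fun v => sub_eq_iff_eq_add'.2 (h v),
    fun h v => sub_eq_iff_eq_add'.1 (congrArg (fun A : Module.End K V => A v) h)⟩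

theorem raisesBy_zero_iff {T : Module.End K V} {φ : V ≃ₗ[K] V} :
    RaisesBy T φ 0 ↔ Commute T φ.toLinearMap := by
  rw [raisesBy_iff, zero_smul, sub_eq_zero]
  rfl

namespace RaisesBy

variable {T : Module.End K V} {φ φ' : V ≃ₗ[K] V} {z z' : K}

theorem one : RaisesBy T 1 0 := fun v => by simp

theorem mul (h : RaisesBy T φ z) (h' : RaisesBy T φ' z') : RaisesBy T (φ * φ') (z + z') :=
  fun v => by
    rw [LinearEquiv.mul_apply, LinearEquiv.mul_apply, h, h', map_add, map_smul]
    module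

theorem inv (h : RaisesBy T φ z) : RaisesBy T φ⁻¹ (-z) := fun v => by
  have hφ (w : V) : φ (φ⁻¹ w) = w := φ.apply_symm_apply w
  have hv := h (φ⁻¹ v)
  rw [hφ] at hv
  refine φ.injective ?_
  rw [map_add, map_smul, hφ, hφ, hv]
  module

theorem zpow (h : RaisesBy T φ z) (k : ℤ) : RaisesBy T (φ ^ k) (k * z) := by
  induction k using Int.induction_on with
  | zero => simpa using one
  | succ k ih =>
    rw [zpow_add_one]
    convert! ih.mul h using 1
    push_cast
    ring
  | pred k ih =>
    rw [zpow_sub_one]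
    convert! ih.mul h.inv using 1
    push_cast
    ring

theorem list_prod {β : Type*} {ψ : β → V ≃ₗ[K] V} {x : β → K} (h : ∀ i, RaisesBy T (ψ i) (x i))
    (l : List β) : RaisesBy T (l.map ψ).prod (l.map x).sum := by
  induction l with
  | nil => exact one
  | cons i l ih => exact (h i).mul ih

end RaisesBy

end RaisesBy

/-! ### Klein factors -/

section KleinSign

variable {Φ : Type*} [Fintype Φ] [LinearOrder Φ]

/-- The sign that makes the Klein factors of different flavors anticommute, an analogue of the
Jordan-Wigner sign. -/
def kleinSign (f : Φ) (ν : Φ → ℤ) : ℂˣ := (-1) ^ ∑ g with g < f, ν g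

theorem kleinSign_mul_self (f : Φ) (ν : Φ → ℤ) : kleinSign f ν * kleinSign f ν = 1 := by
  rw [kleinSign, ← mul_zpow, neg_one_mul, neg_neg, one_zpow]

theorem norm_kleinSign (f : Φ) (ν : Φ → ℤ) : ‖(kleinSign f ν : ℂ)‖ = 1 := by
  simp [kleinSign]

theorem kleinSign_add_single (f g : Φ) (ν : Φ → ℤ) :
    kleinSign f (ν + Pi.single g 1) = (if g < f then -1 else 1) * kleinSign f ν := by
  simp only [kleinSign, Pi.add_apply, Finset.sum_add_distrib, zpow_add, Finset.sum_pi_single',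
    Finset.mem_filter, Finset.mem_univ, true_and]
  split_ifs <;> simp

theorem kleinSign_sub_single (f g : Φ) (ν : Φ → ℤ) :
    kleinSign f (ν - Pi.single g 1) = (if g < f then -1 else 1) * kleinSign f ν := by
  have h := kleinSign_add_single f g (ν - Pi.single g 1)
  rw [sub_add_cancel] at h
  rw [h, ← mul_assoc]
  split_ifs <;> simp

end KleinSign

section KleinFactor

variable {ι : Type} {β Φ : Type*} [Fintype Φ] [LinearOrder Φ]
  {E : Module.Basis (β × (Φ → ℤ)) ℂ (Core ι)} (hE : Orthonormal ℂ fun q => toSpace (E q))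

/-- The Klein factor of flavor `f`, defined by its action on an orthonormal basis labelled by the
charges `ν` and further quantum numbers: up to a sign, it raises the charge `ν f` by one. -/
def kleinFactor (f : Φ) : CoreUnitary ι :=
  .ofIsometry ⟨weightedShift E ((Equiv.refl β).prodCongr (Equiv.addRight (Pi.single f 1)))
      fun q => kleinSign f q.2,
    weightedShift_mem_coreIsometries hE _ fun q => norm_kleinSign f q.2⟩

theorem kleinFactor_apply (f : Φ) (N : β) (ν : Φ → ℤ) : (kleinFactor hE f).onCore (E (N, ν)) =
    (kleinSign f ν : ℂ) • E (N, ν + Pi.single f 1) :=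
  weightedShift_apply ..

theorem kleinFactor_symm_apply (f : Φ) (N : β) (ν : Φ → ℤ) :
    (kleinFactor hE f).onCore.symm (E (N, ν)) =
      (kleinSign f ν : ℂ) • E (N, ν - Pi.single f 1) := by
  rw [LinearEquiv.symm_apply_eq, map_smul, kleinFactor_apply, kleinSign_sub_single,
    if_neg (lt_irrefl f), one_mul, smul_smul, ← Units.val_mul, kleinSign_mul_self, Units.val_one,
    one_smul, sub_add_cancel]

theorem commute_kleinFactor {T : Module.End ℂ (Core ι)} {τ : β → β} {z : β → ℂ}
    (hT : ∀ N ν, T (E (N, ν)) = z N • E (τ N, ν)) (f : Φ) :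
    Commute T (kleinFactor hE f).toEnd := by
  refine E.ext fun ⟨N, ν⟩ => ?_
  change T ((kleinFactor hE f).onCore (E (N, ν))) = (kleinFactor hE f).onCore (T (E (N, ν)))
  rw [hT, map_smul, kleinFactor_apply, kleinFactor_apply, map_smul, hT, smul_comm]

theorem raisesBy_kleinFactor {T : Module.End ℂ (Core ι)} {x : (Φ → ℤ) → ℂ} {z : ℂ} {f : Φ}
    (hT : ∀ N ν, T (E (N, ν)) = x ν • E (N, ν)) (hx : ∀ ν, x (ν + Pi.single f 1) = x ν + z) :
    RaisesBy T (kleinFactor hE f).onCore z := by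
  refine raisesBy_iff.2 (E.ext fun ⟨N, ν⟩ => ?_)
  change T ((kleinFactor hE f).onCore (E (N, ν))) - (kleinFactor hE f).onCore (T (E (N, ν))) =
    z • (kleinFactor hE f).onCore (E (N, ν))
  rw [hT, map_smul, kleinFactor_apply, map_smul, hT, hx]
  module

theorem kleinFactor_anticommute {f f' : Φ} (h : f ≠ f') (N : β) (ν : Φ → ℤ) :
    (kleinFactor hE f).onCore ((kleinFactor hE f').onCore.symm (E (N, ν))) =
      -(kleinFactor hE f').onCore.symm ((kleinFactor hE f).onCore (E (N, ν))) := by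
  have hsign : kleinSign f' ν * ((if f' < f then -1 else 1) * kleinSign f ν) =
      -(kleinSign f ν * ((if f < f' then -1 else 1) * kleinSign f' ν)) := by
    rcases lt_or_gt_of_ne h with hlt | hlt
    · rw [if_neg hlt.not_gt, if_pos hlt, one_mul, neg_one_mul, mul_neg, neg_neg, mul_comm]
    · rw [if_pos hlt, if_neg hlt.not_gt, one_mul, neg_one_mul, mul_neg, mul_comm]
  rw [kleinFactor_symm_apply, kleinFactor_apply, map_smul, map_smul, kleinFactor_apply,
    kleinFactor_symm_apply, smul_smul, smul_smul, ← Units.val_mul, ← Units.val_mul,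
    kleinSign_sub_single, kleinSign_add_single, hsign, Units.val_neg, neg_smul, sub_add_eq_add_sub]

theorem kleinFactor_anticommutator (f f' : Φ) :
    ((kleinFactor hE f).op : Space ι →L[ℂ] Space ι) *
        star ((kleinFactor hE f').op : Space ι →L[ℂ] Space ι) +
      star ((kleinFactor hE f').op : Space ι →L[ℂ] Space ι) * ((kleinFactor hE f).op : _ →L[ℂ] _) =
    if f = f' then 2 else 0 := by
  split_ifs with h
  · subst h
    rw [Unitary.mul_star_self_of_mem (kleinFactor hE f).op.2,
      Unitary.star_mul_self_of_mem (kleinFactor hE f).op.2, one_add_one_eq_two]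
  · refine continuousLinearMap_ext_core E fun q => ?_
    rw [add_apply, mul_apply_eq_comp, mul_apply_eq_comp, CoreUnitary.star_op_toSpace,
      CoreUnitary.op_toSpace, CoreUnitary.op_toSpace, CoreUnitary.star_op_toSpace,
      kleinFactor_anticommute hE h, map_neg, neg_add_cancel]
    rfl

end KleinFactor

end Fock

namespace Nodal

open Fock

/-! ### Momenta and lattice sites -/

/-- The integers `i` with `-M ≤ 2 i + c < M`. The values `c = 0` and `c = 1` label the integer and
half-integer momenta of a Brillouin zone. -/
def window (M : ℕ) (c : ℤ) : Finset ℤ := Finset.Ico (-((M + c) / 2)) (-((M + c) / 2) + M)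

theorem mem_window {M : ℕ} {c i : ℤ} : i ∈ window M c ↔ -M ≤ 2 * i + c ∧ 2 * i + c < M := by
  rw [window, Finset.mem_Ico]
  omega

theorem abs_sub_lt_of_mem_window {M : ℕ} {c i j : ℤ} (hi : i ∈ window M c) (hj : j ∈ window M c) :
    |i - j| < M := by
  rw [mem_window] at hi hj
  rw [abs_lt]
  omega

theorem exp_two_pi_div_ne_one {M : ℕ} {d : ℤ} (h : d ≠ 0) (hd : |d| < M) :
    Complex.exp (2 * Real.pi * Complex.I * (d / M)) ≠ 1 := by
  have hM : (M : ℂ) ≠ 0 := Nat.cast_ne_zero.2 (by have := abs_nonneg d; omega)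
  rw [Ne, Complex.exp_eq_one_iff]
  rintro ⟨n, hn⟩
  rw [mul_comm (n : ℂ), mul_right_inj' Complex.two_pi_I_ne_zero, div_eq_iff hM] at hn
  have hdvd : d = M * n := by rw [mul_comm]; exact_mod_cast hn
  exact h (Int.eq_zero_of_abs_lt_dvd ⟨n, hdvd⟩ hd)

theorem sum_exp_window {M : ℕ} (c : ℤ) {d : ℤ} (hd : |d| < M) :
    ∑ i ∈ window M c, Complex.exp (Complex.I * (2 * Real.pi * (i + c / 2) * d / M)) =
      if d = 0 then (M : ℂ) else 0 := by
  split_ifs with h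
  · subst h
    simp [window]
  set ζ := Complex.exp (2 * Real.pi * Complex.I * (d / M)) with hζ
  have hζ_pow : ζ ^ M = 1 := by
    have hM : (M : ℂ) ≠ 0 := Nat.cast_ne_zero.2 (by have := abs_nonneg d; omega)
    rw [hζ, ← Complex.exp_nat_mul, Complex.exp_eq_one_iff]
    exact ⟨d, by field_simp⟩
  have hgeom : ∑ k ∈ Finset.range M, ζ ^ k = 0 := by
    have := mul_geom_sum ζ M
    rw [hζ_pow, sub_self] at this
    exact (mul_eq_zero.1 this).resolve_left (sub_ne_zero.2 (exp_two_pi_div_ne_one h hd))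
  have hterm : ∀ k : ℕ, Complex.exp (Complex.I * (2 * Real.pi * (((-((M + c) / 2) + k : ℤ) : ℂ) +
      c / 2) * d / M)) = Complex.exp (Complex.I * (2 * Real.pi * (((-((M + c) / 2) : ℤ) : ℂ) +
      c / 2) * d / M)) * ζ ^ k := fun k => by
    rw [hζ, ← Complex.exp_nat_mul, ← Complex.exp_add]
    congr 1
    push_cast
    ring
  rw [window, Int.Ico_eq_finset_map, Finset.sum_map]
  simp only [Function.Embedding.trans_apply, Nat.castEmbedding_apply, addLeftEmbedding_apply, hterm]
  rw [← Finset.mul_sum, add_sub_cancel_left, Int.toNat_natCast, hgeom, mul_zero]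

section Momenta

variable {L a : ℝ} {M : ℕ}

theorem pi_div_eq (hL : 0 < L) (hM : L = M * a) : Real.pi / a = 2 * Real.pi / L * (M / 2) := by
  have : (M : ℝ) ≠ 0 := left_ne_zero_of_mul (hM ▸ hL.ne')
  rw [hM]
  field_simp

theorem momentum_mem_iff (hL : 0 < L) (hM : L = M * a) (i c : ℤ) :
    (-(Real.pi / a) ≤ 2 * Real.pi / L * (i + c / 2) ∧
      2 * Real.pi / L * (i + c / 2) < Real.pi / a) ↔ i ∈ window M c := by
  have hp : 0 < 2 * Real.pi / L := by positivity
  have hle : (-(M / 2 : ℝ) ≤ i + c / 2) ↔ (-(M : ℝ) ≤ 2 * i + c) := by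
    constructor <;> intro h <;> linarith
  have hlt : ((i : ℝ) + c / 2 < M / 2) ↔ (2 * i + c < (M : ℝ)) := by
    constructor <;> intro h <;> linarith
  rw [pi_div_eq hL hM, ← mul_neg, mul_le_mul_iff_right₀ hp, mul_lt_mul_iff_right₀ hp, mem_window,
    hle, hlt]
  norm_cast

theorem site_mem_iff (ha : 0 < a) (hM : L = M * a) (i : ℤ) :
    (-(L / 2) ≤ a * i ∧ a * i < L / 2) ↔ i ∈ window M 0 := by
  have hL : L / 2 = a * (M / 2) := by rw [hM]; ring
  rw [hL, ← mul_neg, mul_le_mul_iff_right₀ ha, mul_lt_mul_iff_right₀ ha, mem_window, add_zero,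
    neg_le_iff_add_nonneg, lt_div_iff₀' two_pos, ← neg_le_iff_add_nonneg, ← neg_div,
    div_le_iff₀' two_pos]
  norm_cast

/-- The sites `ã i` of the 1D lattice. -/
def latticeEquiv (ha : 0 < a) (hM : L = M * a) : window M 0 ≃ lattice L a :=
  Equiv.ofBijective (fun i => ⟨a * (i : ℤ), ⟨i, rfl⟩, (site_mem_iff ha hM i).2 i.2⟩)
    ⟨fun i j h => Subtype.ext <| by
      exact_mod_cast mul_left_cancel₀ ha.ne' (congrArg Subtype.val h),
    fun ⟨_, ⟨j, hj⟩, h⟩ => ⟨⟨j, (site_mem_iff ha hM j).1 (hj ▸ h)⟩, Subtype.ext hj.symm⟩⟩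

theorem latticeEquiv_apply (ha : 0 < a) (hM : L = M * a) (i : window M 0) :
    (latticeEquiv ha hM i : ℝ) = a * (i : ℤ) := rfl

/-- The zero mode momenta `2π i / L`. -/
def zeroModeEquiv (hL : 0 < L) (hM : L = M * a) : window M 0 ≃ zeroModeMomenta L a :=
  Equiv.ofBijective (fun i => ⟨2 * Real.pi / L * (i : ℤ), ⟨i, rfl⟩, by
    simpa using (momentum_mem_iff hL hM i 0).2 i.2⟩)
    ⟨fun i j h => Subtype.ext <| by
      have hp : 2 * Real.pi / L ≠ 0 := by positivity
      exact_mod_cast mul_left_cancel₀ hp (congrArg Subtype.val h),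
    fun ⟨_, ⟨j, hj⟩, h⟩ =>
      ⟨⟨j, (momentum_mem_iff hL hM j 0).1 (by simpa [hj] using h)⟩, Subtype.ext hj.symm⟩⟩

theorem zeroModeEquiv_apply (hL : 0 < L) (hM : L = M * a) (i : window M 0) :
    (zeroModeEquiv hL hM i : ℝ) = 2 * Real.pi / L * (i : ℤ) := rfl

theorem sum_exp_momentum (ha : 0 < a) (hM : L = M * a) (c : ℤ) (x y : lattice L a) :
    ∑ i ∈ window M c, Complex.exp (Complex.I * ((2 * Real.pi / L * (i + c / 2) : ℝ) : ℂ) *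
      ((x : ℝ) - (y : ℝ) : ℂ)) = open Classical in if x = y then (M : ℂ) else 0 := by
  classical
  obtain ⟨i, rfl⟩ := (latticeEquiv ha hM).surjective x
  obtain ⟨j, rfl⟩ := (latticeEquiv ha hM).surjective y
  have ha0 : (a : ℂ) ≠ 0 := Complex.ofReal_ne_zero.2 ha.ne'
  rw [if_congr (EmbeddingLike.apply_eq_iff_eq _) rfl rfl]
  refine Eq.trans (Finset.sum_congr rfl fun k _ => ?_) ((sum_exp_window c
    (abs_sub_lt_of_mem_window i.2 j.2)).trans (if_congr ?_ rfl rfl))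
  · congr 1
    rw [latticeEquiv_apply, latticeEquiv_apply, hM]
    push_cast
    field_simp
  · rw [sub_eq_zero, Subtype.ext_iff]

theorem sum_exp_zeroMode [Fintype (zeroModeMomenta L a)] (hL : 0 < L) (ha : 0 < a) (hM : L = M * a)
    (x y : lattice L a) : ∑ q : zeroModeMomenta L a, Complex.exp (Complex.I * ((q : ℝ) : ℂ) *
      ((x : ℝ) - (y : ℝ) : ℂ)) = open Classical in if x = y then (M : ℂ) else 0 := by
  rw [← sum_exp_momentum ha hM 0 x y, ← Finset.sum_coe_sort (window M 0),
    ← (zeroModeEquiv hL hM).sum_comp]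
  refine Finset.sum_congr rfl fun i _ => ?_
  rw [zeroModeEquiv_apply]
  simp

theorem sum_exp_lattice [Fintype (lattice L a)] (hL : 0 < L) (ha : 0 < a) (hM : L = M * a)
    (q q' : zeroModeMomenta L a) : ∑ x : lattice L a, Complex.exp (Complex.I *
      ((q : ℝ) - (q' : ℝ) : ℂ) * ((x : ℝ) : ℂ)) =
        open Classical in if q = q' then (M : ℂ) else 0 := by
  classical
  obtain ⟨i, rfl⟩ := (zeroModeEquiv hL hM).surjective q
  obtain ⟨j, rfl⟩ := (zeroModeEquiv hL hM).surjective q'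
  have ha0 : (a : ℂ) ≠ 0 := Complex.ofReal_ne_zero.2 ha.ne'
  have hsum := sum_exp_window 0 (abs_sub_lt_of_mem_window i.2 j.2)
  rw [← Finset.sum_coe_sort] at hsum
  rw [if_congr (EmbeddingLike.apply_eq_iff_eq _) rfl rfl, ← (latticeEquiv ha hM).sum_comp]
  refine Eq.trans (Finset.sum_congr rfl fun k _ => ?_) (hsum.trans (if_congr ?_ rfl rfl))
  · congr 1
    rw [latticeEquiv_apply, zeroModeEquiv_apply, zeroModeEquiv_apply, hM]
    push_cast
    field_simp
    ring
  · rw [sub_eq_zero, Subtype.ext_iff]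

end Momenta

section Levels

variable {L a : ℝ}

theorem units_cast_mul_self (r : ℤˣ) : ((r : ℤ) : ℝ) * ((r : ℤ) : ℝ) = 1 := by
  rcases Int.units_eq_one_or r with rfl | rfl <;> norm_num

theorem mem_fermiMomenta_iff (r : ℤˣ) {k : ℝ} :
    k ∈ fermiMomenta L ↔ ∃ j : ℤ, k = (r : ℤ) * (2 * Real.pi / L * (j + 1 / 2)) := by
  rcases Int.units_eq_one_or r with rfl | rfl
  · simp [fermiMomenta]
  · refine (Equiv.subLeft (-1 : ℤ)).exists_congr fun j => Eq.congr_right ?_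
    simp only [Equiv.subLeft_apply, Units.val_neg, Units.val_one]
    push_cast
    ring

/-- The modes, labelled by the flavor and the integer `j` with `r k = 2π / L (j + 1/2)`, so that
`j < 0` are the levels of the Dirac sea. -/
def levels (a : ℝ) (hL : 0 < L) : Flavor L a × ℤ ≃ Mode L a :=
  Equiv.ofBijective (fun x => ⟨x.1, _, (mem_fermiMomenta_iff x.1.r).2 ⟨x.2, rfl⟩⟩) (by
    have hp : 2 * Real.pi / L ≠ 0 := by positivity
    constructor
    · rintro ⟨f, j⟩ ⟨g, i⟩ h
      rw [Mode.mk.injEq, Subtype.mk.injEq] at h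
      obtain ⟨rfl, h⟩ := h
      have hr : ((f.r : ℤ) : ℝ) ≠ 0 := left_ne_zero_of_mul_eq_one (units_cast_mul_self f.r)
      have hji : (j : ℝ) = i := add_right_cancel (mul_left_cancel₀ hp (mul_left_cancel₀ hr h))
      rw [Int.cast_injective hji]
    · rintro ⟨f, k, hk⟩
      obtain ⟨j, rfl⟩ := (mem_fermiMomenta_iff f.r).1 hk
      exact ⟨(f, j), rfl⟩)

theorem levels_apply (hL : 0 < L) (f : Flavor L a) (j : ℤ) :
    levels a hL (f, j) = ⟨f, _, (mem_fermiMomenta_iff f.r).2 ⟨j, rfl⟩⟩ := rfl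

theorem zero_lt_levels_iff (hL : 0 < L) (f : Flavor L a) (j : ℤ) :
    0 < (((levels a hL (f, j)).flavor.r : ℤ) : ℝ) * (levels a hL (f, j)).k ↔ 0 ≤ j := by
  have hp : 0 < 2 * Real.pi / L := by positivity
  rw [levels_apply, ← mul_assoc, units_cast_mul_self, one_mul, mul_pos_iff_of_pos_left hp]
  constructor
  · intro h
    by_contra! hj
    have : (j : ℝ) ≤ -1 := by exact_mod_cast Int.le_sub_one_of_lt hj
    linarith
  · intro h
    positivity

theorem c_levels (hL : 0 < L) (f : Flavor L a) (j : ℤ) :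
    c (levels a hL (f, j)) = fermi (levels a hL) f j :=
  if_congr (zero_lt_levels_iff hL f j) rfl rfl

theorem cDag_levels (hL : 0 < L) (f : Flavor L a) (j : ℤ) :
    cDag (levels a hL (f, j)) = fermiDag (levels a hL) f j :=
  if_congr (zero_lt_levels_iff hL f j) rfl rfl

end Levels

/-! ### The 2D densities as Fourier transforms of 1D densities -/

section NodalMomenta

variable {L a : ℝ} {M : ℕ} {s : ℤˣ}

theorem forall_units_iff {p : ℤˣ → Prop} (s : ℤˣ) : (∀ t, p t) ↔ p s ∧ p (-s) := by
  refine ⟨fun h => ⟨h s, h (-s)⟩, fun h t => ?_⟩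
  rcases eq_or_ne t s with rfl | ht
  · exact h.1
  · exact Int.units_ne_iff_eq_neg.1 ht ▸ h.2

/-- The 2D momentum with `r k_s = 2π / L (j + 1/2)` and `k_{-s} = 2π / L (i + 1/2)`. -/
def nodalMomentum (L : ℝ) (r s : ℤˣ) (j i : ℤ) : ℤˣ → ℝ := fun t =>
  if t = s then ((r : ℤ) : ℝ) * (2 * Real.pi / L * (j + 1 / 2)) else 2 * Real.pi / L * (i + 1 / 2)

theorem nodalMomentum_self (L : ℝ) (r s : ℤˣ) (j i : ℤ) :
    nodalMomentum L r s j i s = ((r : ℤ) : ℝ) * (2 * Real.pi / L * (j + 1 / 2)) := if_pos rfl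

theorem nodalMomentum_neg (L : ℝ) (r s : ℤˣ) (j i : ℤ) :
    nodalMomentum L r s j i (-s) = 2 * Real.pi / L * (i + 1 / 2) :=
  if_neg (units_ne_neg_self s).symm

theorem nodalMomentum_mem_iff (hL : 0 < L) (hM : L = M * a) (r s : ℤˣ) (j i : ℤ) :
    nodalMomentum L r s j i ∈ nodalMomenta L a s ↔ i ∈ window M 1 := by
  have h := momentum_mem_iff hL hM i 1
  rw [Int.cast_one] at h
  rw [nodalMomenta, Set.mem_ofPred_eq, nodalMomentum_neg, h, forall_units_iff s, nodalMomentum_self,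
    nodalMomentum_neg]
  exact and_iff_right ⟨(mem_fermiMomenta_iff r).2 ⟨j, rfl⟩, i, rfl⟩

theorem nodalMomentum_injective (hL : 0 < L) (r s : ℤˣ) :
    Function.Injective2 (nodalMomentum L r s) := by
  intro j j' i i' h
  have hp : 2 * Real.pi / L ≠ 0 := by positivity
  have hr : ((r : ℤ) : ℝ) ≠ 0 := left_ne_zero_of_mul_eq_one (units_cast_mul_self r)
  have hself := congrFun h s
  have hneg := congrFun h (-s)
  rw [nodalMomentum_self, nodalMomentum_self] at hself
  rw [nodalMomentum_neg, nodalMomentum_neg] at hneg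
  exact ⟨Int.cast_injective
      (add_right_cancel (mul_left_cancel₀ hp (mul_left_cancel₀ hr hself))),
    Int.cast_injective (add_right_cancel (mul_left_cancel₀ hp hneg))⟩

theorem exists_eq_nodalMomentum (r : ℤˣ) (k : nodalMomenta L a s) :
    ∃ j i, k.1 = nodalMomentum L r s j i := by
  obtain ⟨j, hj⟩ := (mem_fermiMomenta_iff r).1 (k.2.1 s)
  obtain ⟨i, hi⟩ := k.2.1 (-s)
  refine ⟨j, i, funext ((forall_units_iff s).2 ?_)⟩
  rw [nodalMomentum_self, nodalMomentum_neg]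
  exact ⟨hj, hi⟩

/-- The labelling of the nodal momenta by pairs of integers. -/
def nodalEquiv (hL : 0 < L) (hM : L = M * a) (r s : ℤˣ) :
    ℤ × window M 1 ≃ nodalMomenta L a s :=
  Equiv.ofBijective (fun x => ⟨nodalMomentum L r s x.1 x.2,
    (nodalMomentum_mem_iff hL hM r s _ _).2 x.2.2⟩) (by
    constructor
    · intro x y h
      obtain ⟨hj, hi⟩ := nodalMomentum_injective hL r s (congrArg Subtype.val h)
      exact Prod.ext hj (Subtype.ext hi)
    · intro k
      obtain ⟨j, i, h⟩ := exists_eq_nodalMomentum r k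
      exact ⟨(j, ⟨i, (nodalMomentum_mem_iff hL hM r s j i).1 (h ▸ k.2)⟩), Subtype.ext h.symm⟩)

theorem add_sub_single_mem_nodalMomenta (hL : 0 < L) (hM : L = M * a) {p : ℤˣ → ℝ}
    (hp : ∀ t, ∃ j : ℤ, p t = 2 * Real.pi / L * j) (k : nodalMomenta L a s) {n : ℤ}
    (hn : k.1 (-s) + p (-s) - 2 * Real.pi * n / a ∈
      Set.Ico (-(Real.pi / a)) (Real.pi / a)) :
    k.1 + p - Pi.single (-s) (2 * Real.pi * n / a) ∈ nodalMomenta L a s := by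
  have hshift : 2 * Real.pi * n / a = 2 * Real.pi / L * (M * n : ℤ) := by
    rw [show 2 * Real.pi * n / a = 2 * (Real.pi / a) * n by ring, pi_div_eq hL hM]
    push_cast
    ring
  refine ⟨(forall_units_iff s).2 ⟨?_, ?_⟩, by simpa using hn⟩
  · obtain ⟨j, hj⟩ := k.2.1 s
    obtain ⟨i, hi⟩ := hp s
    refine ⟨j + i, ?_⟩
    simp only [Pi.sub_apply, Pi.add_apply, Pi.single_eq_of_ne (units_ne_neg_self s), hj, hi]
    push_cast
    ring
  · obtain ⟨j, hj⟩ := k.2.1 (-s)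
    obtain ⟨i, hi⟩ := hp (-s)
    refine ⟨j + i - M * n, ?_⟩
    simp only [Pi.sub_apply, Pi.add_apply, Pi.single_eq_same, hj, hi, hshift]
    push_cast
    ring

/-- The umklapp index `n` folds the transferred momentum back into the Brillouin zone, so it is
determined by `k₁`. -/
theorem transfer_fst_bijective (hL : 0 < L) (ha : 0 < a) (hM : L = M * a) {p : ℤˣ → ℝ}
    (hp : ∀ t, ∃ j : ℤ, p t = 2 * Real.pi / L * j) :
    Function.Bijective fun t : transfer L a s p => t.1.1 := by
  refine (Function.bijective_iff_existsUnique _).2 fun k => ?_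
  obtain ⟨n, hn, hn_unique⟩ := existsUnique_sub_zsmul_mem_Ico (by positivity : 0 < 2 * Real.pi / a)
    (k.1 (-s) + p (-s)) (-(Real.pi / a))
  have hzone : -(Real.pi / a) + 2 * Real.pi / a = Real.pi / a := by ring
  have hzsmul : ∀ n : ℤ, n • (2 * Real.pi / a) = 2 * Real.pi * n / a := fun n => by
    rw [zsmul_eq_mul]; ring
  simp only [hzone, hzsmul] at hn hn_unique
  refine ⟨⟨⟨k, ⟨_, add_sub_single_mem_nodalMomenta hL hM hp k hn⟩, n⟩, (sub_add_cancel _ _).symm⟩,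
    rfl, ?_⟩
  rintro ⟨⟨k, k', n'⟩, h⟩ rfl
  have hk' : k.1 + p - Pi.single (-s) (2 * Real.pi * n' / a) = k'.1 := sub_eq_of_eq_add h
  obtain rfl : n' = n := hn_unique n' (by
    have := k'.2.2
    rw [← hk'] at this
    simpa using this)
  simp only [hk']

end NodalMomenta

section Density

variable {L a : ℝ} {M : ℕ} {s : ℤˣ} {p : ℤˣ → ℝ}

theorem half_σ (α β γ : ℤˣ) :
    1 / 2 * (σ₀ β γ + ((α : ℤ) : ℂ) * σ₃ β γ) = if β = α then if γ = α then 1 else 0 else 0 := by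
  rcases Int.units_eq_one_or α with rfl | rfl <;> rcases Int.units_eq_one_or β with rfl | rfl <;>
    rcases Int.units_eq_one_or γ with rfl | rfl <;> norm_num [σ₀, σ₃, neg_units_ne_self]

/-- The term `(2π/L)² :ψ_{r,s,α}(k₁)† ψ_{r,s,α}(k₂):` of the density `J_{r,s,α}(p)`. -/
def densityTerm (r α : ℤˣ) (t : transfer L a s p) : Op L a :=
  (((2 * Real.pi / L) ^ 2 : ℝ) : ℂ) • normalOrder (ψDag r s α t.1.1 * ψ r s α t.1.2.1)

theorem densityTerm_eq_bilinear (r α : ℤˣ) (t : transfer L a s p) :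
    densityTerm r α t = (1 / 2 : ℂ) • (bilinear σ₀ r s t.1.1 t.1.2.1 +
      ((α : ℤ) : ℂ) • bilinear σ₃ r s t.1.1 t.1.2.1) := by
  have hterm : ∀ β γ : ℤˣ, ∀ (w : ℂ) (X : Op L a), (1 / 2 : ℂ) • ((w * σ₀ β γ) • X +
      ((α : ℤ) : ℂ) • (w * σ₃ β γ) • X) = if β = α then if γ = α then w • X else 0 else 0 :=
    fun β γ w X => by
      rw [smul_smul, ← add_smul, smul_smul,
        show 1 / 2 * (w * σ₀ β γ + ((α : ℤ) : ℂ) * (w * σ₃ β γ)) =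
          w * (1 / 2 * (σ₀ β γ + ((α : ℤ) : ℂ) * σ₃ β γ)) by ring, half_σ]
      split_ifs <;> simp
  simp only [bilinear, Finset.smul_sum, ← Finset.sum_add_distrib, hterm, densityTerm,
    Finset.sum_ite_irrel, Finset.sum_ite_eq', Finset.mem_univ, if_true, Finset.sum_const_zero]

theorem locFinite_bilinear (hL : 0 < L) (ha : 0 < a) (σ : ℤˣ → ℤˣ → ℂ) (r s : ℤˣ) (p : ℤˣ → ℝ) :
    LocFinite fun t : transfer L a s p => bilinear σ r s t.1.1 t.1.2.1 :=
  locFinite_of_ket fun S => (finite_support_J hL ha σ r s p S).1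

theorem J_eq_opSum (hL : 0 < L) (ha : 0 < a) (σ : ℤˣ → ℤˣ → ℂ) (r s : ℤˣ) (p : ℤˣ → ℝ) :
    J σ r s p = opSum fun t : transfer L a s p => bilinear σ r s t.1.1 t.1.2.1 :=
  ext_ket fun S => by
    rw [opSum_apply (locFinite_bilinear hL ha σ r s p)]
    simp [J, ket]

theorem locFinite_densityTerm (hL : 0 < L) (ha : 0 < a) (r α : ℤˣ) :
    LocFinite fun t : transfer L a s p => densityTerm r α t := fun v => by
  simp only [densityTerm_eq_bilinear, LinearMap.smul_apply, LinearMap.add_apply]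
  exact ((locFinite_bilinear hL ha σ₀ r s p v).fun_add
    ((locFinite_bilinear hL ha σ₃ r s p v).fun_smul_right _)).fun_smul_right _

theorem density_eq_opSum (hL : 0 < L) (ha : 0 < a) (r s α : ℤˣ) (p : ℤˣ → ℝ) :
    density r s α p = opSum fun t : transfer L a s p => densityTerm r α t := by
  have h₀ := locFinite_bilinear hL ha σ₀ r s p
  have h₃ := locFinite_bilinear hL ha σ₃ r s p
  refine LinearMap.ext fun v => ?_
  rw [density, J_eq_opSum hL ha, J_eq_opSum hL ha, opSum_apply (locFinite_densityTerm hL ha r α)]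
  simp only [densityTerm_eq_bilinear, LinearMap.smul_apply, LinearMap.add_apply, opSum_apply h₀,
    opSum_apply h₃]
  rw [smul_finsum, ← finsum_add_distrib (h₀ v) ((h₃ v).fun_smul_right _), smul_finsum]

theorem exp_transfer (ha : 0 < a) (t : transfer L a s p) (y : lattice L a) :
    Complex.exp (-(Complex.I * (t.1.2.1.1 (-s) : ℂ) * (y : ℂ))) =
      Complex.exp (-(Complex.I * (t.1.1.1 (-s) : ℂ) * (y : ℂ))) *
        Complex.exp (-(Complex.I * (p (-s) : ℂ) * (y : ℂ))) := by
  obtain ⟨⟨k, k', n⟩, h⟩ := t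
  obtain ⟨j, hj⟩ := y.2.1
  have hreal : k.1 (-s) + p (-s) = k'.1 (-s) + 2 * Real.pi * n / a := by
    simpa using congrFun h (-s)
  have hk' : (k'.1 (-s) : ℂ) = k.1 (-s) + p (-s) - 2 * Real.pi * n / a := by
    rw [eq_sub_iff_add_eq]
    exact_mod_cast hreal.symm
  have ha0 : (a : ℂ) ≠ 0 := Complex.ofReal_ne_zero.2 ha.ne'
  rw [← Complex.exp_add, Complex.exp_eq_exp_iff_exists_int]
  refine ⟨n * j, ?_⟩
  simp only [hk', hj]
  push_cast
  field_simp
  ring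

theorem sq_ψ_normalization (hL : 0 < L) (ha : 0 < a) (hM : L = M * a) :
    (((2 * Real.pi / L) ^ 2 : ℝ) : ℂ) * (((L / (2 * Real.pi) * √(a / L) : ℝ) : ℂ) *
      ((L / (2 * Real.pi) * √(a / L) : ℝ) : ℂ)) = 1 / M := by
  have hM0 : (M : ℝ) ≠ 0 := left_ne_zero_of_mul (hM ▸ hL.ne')
  have h : (2 * Real.pi / L) ^ 2 * (L / (2 * Real.pi) * √(a / L) * (L / (2 * Real.pi) * √(a / L))) =
      1 / M := by
    rw [← sq, mul_pow (L / (2 * Real.pi)), Real.sq_sqrt (by positivity)]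
    field_simp
    rw [hM, mul_comm]
  rw [← Complex.ofReal_mul, ← Complex.ofReal_mul, h]
  push_cast
  rfl

/-- The momentum transfers, labelled by the momentum `k₁`. -/
def transferEquiv (hL : 0 < L) (ha : 0 < a) (hM : L = M * a) (r : ℤˣ)
    (hp : ∀ t, ∃ j : ℤ, p t = 2 * Real.pi / L * j) : ℤ × window M 1 ≃ transfer L a s p :=
  (nodalEquiv hL hM r s).trans (Equiv.ofBijective _ (transfer_fst_bijective hL ha hM hp)).symm

theorem transferEquiv_fst (hL : 0 < L) (ha : 0 < a) (hM : L = M * a) (r : ℤˣ)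
    (hp : ∀ t, ∃ j : ℤ, p t = 2 * Real.pi / L * j) (x : ℤ × window M 1) :
    (transferEquiv (s := s) hL ha hM r hp x).1.1.1 = nodalMomentum L r s x.1 x.2 :=
  congrArg Subtype.val
    ((Equiv.ofBijective _ (transfer_fst_bijective hL ha hM hp)).apply_symm_apply _)

variable [Fintype (lattice L a)]

theorem ψ_eq (hL : 0 < L) (r s α : ℤˣ) (k : nodalMomenta L a s) {j : ℤ}
    (hk : k.1 s = ((r : ℤ) : ℝ) * (2 * Real.pi / L * (j + 1 / 2))) :
    ψ r s α k = ((L / (2 * Real.pi) * √(a / L) : ℝ) : ℂ) • ∑ x : lattice L a,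
      Complex.exp (-(Complex.I * (k.1 (-s) : ℂ) * (x : ℂ))) •
        fermi (levels a hL) ⟨r, s, α, x⟩ j := by
  simp only [ψ, finsum_eq_sum_of_fintype, ← c_levels, levels_apply, hk]

theorem ψDag_eq (hL : 0 < L) (r s α : ℤˣ) (k : nodalMomenta L a s) {j : ℤ}
    (hk : k.1 s = ((r : ℤ) : ℝ) * (2 * Real.pi / L * (j + 1 / 2))) :
    ψDag r s α k = ((L / (2 * Real.pi) * √(a / L) : ℝ) : ℂ) • ∑ x : lattice L a,
      Complex.exp (Complex.I * (k.1 (-s) : ℂ) * (x : ℂ)) •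
        fermiDag (levels a hL) ⟨r, s, α, x⟩ j := by
  simp only [ψDag, finsum_eq_sum_of_fintype, ← cDag_levels, levels_apply, hk]

theorem densityTerm_eq (hL : 0 < L) (ha : 0 < a) (hM : L = M * a) (r α : ℤˣ) {j n : ℤ}
    (hn : p s = ((r : ℤ) : ℝ) * (2 * Real.pi / L * n)) (t : transfer L a s p)
    (ht : t.1.1.1 s = ((r : ℤ) : ℝ) * (2 * Real.pi / L * (j + 1 / 2))) :
    densityTerm r α t = ∑ x : lattice L a, ∑ y : lattice L a,
      (Complex.exp (Complex.I * (t.1.1.1 (-s) : ℂ) * (x - y : ℂ)) *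
        (1 / M * Complex.exp (-(Complex.I * (p (-s) : ℂ) * (y : ℂ))))) •
      normalOrder (fermiDag (levels a hL) ⟨r, s, α, x⟩ j *
        fermi (levels a hL) ⟨r, s, α, y⟩ (j + n)) := by
  have ht' : t.1.2.1.1 s = ((r : ℤ) : ℝ) * (2 * Real.pi / L * ((j + n : ℤ) + 1 / 2)) := by
    have := transfer_s t
    push_cast
    linarith
  rw [densityTerm, ψDag_eq hL r s α _ ht, ψ_eq hL r s α _ ht', smul_mul_smul_comm,
    normalOrder_smul, smul_smul, sq_ψ_normalization hL ha hM, Finset.sum_mul_sum, normalOrder_sum,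
    Finset.smul_sum]
  refine Finset.sum_congr rfl fun x _ => ?_
  rw [normalOrder_sum, Finset.smul_sum]
  refine Finset.sum_congr rfl fun y _ => ?_
  rw [smul_mul_smul_comm, normalOrder_smul, smul_smul, exp_transfer ha,
    show Complex.I * (t.1.1.1 (-s) : ℂ) * (x - y : ℂ) = Complex.I * (t.1.1.1 (-s) : ℂ) * (x : ℂ) +
      -(Complex.I * (t.1.1.1 (-s) : ℂ) * (y : ℂ)) by ring, Complex.exp_add]
  congr 1
  ring

theorem sum_window_densityTerm (hL : 0 < L) (ha : 0 < a) (hM : L = M * a) (r α : ℤˣ) {n : ℤ}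
    (hp : ∀ t, ∃ j : ℤ, p t = 2 * Real.pi / L * j)
    (hn : p s = ((r : ℤ) : ℝ) * (2 * Real.pi / L * n)) (j : ℤ) :
    ∑ i, densityTerm r α (transferEquiv (s := s) hL ha hM r hp (j, i)) =
      ∑ x : lattice L a, Complex.exp (-(Complex.I * (p (-s) : ℂ) * (x : ℂ))) •
        hop (levels a hL) ⟨r, s, α, x⟩ n j := by
  classical
  have hM0 : (M : ℂ) ≠ 0 := by exact_mod_cast left_ne_zero_of_mul (hM ▸ hL.ne')
  have hself : ∀ i, (transferEquiv (s := s) hL ha hM r hp (j, i)).1.1.1 s =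
      ((r : ℤ) : ℝ) * (2 * Real.pi / L * (j + 1 / 2)) := fun i => by
    rw [transferEquiv_fst, nodalMomentum_self]
  have horth : ∀ x y : lattice L a, ∑ i : window M 1, Complex.exp (Complex.I *
      ((transferEquiv (s := s) hL ha hM r hp (j, i)).1.1.1 (-s) : ℂ) * (x - y : ℂ)) =
      if x = y then (M : ℂ) else 0 := fun x y => by
    rw [← sum_exp_momentum ha hM 1 x y, ← Finset.sum_coe_sort (window M 1)]
    simp only [transferEquiv_fst, nodalMomentum_neg, Int.cast_one]
  simp only [densityTerm_eq hL ha hM r α hn _ (hself _)]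
  rw [Finset.sum_comm]
  refine Finset.sum_congr rfl fun x _ => ?_
  rw [Finset.sum_comm, Finset.sum_eq_single x]
  · rw [← Finset.sum_smul, ← Finset.sum_mul, horth, if_pos rfl, ← mul_assoc, mul_one_div_cancel hM0,
      one_mul, hop]
  · intro y _ hy
    rw [← Finset.sum_smul, ← Finset.sum_mul, horth, if_neg hy.symm, zero_mul, zero_smul]
  · simp

theorem density_eq_sum_rho (hL : 0 < L) (ha : 0 < a) (hM : L = M * a) (r s α : ℤˣ) {n : ℤ}
    (hp : ∀ t, ∃ j : ℤ, p t = 2 * Real.pi / L * j)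
    (hn : p s = ((r : ℤ) : ℝ) * (2 * Real.pi / L * n)) :
    density r s α p = ∑ x : lattice L a, Complex.exp (-(Complex.I * (p (-s) : ℂ) * (x : ℂ))) •
      rho (levels a hL) ⟨r, s, α, x⟩ n := by
  have hfin := locFinite_densityTerm (s := s) (p := p) hL ha r α
  rw [density_eq_opSum hL ha, ← opSum_comp_equiv (transferEquiv hL ha hM r hp) hfin,
    opSum_prod (hfin.comp_injective (transferEquiv hL ha hM r hp).injective)]
  simp only [sum_window_densityTerm hL ha hM r α hp hn]
  exact opSum_sum_smul (fun x => locFinite_hop _ _ n) _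

end Density

/-! ### The boson operators -/

section DensityMomentum

variable {L a : ℝ} {M : ℕ}

/-- The 2D momentum `p` with `p_s = 2π r n / L` and `p_{-s} = q`. -/
def densityMomentum (L : ℝ) (r s : ℤˣ) (n : ℤ) (q : ℝ) : ℤˣ → ℝ := fun t =>
  if t = s then ((r : ℤ) : ℝ) * (2 * Real.pi / L * n) else q

theorem densityMomentum_self (L : ℝ) (r s : ℤˣ) (n : ℤ) (q : ℝ) :
    densityMomentum L r s n q s = ((r : ℤ) : ℝ) * (2 * Real.pi / L * n) := if_pos rfl

theorem densityMomentum_neg (L : ℝ) (r s : ℤˣ) (n : ℤ) (q : ℝ) :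
    densityMomentum L r s n q (-s) = q := if_neg (units_ne_neg_self s).symm

theorem exists_densityMomentum_eq (r s : ℤˣ) (n : ℤ) (q : zeroModeMomenta L a) :
    ∀ t, ∃ j : ℤ, densityMomentum L r s n q t = 2 * Real.pi / L * j := by
  refine (forall_units_iff s).2 ⟨⟨r * n, ?_⟩, ?_⟩
  · rw [densityMomentum_self]
    push_cast
    ring
  · rw [densityMomentum_neg]
    exact q.2.1

theorem densityMomentum_zero (r s : ℤˣ) (q : ℝ) :
    densityMomentum L r s 0 q = Pi.single (-s) q := by
  refine funext ((forall_units_iff s).2 ⟨?_, ?_⟩)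
  · rw [densityMomentum_self, Pi.single_eq_of_ne (units_ne_neg_self s)]
    simp
  · rw [densityMomentum_neg, Pi.single_eq_same]

theorem rho_eq_sum_density [Fintype (zeroModeMomenta L a)] (hL : 0 < L) (ha : 0 < a)
    (hM : L = M * a) (f : Flavor L a) (n : ℤ) : rho (levels a hL) f n =
      ∑ q : zeroModeMomenta L a, (1 / M * Complex.exp (Complex.I * (q : ℂ) * (f.x : ℂ))) •
        density f.r f.s f.α (densityMomentum L f.r f.s n q) := by
  classical
  have := finite_lattice (L := L) ha
  have := Fintype.ofFinite (lattice L a)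
  have hM0 : (M : ℂ) ≠ 0 := by exact_mod_cast left_ne_zero_of_mul (hM ▸ hL.ne')
  have hexp : ∀ (y : lattice L a) (q : zeroModeMomenta L a),
      1 / M * Complex.exp (Complex.I * (q : ℂ) * (f.x : ℂ)) *
        Complex.exp (-(Complex.I * (q : ℂ) * (y : ℂ))) =
      1 / M * Complex.exp (Complex.I * (q : ℂ) * (f.x - y : ℂ)) := fun y q => by
    rw [mul_assoc, ← Complex.exp_add, ← sub_eq_add_neg, mul_sub]
  simp only [density_eq_sum_rho hL ha hM f.r f.s f.α (exists_densityMomentum_eq f.r f.s n _)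
    (densityMomentum_self L f.r f.s n _), densityMomentum_neg, Finset.smul_sum, smul_smul, hexp]
  rw [Finset.sum_comm]
  simp only [← Finset.sum_smul, ← Finset.mul_sum, sum_exp_zeroMode hL ha hM, mul_ite, mul_zero,
    one_div_mul_cancel hM0, ite_smul, one_smul, zero_smul, Finset.sum_ite_eq, Finset.mem_univ,
    if_true]

theorem zeroMode_eq_rho (hL : 0 < L) (ha : 0 < a) (hM : L = M * a) (f : Flavor L a) :
    zeroMode f = rho (levels a hL) f 0 := by
  have := Fintype.ofEquiv _ (zeroModeEquiv hL hM)
  have hsqrt : √(2 * Real.pi * a) * √(a / (2 * Real.pi)) = a := by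
    rw [← Real.sqrt_mul (by positivity), show 2 * Real.pi * a * (a / (2 * Real.pi)) = a * a by
      field_simp, Real.sqrt_mul_self ha.le]
  have hscalar : ((√(2 * Real.pi * a) : ℝ) : ℂ) * ((√(a / (2 * Real.pi)) : ℝ) : ℂ) * (1 / L) =
      1 / M := by
    have ha0 : (a : ℂ) ≠ 0 := Complex.ofReal_ne_zero.2 ha.ne'
    rw [← Complex.ofReal_mul, hsqrt, hM]
    push_cast
    field_simp
  rw [rho_eq_sum_density hL ha hM, zeroMode, finsum_eq_sum_of_fintype, Finset.smul_sum]
  refine Finset.sum_congr rfl fun q _ => ?_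
  rw [zeroModeHat, smul_smul, smul_smul, densityMomentum_zero, ← hscalar]
  congr 1
  ring

end DensityMomentum

theorem norm_units_cast (r : ℤˣ) : ‖((r : ℤ) : ℂ)‖ = 1 := by
  rcases Int.units_eq_one_or r with rfl | rfl <;> simp

namespace BosonMode

variable {L a : ℝ} {M : ℕ}

/-- The chirality of the densities that make up `b m`. -/
def chirality (m : BosonMode L a) : ℤˣ := if 0 < m.ps then 1 else -1

/-- The positive integer `n` with `|p_s| = 2π n / L`. -/
def index (m : BosonMode L a) : ℤ := |(m.p.2.1 m.s).choose|

theorem ps_eq (hL : 0 < L) (m : BosonMode L a) :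
    m.ps = ((m.chirality : ℤ) : ℝ) * (2 * Real.pi / L * m.index) := by
  have hp : 0 < 2 * Real.pi / L := by positivity
  have h : m.ps = _ := (m.p.2.1 m.s).choose_spec
  unfold chirality index
  generalize (m.p.2.1 m.s).choose = j at h
  split_ifs with h0 <;> rw [h, mul_pos_iff_of_pos_left hp] at h0
  · rw [h, abs_of_pos (by exact_mod_cast h0)]
    simp
  · rw [h, abs_of_nonpos (by exact_mod_cast not_lt.1 h0)]
    simp

theorem index_pos (m : BosonMode L a) : 0 < m.index := by
  have h : m.ps = _ := (m.p.2.1 m.s).choose_spec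
  refine abs_pos.2 fun hj => m.p.2.2.2 (h.trans ?_)
  rw [hj, Int.cast_zero, mul_zero]

theorem abs_ps (hL : 0 < L) (m : BosonMode L a) : |m.ps| = 2 * Real.pi / L * m.index := by
  have hn : (0 : ℝ) < m.index := by exact_mod_cast m.index_pos
  rw [m.ps_eq hL, abs_mul, ← Int.cast_abs, Int.abs_eq_natAbs, Int.units_natAbs, Nat.cast_one,
    Int.cast_one, one_mul, abs_of_pos (by positivity)]

theorem eq_of_chirality_eq_of_index_eq (hL : 0 < L) {m m' : BosonMode L a}
    (hchirality : m.chirality = m'.chirality) (hs : m.s = m'.s) (hα : m.α = m'.α)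
    (hindex : m.index = m'.index) (hp : m.p.1 (-m.s) = m'.p.1 (-m'.s)) : m = m' := by
  have hps : m.ps = m'.ps := by rw [m.ps_eq hL, m'.ps_eq hL, hchirality, hindex]
  obtain ⟨s, α, p⟩ := m
  obtain ⟨s', α', p'⟩ := m'
  dsimp only at hs hα hp
  subst hs hα
  congr 1
  exact Subtype.ext (funext ((forall_units_iff s).2 ⟨hps, hp⟩))

/-- The ratio of `b m` to the density it is proportional to. -/
def prefactor (m : BosonMode L a) : ℂ :=
  -((m.chirality : ℤ) : ℂ) * (Complex.I / L) * (√(2 * Real.pi * a / |m.ps|) : ℝ)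

theorem sq_norm_prefactor (hL : 0 < L) (ha : 0 < a) (hM : L = M * a) (m : BosonMode L a) :
    ‖m.prefactor‖ ^ 2 = 1 / (M * m.index) := by
  have hn : (0 : ℝ) < m.index := by exact_mod_cast m.index_pos
  have hM0 : (M : ℝ) ≠ 0 := left_ne_zero_of_mul (hM ▸ hL.ne')
  rw [prefactor, norm_mul, norm_mul, norm_neg, norm_units_cast, norm_div, Complex.norm_I,
    Complex.norm_real, Complex.norm_real, mul_pow, Real.norm_eq_abs √_, sq_abs,
    Real.sq_sqrt (by positivity), Real.norm_eq_abs L, abs_of_pos hL, m.abs_ps hL]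
  field_simp
  rw [hM, mul_comm]

theorem prefactor_ne_zero (hL : 0 < L) (ha : 0 < a) (m : BosonMode L a) : m.prefactor ≠ 0 := by
  have hr : ((m.chirality : ℤ) : ℂ) ≠ 0 := norm_ne_zero_iff.1 (by simp)
  have hps : 0 < |m.ps| := abs_pos.2 m.p.2.2.2
  have hsqrt : √(2 * Real.pi * a / |m.ps|) ≠ 0 := by positivity
  exact mul_ne_zero (mul_ne_zero (neg_ne_zero.2 hr)
    (div_ne_zero Complex.I_ne_zero (Complex.ofReal_ne_zero.2 hL.ne')))
    (Complex.ofReal_ne_zero.2 hsqrt)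

theorem b_eq_smul_density (m : BosonMode L a) :
    b m = m.prefactor • density m.chirality m.s m.α m.p := by
  unfold b prefactor chirality
  split_ifs <;> simp

/-- The component `p_{-s}` as a 1D momentum. -/
def transverse (m : BosonMode L a) : zeroModeMomenta L a := ⟨m.p.1 (-m.s), m.p.2.1 _, m.p.2.2.1⟩

/-- The coefficients of `b m` in terms of the 1D densities. -/
def coeff (m : BosonMode L a) (x : lattice L a) : ℂ :=
  m.prefactor * Complex.exp (-(Complex.I * (m.transverse : ℂ) * (x : ℂ)))

/-- The flavors of the 1D densities that make up `b m`. -/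
def flavor (m : BosonMode L a) (x : lattice L a) : Flavor L a := ⟨m.chirality, m.s, m.α, x⟩

theorem b_eq_sum_rho [Fintype (lattice L a)] (hL : 0 < L) (ha : 0 < a) (hM : L = M * a)
    (m : BosonMode L a) :
    b m = ∑ x : lattice L a, m.coeff x • rho (levels a hL) (m.flavor x) m.index := by
  rw [b_eq_smul_density, density_eq_sum_rho hL ha hM m.chirality m.s m.α m.p.2.1 (m.ps_eq hL),
    Finset.smul_sum]
  simp only [smul_smul, coeff, flavor, transverse]

theorem bDag_eq_sum_rho [Fintype (lattice L a)] (hL : 0 < L) (ha : 0 < a) (hM : L = M * a)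
    (m : BosonMode L a) : bDag m =
      ∑ x : lattice L a, starRingEnd ℂ (m.coeff x) • rho (levels a hL) (m.flavor x) (-m.index) := by
  have h := isAdj_b hL ha m
  rw [b_eq_sum_rho hL ha hM m] at h
  exact h.unique (IsAdj.sum _ _ _ fun x => (isAdj_rho _ _ _).smul _)

theorem sum_coeff_mul_conj [Fintype (lattice L a)] (hL : 0 < L) (ha : 0 < a) (hM : L = M * a)
    {m m' : BosonMode L a} (h : m.prefactor = m'.prefactor) :
    ∑ x, m.coeff x * starRingEnd ℂ (m'.coeff x) =
      open Classical in if m'.transverse = m.transverse then 1 / (m.index : ℂ) else 0 := by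
  have hM0 : (M : ℂ) ≠ 0 := by exact_mod_cast left_ne_zero_of_mul (hM ▸ hL.ne')
  have hn : (m.index : ℂ) ≠ 0 := by exact_mod_cast m.index_pos.ne'
  have hterm : ∀ x, m.coeff x * starRingEnd ℂ (m'.coeff x) = 1 / (M * m.index) *
      Complex.exp (Complex.I * (m'.transverse - m.transverse : ℂ) * (x : ℂ)) := fun x => by
    rw [coeff, coeff, ← h, map_mul (starRingEnd ℂ) _ (Complex.exp _), ← Complex.exp_conj,
      mul_mul_mul_comm, ← Complex.exp_add, Complex.mul_conj', ← Complex.ofReal_pow,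
      sq_norm_prefactor hL ha hM]
    simp only [map_neg, map_mul, Complex.conj_I, Complex.conj_ofReal]
    push_cast
    congr 2
    ring
  simp only [hterm, ← Finset.mul_sum, sum_exp_lattice hL ha hM]
  split_ifs
  · field_simp
  · exact mul_zero _

end BosonMode

section Commutators

variable {L a : ℝ} {M : ℕ}

theorem commute_b_b (hL : 0 < L) (ha : 0 < a) (hM : L = M * a) (m m' : BosonMode L a) :
    Commute (b m) (b m') := by
  classical
  have := finite_lattice (L := L) ha
  have := Fintype.ofFinite (lattice L a)
  have hindex : m.index + m'.index ≠ 0 := (add_pos m.index_pos m'.index_pos).ne'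
  refine commute_of_lie_eq_zero (A := Op L a) ?_
  rw [m.b_eq_sum_rho hL ha hM, m'.b_eq_sum_rho hL ha hM, lie_sum_rho]
  simp [hindex]

theorem b_lie_bDag (hL : 0 < L) (ha : 0 < a) (hM : L = M * a) (m m' : BosonMode L a) :
    ⁅b m, bDag m'⁆ = open Classical in if m = m' then 1 else 0 := by
  classical
  have := finite_lattice (L := L) ha
  have := Fintype.ofFinite (lattice L a)
  rw [m.b_eq_sum_rho hL ha hM, m'.bDag_eq_sum_rho hL ha hM, lie_sum_rho]
  by_cases h : m.chirality = m'.chirality ∧ m.s = m'.s ∧ m.α = m'.α ∧ m.index = m'.index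
  · obtain ⟨hchirality, hs, hα, hindex⟩ := h
    have hn : (m.index : ℂ) ≠ 0 := by exact_mod_cast m.index_pos.ne'
    have hprefactor : m.prefactor = m'.prefactor := by
      rw [BosonMode.prefactor, BosonMode.prefactor, hchirality, m.abs_ps hL, m'.abs_ps hL, hindex]
    have hflavor : ∀ x y, m.flavor x = m'.flavor y ∧ m.index + -m'.index = 0 ↔ x = y :=
      fun x y => by simp [BosonMode.flavor, hchirality, hs, hα, hindex]
    have hmode : m'.transverse = m.transverse ↔ m = m' :=
      ⟨fun h => BosonMode.eq_of_chirality_eq_of_index_eq hL hchirality hs hα hindex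
        (congrArg Subtype.val h.symm), fun h => by rw [h]⟩
    simp only [hflavor, mul_ite, mul_zero, Finset.sum_ite_eq, Finset.mem_univ, if_true]
    rw [← Finset.sum_mul, BosonMode.sum_coeff_mul_conj hL ha hM hprefactor, if_congr hmode rfl rfl]
    split_ifs <;> simp [hn]
  · have hflavor : ∀ x y, ¬(m.flavor x = m'.flavor y ∧ m.index + -m'.index = 0) :=
      fun x y hxy => h (by
        simp only [BosonMode.flavor, Flavor.mk.injEq] at hxy
        exact ⟨hxy.1.1, hxy.1.2.1, hxy.1.2.2.1, by omega⟩)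
    rw [if_neg fun hm => h (by simp [hm])]
    simp [hflavor]

theorem commute_zeroMode_bDag (hL : 0 < L) (ha : 0 < a) (hM : L = M * a) (f : Flavor L a)
    (m : BosonMode L a) : Commute (zeroMode f) (bDag m) := by
  classical
  have := finite_lattice (L := L) ha
  have := Fintype.ofFinite (lattice L a)
  rw [zeroMode_eq_rho hL ha hM, m.bDag_eq_sum_rho hL ha hM]
  refine Commute.sum_right _ _ _ fun x _ => Commute.smul_right ?_ _
  refine commute_of_lie_eq_zero (A := Op L a) ?_
  rw [rho_lie_rho]
  simp

theorem isAdj_zeroMode (hL : 0 < L) (ha : 0 < a) (hM : L = M * a) (f : Flavor L a) :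
    IsAdj (zeroMode f) (zeroMode f) := by
  rw [zeroMode_eq_rho hL ha hM]
  exact isAdj_rho _ _ 0

end Commutators

section Inversion

variable {L a : ℝ} {M : ℕ}

/-- The boson mode with flavor indices `r`, `s`, `α` and momentum `p_s = 2π r n / L`,
`p_{-s} = q`. -/
def bosonMode (hL : 0 < L) (f : Flavor L a) {n : ℤ} (hn : 0 < n) (q : zeroModeMomenta L a) :
    BosonMode L a :=
  ⟨f.s, f.α, densityMomentum L f.r f.s n q, exists_densityMomentum_eq f.r f.s n q, by
    rw [densityMomentum_neg]
    exact q.2.2, by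
    have hr : ((f.r : ℤ) : ℝ) ≠ 0 := left_ne_zero_of_mul_eq_one (units_cast_mul_self f.r)
    have : (0 : ℝ) < n := by exact_mod_cast hn
    rw [densityMomentum_self]
    positivity⟩

theorem bosonMode_chirality (hL : 0 < L) (f : Flavor L a) {n : ℤ} (hn : 0 < n)
    (q : zeroModeMomenta L a) : (bosonMode hL f hn q).chirality = f.r := by
  have hps : (bosonMode hL f hn q).ps = ((f.r : ℤ) : ℝ) * (2 * Real.pi / L * n) :=
    densityMomentum_self ..
  have hp : 0 < 2 * Real.pi / L * (n : ℝ) := by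
    have : (0 : ℝ) < n := by exact_mod_cast hn
    positivity
  rw [BosonMode.chirality, hps]
  rcases Int.units_eq_one_or f.r with h | h
  · rw [h, if_pos (by simpa using hp)]
  · rw [h, if_neg (by push_cast; linarith)]

theorem rho_mem_span_b (hL : 0 < L) (ha : 0 < a) (hM : L = M * a) (f : Flavor L a) {n : ℤ}
    (hn : 0 < n) : rho (levels a hL) f n ∈ Submodule.span ℂ (Set.range (b (L := L) (a := a))) := by
  have := Fintype.ofEquiv _ (zeroModeEquiv hL hM)
  rw [rho_eq_sum_density hL ha hM]
  refine Submodule.sum_mem _ fun q _ => Submodule.smul_mem _ _ ?_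
  have hb := (bosonMode hL f hn q).b_eq_smul_density
  rw [bosonMode_chirality] at hb
  exact (Submodule.smul_mem_iff _ ((bosonMode hL f hn q).prefactor_ne_zero hL ha)).1
    (hb ▸ Submodule.subset_span ⟨_, rfl⟩)

theorem rho_neg_mem_span_bDag (hL : 0 < L) (ha : 0 < a) (hM : L = M * a) (f : Flavor L a) {n : ℤ}
    (hn : 0 < n) :
    rho (levels a hL) f (-n) ∈ Submodule.span ℂ (Set.range (bDag (L := L) (a := a))) := by
  have key : ∀ T ∈ Submodule.span ℂ (Set.range (b (L := L) (a := a))),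
      ∃ T' ∈ Submodule.span ℂ (Set.range bDag), IsAdj T T' := fun T hT => by
    induction hT using Submodule.span_induction with
    | mem T h =>
      obtain ⟨m, rfl⟩ := h
      exact ⟨bDag m, Submodule.subset_span ⟨m, rfl⟩, isAdj_b hL ha m⟩
    | zero => exact ⟨0, Submodule.zero_mem _, IsAdj.zero⟩
    | add T U _ _ hT hU =>
      obtain ⟨T', hT', hTT'⟩ := hT
      obtain ⟨U', hU', hUU'⟩ := hU
      exact ⟨T' + U', Submodule.add_mem _ hT' hU', hTT'.add hUU'⟩
    | smul z T _ hT =>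
      obtain ⟨T', hT', hTT'⟩ := hT
      exact ⟨_, Submodule.smul_mem _ (starRingEnd ℂ z) hT', hTT'.smul z⟩
  obtain ⟨T', hT', h⟩ := key _ (rho_mem_span_b hL ha hM f hn)
  exact (isAdj_rho (levels a hL) f n).unique h ▸ hT'

end Inversion

/-! ### Completeness -/

section

variable {L a : ℝ} {M : ℕ}

theorem isBosonic (hL : 0 < L) (ha : 0 < a) (hM : L = M * a) :
    IsBosonic (b (L := L) (a := a)) bDag :=
  ⟨isAdj_b hL ha, commute_b_b hL ha hM, b_lie_bDag hL ha hM⟩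

theorem bosonProduct_coe (N : BosonMode L a →₀ ℕ) : bosonProduct ⇑N = monomial bDag N := by
  have h : (Function.support ⇑N).Finite := N.hasFiniteSupport
  have hN : h.toFinset = N.support := by
    ext m
    simp
  rw [bosonProduct, dif_pos h, hN]
  rfl

theorem finite_flavor (ha : 0 < a) : Finite (Flavor L a) := by
  have := finite_lattice (L := L) ha
  refine Finite.of_injective (fun f : Flavor L a => (f.r, f.s, f.α, f.x)) fun f f' h => ?_
  simp only [Prod.mk.injEq] at h
  exact Flavor.ext h.1 h.2.1 h.2.2.1 h.2.2.2

theorem b_eq_zero_of_rho_eq_zero (hL : 0 < L) (ha : 0 < a) (hM : L = M * a)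
    {v : Core (Mode L a)} (h : ∀ f n, 0 < n → rho (levels a hL) f n v = 0) (m : BosonMode L a) :
    b m v = 0 := by
  have := finite_lattice (L := L) ha
  have := Fintype.ofFinite (lattice L a)
  rw [m.b_eq_sum_rho hL ha hM, LinearMap.sum_apply]
  exact Finset.sum_eq_zero fun x _ => by
    rw [LinearMap.smul_apply, h _ _ m.index_pos, smul_zero]

theorem rho_eq_zero_of_b_eq_zero (hL : 0 < L) (ha : 0 < a) (hM : L = M * a)
    {v : Core (Mode L a)} (h : ∀ m, b m v = 0) (f : Flavor L a) {n : ℤ} (hn : 0 < n) :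
    rho (levels a hL) f n v = 0 := by
  have hle : Submodule.span ℂ (Set.range b) ≤ LinearMap.ker (LinearMap.applyₗ (R := ℂ) v) :=
    Submodule.span_le.2 <| Set.range_subset_iff.2 h
  exact hle (rho_mem_span_b hL ha hM f hn)

theorem rho_neg_mem_of_bDag_mem (hL : 0 < L) (ha : 0 < a) (hM : L = M * a)
    {W : Submodule ℂ (Core (Mode L a))} (hW : ∀ m, ∀ v ∈ W, bDag m v ∈ W) (f : Flavor L a) {n : ℤ}
    (hn : 0 < n) {v : Core (Mode L a)} (hv : v ∈ W) : rho (levels a hL) f (-n) v ∈ W := by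
  have hle : Submodule.span ℂ (Set.range bDag) ≤ W.comap (LinearMap.applyₗ (R := ℂ) v) :=
    Submodule.span_le.2 <| Set.range_subset_iff.2 fun m => hW m v hv
  exact hle (rho_neg_mem_span_bDag hL ha hM f hn)

/-- A family of normalized states without bosons, labelled by their charges. -/
structure IsGroundFamily (g : (Flavor L a → ℤ) → Core (Mode L a)) : Prop where
  b_eq_zero : ∀ ν m, b m (g ν) = 0
  zeroMode_eq : ∀ ν f, zeroMode f (g ν) = (((f.r : ℤ) : ℂ) * (ν f : ℂ)) • g ν
  norm_eq_one : ∀ ν, ‖toSpace (g ν)‖ = 1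

namespace IsGroundFamily

variable {g : (Flavor L a → ℤ) → Core (Mode L a)}

theorem zeroMode_monomial (hg : IsGroundFamily g) (hL : 0 < L) (ha : 0 < a) (hM : L = M * a)
    (N : BosonMode L a →₀ ℕ) (ν : Flavor L a → ℤ) (f : Flavor L a) :
    zeroMode f (monomial bDag N (g ν)) =
      (((f.r : ℤ) : ℂ) * (ν f : ℂ)) • monomial bDag N (g ν) := by
  have hcomm : Commute (zeroMode f) (monomial bDag N) :=
    commute_monomial (commute_zeroMode_bDag hL ha hM f)
  refine (congrArg (fun T : Op L a => T (g ν)) hcomm.eq).trans ?_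
  rw [Module.End.mul_apply, hg.zeroMode_eq, map_smul]

theorem inner_eq_zero (hg : IsGroundFamily g) (hL : 0 < L) (ha : 0 < a) (hM : L = M * a)
    {ν ν' : Flavor L a → ℤ} (h : ν ≠ ν') : inner ℂ (toSpace (g ν)) (toSpace (g ν')) = (0 : ℂ) := by
  obtain ⟨f, hf⟩ := Function.ne_iff.1 h
  have hr : ((f.r : ℤ) : ℝ) ≠ 0 := left_ne_zero_of_mul_eq_one (units_cast_mul_self f.r)
  refine inner_eq_zero_of_eigenvectors (isAdj_zeroMode hL ha hM f)
    (x := (f.r : ℤ) * ν f) (y := (f.r : ℤ) * ν' f) ?_ ?_ fun heq =>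
      hf (by exact_mod_cast mul_left_cancel₀ hr heq)
  · exact_mod_cast hg.zeroMode_eq ν f
  · exact_mod_cast hg.zeroMode_eq ν' f

theorem orthonormal (hg : IsGroundFamily g) (hL : 0 < L) (ha : 0 < a) (hM : L = M * a) :
    Orthonormal ℂ fun q : (BosonMode L a →₀ ℕ) × (Flavor L a → ℤ) =>
      toSpace (monomial bDag q.1 (g q.2)) := by
  have hb := isBosonic hL ha hM
  refine ⟨fun ⟨N, ν⟩ => ?_, ?_⟩
  · rw [norm_eq_sqrt_re_inner (𝕜 := ℂ), hb.inner_monomial_self (hg.b_eq_zero ν),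
      ← norm_eq_sqrt_re_inner, hg.norm_eq_one]
  · rintro ⟨N, ν⟩ ⟨N', ν'⟩ h
    by_cases hN : N = N'
    · subst hN
      have hν : ν ≠ ν' := fun hν => h (by rw [hν])
      exact (hb.inner_monomial_self (hg.b_eq_zero ν') N _).trans (hg.inner_eq_zero hL ha hM hν)
    · exact hb.inner_monomial_of_ne (hg.b_eq_zero ν) (hg.b_eq_zero ν') hN

theorem exists_eq_smul_ket (hg : IsGroundFamily g) (hL : 0 < L) (ha : 0 < a) (hM : L = M * a)
    {S : Finset (Mode L a)} {μ : Flavor L a → ℤ}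
    (hS : ∀ f j, Filled (levels a hL) S f j ↔ j < μ f) : ∃ ν, ∃ z : ℂ, z ≠ 0 ∧ g ν = z • ket S := by
  have := finite_flavor (L := L) ha
  set ν : Flavor L a → ℤ := fun f => f.r * μ f with hν
  have hket : g ν = g ν S • ket S := by
    refine eq_smul_ket_of_rho_eq_zero
      (fun f n hn => rho_eq_zero_of_b_eq_zero hL ha hM (hg.b_eq_zero ν) f hn) (fun f => ?_) hS
    have hr : ((f.r : ℤ) : ℂ) * (f.r : ℤ) = 1 := by exact_mod_cast units_cast_mul_self f.r
    rw [← zeroMode_eq_rho hL ha hM, hg.zeroMode_eq, hν, Int.cast_mul, ← mul_assoc, hr, one_mul]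
  refine ⟨ν, g ν S, fun hz => ?_, hket⟩
  have hnorm := hg.norm_eq_one ν
  rw [hket, hz, zero_smul, map_zero, norm_zero] at hnorm
  exact zero_ne_one hnorm

theorem span_eq_top (hg : IsGroundFamily g) (hL : 0 < L) (ha : 0 < a) (hM : L = M * a) :
    Submodule.span ℂ (Set.range fun q : (BosonMode L a →₀ ℕ) × (Flavor L a → ℤ) =>
      monomial bDag q.1 (g q.2)) = ⊤ := by
  have := finite_flavor (L := L) ha
  set W := Submodule.span ℂ (Set.range fun q : (BosonMode L a →₀ ℕ) × (Flavor L a → ℤ) =>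
    monomial bDag q.1 (g q.2))
  have hmem (N ν) : monomial bDag N (g ν) ∈ W := Submodule.subset_span ⟨(N, ν), rfl⟩
  have hbDag (m : BosonMode L a) : W ≤ W.comap (bDag m) := by
    refine Submodule.span_le.2 <| Set.range_subset_iff.2 fun ⟨N, ν⟩ => ?_
    change bDag m (monomial bDag N (g ν)) ∈ W
    rw [(isBosonic hL ha hM).creation_monomial]
    exact W.smul_mem _ (hmem _ _)
  refine eq_top_of_rho_invariant
    (fun f n hn v hv => rho_neg_mem_of_bDag_mem hL ha hM (fun m => hbDag m) f hn hv)
    fun S μ hS => ?_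
  obtain ⟨ν, z, hz, hket⟩ := hg.exists_eq_smul_ket hL ha hM hS
  have hground := hmem 0 ν
  rw [monomial_zero, Module.End.one_apply, hket] at hground
  exact (W.smul_mem_iff hz).1 hground

end IsGroundFamily

end

/-! ### Charge shifts and occupation number states -/

section

variable {L a : ℝ} {M : ℕ}

/-- The relations of the Klein factors with the boson operators and the zero modes: the unitary
operator `R f` leaves the bosons alone and shifts the charge of flavor `f` by `f.r`. -/
structure IsChargeShift (R : Flavor L a → CoreUnitary (Mode L a)) : Prop where
  commute_b : ∀ f m, Commute (b m) (R f).toEnd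
  raises : ∀ f f', RaisesBy (zeroMode f) (R f').onCore
    (open Classical in if f = f' then ((f.r : ℤ) : ℂ) else 0)

theorem IsKleinFamily.isChargeShift {R : Flavor L a → CoreUnitary (Mode L a)}
    (hR : IsKleinFamily R) : IsChargeShift R where
  commute_b := hR.commute_b
  raises f f' := by
    refine raisesBy_iff.2 ((hR.zeroMode_commutator f f').trans ?_)
    split_ifs with h
    · rw [h]
      rfl
    · rw [zero_smul]

namespace IsChargeShift

variable {R : Flavor L a → CoreUnitary (Mode L a)}

theorem b_apply_list_prod (hR : IsChargeShift R) (hL : 0 < L) (ha : 0 < a) (hM : L = M * a)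
    (o : List (Flavor L a)) (ν : Flavor L a → ℤ) (m : BosonMode L a) :
    b m ((o.map fun f => (R f).onCore ^ ν f).prod vacuum) = 0 := by
  have hraises (f : Flavor L a) : RaisesBy (b m) ((R f).onCore ^ ν f) (ν f * (0 : ℂ)) :=
    (raisesBy_zero_iff.2 (hR.commute_b f m)).zpow (ν f)
  have hvacuum : b m vacuum = 0 :=
    b_eq_zero_of_rho_eq_zero hL ha hM (fun f n hn => rho_vacuum _ f hn.le) m
  rw [RaisesBy.list_prod hraises o, hvacuum, map_zero, zero_add]
  simp

theorem zeroMode_apply_list_prod (hR : IsChargeShift R) (hL : 0 < L) (ha : 0 < a) (hM : L = M * a)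
    {o : List (Flavor L a)} (ho : o.Nodup) (hmem : ∀ f, f ∈ o) (ν : Flavor L a → ℤ)
    (f : Flavor L a) : zeroMode f ((o.map fun f' => (R f').onCore ^ ν f').prod vacuum) =
      (((f.r : ℤ) : ℂ) * (ν f : ℂ)) • (o.map fun f' => (R f').onCore ^ ν f').prod vacuum := by
  classical
  have hraises (f' : Flavor L a) := (hR.raises f f').zpow (ν f')
  have hsum : (o.map fun f' => (ν f' : ℂ) * if f = f' then ((f.r : ℤ) : ℂ) else 0).sum =
      ((f.r : ℤ) : ℂ) * (ν f : ℂ) := by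
    rw [List.sum_map_eq_nsmul_single f _ fun f' hf' _ => by rw [if_neg hf'.symm, mul_zero],
      List.count_eq_one_of_mem ho (hmem f), one_nsmul, if_pos rfl, mul_comm]
  have hvacuum : zeroMode f vacuum = 0 := by
    rw [zeroMode_eq_rho hL ha hM, rho_vacuum _ f le_rfl]
  rw [RaisesBy.list_prod hraises o, hvacuum, map_zero, zero_add, hsum]

theorem isGroundFamily (hR : IsChargeShift R) (hL : 0 < L) (ha : 0 < a) (hM : L = M * a)
    {o : List (Flavor L a)} (ho : o.Nodup) (hmem : ∀ f, f ∈ o) :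
    IsGroundFamily fun ν => (o.map fun f => (R f).onCore ^ ν f).prod vacuum where
  b_eq_zero ν m := hR.b_apply_list_prod hL ha hM o ν m
  zeroMode_eq ν f := hR.zeroMode_apply_list_prod hL ha hM ho hmem ν f
  norm_eq_one ν := by
    have hprod : (o.map fun f => (R f).onCore ^ ν f).prod ∈ coreIsometries (Mode L a) :=
      Subgroup.list_prod_mem _ fun φ hφ => by
        obtain ⟨f, -, rfl⟩ := List.mem_map.1 hφ
        exact zpow_mem (R f).onCore_mem_coreIsometries _
    exact (hprod vacuum).trans (norm_toSpace_ket ∅)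

end IsChargeShift

theorem mem_occupations (ha : 0 < a) (N : BosonMode L a →₀ ℕ) (ν : Flavor L a → ℤ) :
    (⇑N, ν) ∈ occupations L a := by
  have := finite_flavor (L := L) ha
  refine ⟨.of_finite, summable_of_hasFiniteSupport (N.hasFiniteSupport.subset fun m hm => ?_)⟩
  exact Nat.cast_ne_zero.1 (right_ne_zero_of_mul hm)

/-- As the momenta `|p_s|` are bounded below by `2π / L` and there are finitely many flavors,
`occupations L a` consists of all pairs `(n, ν)` with `n` of finite support. -/
def occupationsEquiv (hL : 0 < L) (ha : 0 < a) :
    occupations L a ≃ (BosonMode L a →₀ ℕ) × (Flavor L a → ℤ) where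
  toFun q := (Finsupp.ofSupportFinite q.1.1 (finite_support_occupations hL q), q.1.2)
  invFun q := ⟨(⇑q.1, q.2), mem_occupations ha q.1 q.2⟩
  left_inv _ := rfl
  right_inv _ := Prod.ext (Finsupp.ext fun _ => rfl) rfl

theorem η_eq_monomial (hL : 0 < L) (ha : 0 < a) (R : Flavor L a → CoreUnitary (Mode L a))
    (o : List (Flavor L a)) (q : occupations L a) : η R o q.1.1 q.1.2 =
      monomial bDag (occupationsEquiv hL ha q).1
        ((o.map fun f => (R f).onCore ^ (occupationsEquiv hL ha q).2 f).prod vacuum) :=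
  congrArg (fun T : Op L a => T _) (bosonProduct_coe (occupationsEquiv hL ha q).1)

section IsChargeShift

variable {R : Flavor L a → CoreUnitary (Mode L a)} (hR : IsChargeShift R) (hL : 0 < L) (ha : 0 < a)
  (hM : L = M * a) {o : List (Flavor L a)} (ho : o.Nodup) (hmem : ∀ f, f ∈ o)
include hR hL ha hM ho hmem

theorem orthonormal_η : Orthonormal ℂ fun q : occupations L a => toSpace (η R o q.1.1 q.1.2) := by
  simp only [η_eq_monomial hL ha]
  exact ((hR.isGroundFamily hL ha hM ho hmem).orthonormal hL ha hM).comp _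
    (occupationsEquiv hL ha).injective

theorem topologicalClosure_span_η_eq_top : (Submodule.span ℂ (Set.range fun q : occupations L a =>
    toSpace (η R o q.1.1 q.1.2))).topologicalClosure = ⊤ := by
  refine topologicalClosure_span_toSpace_eq_top
    (v := fun q : occupations L a => η R o q.1.1 q.1.2) ?_
  rw [← (hR.isGroundFamily hL ha hM ho hmem).span_eq_top hL ha hM,
    ← (occupationsEquiv hL ha).surjective.range_comp]
  simp only [η_eq_monomial hL ha]
  rfl

theorem zeroMode_η (q : occupations L a) (f : Flavor L a) : zeroMode f (η R o q.1.1 q.1.2) =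
    (((f.r : ℤ) : ℂ) * (q.1.2 f : ℂ)) • η R o q.1.1 q.1.2 := by
  rw [η_eq_monomial hL ha]
  exact (hR.isGroundFamily hL ha hM ho hmem).zeroMode_monomial hL ha hM _ _ f

theorem number_η (q : occupations L a) (m : BosonMode L a) :
    bDag m (b m (η R o q.1.1 q.1.2)) = (q.1.1 m : ℂ) • η R o q.1.1 q.1.2 := by
  rw [η_eq_monomial hL ha]
  exact (isBosonic hL ha hM).number_monomial
    ((hR.isGroundFamily hL ha hM ho hmem).b_eq_zero _) _ m

end IsChargeShift

/-! ### Existence of Klein factors -/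

theorem exists_isGroundFamily (hL : 0 < L) (ha : 0 < a) (hM : L = M * a) :
    ∃ g : (Flavor L a → ℤ) → Core (Mode L a), IsGroundFamily g := by
  have := finite_flavor (L := L) ha
  choose S hS using fun ν : Flavor L a → ℤ =>
    exists_filled_iff_lt (levels a hL) fun f => (f.r : ℤ) * ν f
  refine ⟨fun ν => ket (S ν), fun ν m => ?_, fun ν f => ?_, fun ν => norm_toSpace_ket _⟩
  · exact b_eq_zero_of_rho_eq_zero hL ha hM (fun f n hn => rho_ket_eq_zero (hS ν f) hn) m
  · rw [zeroMode_eq_rho hL ha hM, rho_zero_ket _ (hS ν f), Int.cast_mul]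

/-- The basis of the core consisting of the states with definite occupation numbers. -/
def occupationBasis (hL : 0 < L) (ha : 0 < a) (hM : L = M * a)
    {g : (Flavor L a → ℤ) → Core (Mode L a)} (hg : IsGroundFamily g) :
    Module.Basis ((BosonMode L a →₀ ℕ) × (Flavor L a → ℤ)) ℂ (Core (Mode L a)) :=
  .mk (.of_comp toSpace (hg.orthonormal hL ha hM).linearIndependent) (hg.span_eq_top hL ha hM).ge

theorem occupationBasis_apply (hL : 0 < L) (ha : 0 < a) (hM : L = M * a)
    {g : (Flavor L a → ℤ) → Core (Mode L a)} (hg : IsGroundFamily g)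
    (q : (BosonMode L a →₀ ℕ) × (Flavor L a → ℤ)) :
    occupationBasis hL ha hM hg q = monomial bDag q.1 (g q.2) := by
  rw [occupationBasis, Module.Basis.mk_apply]

theorem isKleinFamily_kleinFactor (hL : 0 < L) (ha : 0 < a) (hM : L = M * a)
    [Fintype (Flavor L a)] [LinearOrder (Flavor L a)]
    {g : (Flavor L a → ℤ) → Core (Mode L a)} (hg : IsGroundFamily g)
    (hE : Orthonormal ℂ fun q => toSpace (occupationBasis hL ha hM hg q)) :
    IsKleinFamily (kleinFactor hE) := by
  have hbDag (f : Flavor L a) (m : BosonMode L a) :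
      Commute (bDag m) (kleinFactor hE f).toEnd := by
    refine commute_kleinFactor hE (τ := (· + Finsupp.single m 1))
      (z := fun N => ((√((N m : ℝ) + 1) : ℝ) : ℂ)) (fun N ν => ?_) f
    rw [occupationBasis_apply, (isBosonic hL ha hM).creation_monomial, occupationBasis_apply]
  refine ⟨fun f m => (kleinFactor hE f).commute_of_isAdj (isAdj_b hL ha m) (hbDag f m), hbDag,
    fun f f' => ?_, fun f f' => ?_⟩
  · have hraises := raisesBy_kleinFactor hE (f := f') (x := fun ν => ((f.r : ℤ) : ℂ) * (ν f : ℂ))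
      (z := if f = f' then ((f.r : ℤ) : ℂ) else 0) (T := zeroMode f) (fun N ν => ?_) fun ν => ?_
    · refine (raisesBy_iff.1 hraises).trans ?_
      split_ifs with h
      · rw [h]
        rfl
      · exact zero_smul ..
    · rw [occupationBasis_apply, hg.zeroMode_monomial hL ha hM]
    · rw [Pi.add_apply, Pi.single_apply]
      split_ifs <;> simp [mul_add]
  · convert kleinFactor_anticommutator hE f f'

theorem exists_isKleinFamily (hL : 0 < L) (ha : 0 < a) (hM : L = M * a) :
    ∃ R : Flavor L a → CoreUnitary (Mode L a), IsKleinFamily R := by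
  have := finite_flavor (L := L) ha
  have := Fintype.ofFinite (Flavor L a)
  obtain ⟨n, ⟨order⟩⟩ := Finite.exists_equiv_fin (Flavor L a)
  have := LinearOrder.lift' order order.injective
  obtain ⟨g, hg⟩ := exists_isGroundFamily hL ha hM
  have hE : Orthonormal ℂ fun q => toSpace (occupationBasis hL ha hM hg q) := by
    simpa only [occupationBasis_apply] using hg.orthonormal hL ha hM
  exact ⟨_, isKleinFamily_kleinFactor hL ha hM hg hE⟩

end

end Nodal

end

theorem lemmaC2_general (L a : ℝ) (hL : 0 < L) (ha : 0 < a) (hLa : ∃ M : ℕ, L = M * a) :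
    (∃ R : Nodal.Flavor L a → Fock.CoreUnitary (Nodal.Mode L a), Nodal.IsKleinFamily R) ∧
    ∀ R : Nodal.Flavor L a → Fock.CoreUnitary (Nodal.Mode L a), Nodal.IsChargeShift R →
    ∀ o : List (Nodal.Flavor L a), o.Nodup → (∀ f, f ∈ o) →
      (Orthonormal ℂ (fun q : Nodal.occupations L a => Fock.toSpace (Nodal.η R o q.1.1 q.1.2)) ∧
        (Submodule.span ℂ (Set.range fun q : Nodal.occupations L a =>
          Fock.toSpace (Nodal.η R o q.1.1 q.1.2))).topologicalClosure = ⊤) ∧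
      ∀ q : Nodal.occupations L a,
        (∀ f : Nodal.Flavor L a, Nodal.zeroMode f (Nodal.η R o q.1.1 q.1.2) =
          (((f.r : ℤ) : ℂ) * (q.1.2 f : ℂ)) • Nodal.η R o q.1.1 q.1.2) ∧
        ∀ m : Nodal.BosonMode L a, Nodal.bDag m (Nodal.b m (Nodal.η R o q.1.1 q.1.2)) =
          (q.1.1 m : ℂ) • Nodal.η R o q.1.1 q.1.2 := by
  obtain ⟨M, hM⟩ := hLa
  exact ⟨Nodal.exists_isKleinFamily hL ha hM, fun R hR o ho hmem =>
    ⟨⟨Nodal.orthonormal_η hR hL ha hM ho hmem,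
      Nodal.topologicalClosure_span_η_eq_top hR hL ha hM ho hmem⟩,
    fun q => ⟨Nodal.zeroMode_η hR hL ha hM ho hmem q, Nodal.number_η hR hL ha hM ho hmem q⟩⟩⟩

theorem lemmaC2 (L a : ℝ) (hL : 0 < L) (ha : 0 < a) (hLa : ∃ M : ℕ, L = M * a) :
    -- (a) existence of Klein factors
    (∃ R : Nodal.Flavor L a → Fock.CoreUnitary (Nodal.Mode L a), Nodal.IsKleinFamily R) ∧
    -- (b), (c) for every family of Klein factors and every ordering `o` of their product
    ∀ R : Nodal.Flavor L a → Fock.CoreUnitary (Nodal.Mode L a), Nodal.IsKleinFamily R →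
    ∀ o : List (Nodal.Flavor L a), o.Nodup → (∀ f, f ∈ o) →
      (Orthonormal ℂ (fun q : Nodal.occupations L a => Fock.toSpace (Nodal.η R o q.1.1 q.1.2)) ∧
        (Submodule.span ℂ (Set.range fun q : Nodal.occupations L a =>
          Fock.toSpace (Nodal.η R o q.1.1 q.1.2))).topologicalClosure = ⊤) ∧
      ∀ q : Nodal.occupations L a,
        (∀ f : Nodal.Flavor L a, Nodal.zeroMode f (Nodal.η R o q.1.1 q.1.2) =
          (((f.r : ℤ) : ℂ) * (q.1.2 f : ℂ)) • Nodal.η R o q.1.1 q.1.2) ∧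
        ∀ m : Nodal.BosonMode L a, Nodal.bDag m (Nodal.b m (Nodal.η R o q.1.1 q.1.2)) =
          (q.1.1 m : ℂ) • Nodal.η R o q.1.1 q.1.2 :=
  (lemmaC2_general L a hL ha hLa).imp_right fun h R hR => h R hR.isChargeShift
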